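/- Fix a commutative ring $\mathbf{k}$, an abelian group $\Gamma$, a symmetric bilinear form $\langle\cdot,\cdot\rangle\colon\Gamma\times\Gamma\to\mathbb{Z}/2$ and an element $\iota\in\Gamma$ with $\langle\iota,\iota\rangle=1$. A dg $\mathbf{k}$-module is a $\Gamma$-graded $\mathbf{k}$-module with a differential of degree $\iota$; tensor products are formed with the Koszul sign rule $(f\otimes g)(m\otimes n)=(-1)^{\langle |g|,|m|\rangle}f(m)\otimes g(n)$. Let $\mathcal C$ be a dg category (a category enriched in dg $\mathbf{k}$-modules), and write $\langle X|\mathcal C|Y\rangle=\mathrm{Hom}_{\mathcal C}(Y,X)$. The suspended envelope $\mathrm{SB}(\mathcal C)$ is the dg category with objects $q^iX$ ($i\in\Gamma$, $X\in\mathcal C$) and $\mathrm{Hom}^l_{\mathrm{SB}(\mathcal C)}(q^iX,q^jY)=\mathrm{Hom}^{l+i-j}_{\mathcal C}(X,Y)$; the morphism $q^iX\to q^jY$ corresponding to $f\colon X\to Y$ is written $f^j_i$, composition is that of $\mathcal C$, and $d(f^j_i)=(-1)^{\langle\iota,j\rangle}(d f)^j_i$. It contains $\mathcal C$ as a full dg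 subcategory via $X\mapsto q^0X$, and we put $\phi_{X,i}=(\mathrm{id}_X)^i_0\colon X\to q^iX$, with inverse $\phi_{X,i}^{-1}=(\mathrm{id}_X)^0_i$. For a dg category $\mathcal D$, the two-sided bar complex $\mathrm{Bar}(\mathcal D)$ is the $(\mathcal D,\mathcal D)$-bimodule with $$\langle Y|\mathrm{Bar}(\mathcal D)|Y'\rangle=\bigoplus_{r\ge 0}q^{-r\iota}\bigoplus_{X_0,\dots,X_r}\langle Y|\mathcal D|X_0\rangle\otimes\langle X_0|\mathcal D|X_1\rangle\otimes\cdots\otimes\langle X_r|\mathcal D|Y'\rangle,$$ where $(q^jM)^i=M^{i-j}$. Write $[f_0,\dots,f_{r+1}]=f_0\otimes\cdots\otimes f_{r+1}$. The actions are $$g\cdot[f_0,\dots,f_{r+1}]\cdot g'=(-1)^{r\langle\iota,|g|\rangle}[g\circ f_0,f_1,\dots,f_r,f_{r+1}\circ g'],$$ and the differential is $$d[f_0,\dots,f_{r+1}]=\sum_{i=0}^{r+1}(-1)^{r+k_0+\cdots+k_{i-1}}[f_0,\dots,d(f_i),\dots,f_{r+1}]+\sum_{i=0}^{r}(-1)^i[f_0,\dots,f_i\circ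 f_{i+1},\dots,f_{r+1}],$$ where $k_i=\langle\iota,|f_i|\rangle$ and the second sum is omitted if $r=0$. A morphism of bimodules of degree $l$ is a family of degree $l$ linear maps $F$ with $F(g\cdot m\cdot g')=(-1)^{\langle l,|g|\rangle}g\cdot F(m)\cdot g'$; with the differential $d(F)=d\circ F-(-1)^{\langle\iota,l\rangle}F\circ d$ bimodules form a dg category. The tensor product $M\otimes_{\mathcal C}N$ is the quotient of $\bigoplus_Y\langle X|M|Y\rangle\otimes\langle Y|N|Z\rangle$ by the relations $mf\otimes n=m\otimes fn$. **Lemma.** There is a unique family of linear maps $\Xi_{\mathrm{SB}}\colon\langle q^jY|\mathrm{Bar}(\mathrm{SB}(\mathcal C))|q^{j'}Y'\rangle\to\langle q^jY|\mathrm{SB}(\mathcal C)\otimes_{\mathcal C}\mathrm{Bar}(\mathcal C)\otimes_{\mathcal C}\mathrm{SB}(\mathcal C)|q^{j'}Y'\rangle$ such that, for every $r\ge 0$ and every composable sequence $\mathbf f_u=(f_u)^{i_{u-1}}_{i_u}$, $0\le u\le r+1$, of morphisms of $\mathrm{SB}(\mathcal C)$ running from $q^{i_{r+1}}X_{r+1}=q^{j'}Y'$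 to $q^{i_{-1}}X_{-1}=q^jY$, $$\Xi_{\mathrm{SB}}([\mathbf f_0,\mathbf f_1,\dots,\mathbf f_{r+1}])=(-1)^{r\langle\iota,j\rangle}\,\phi_{Y,j}\cdot[f_0,f_1,\dots,f_{r+1}]\cdot\phi_{Y',j'}^{-1}.$$ It is a closed morphism of $(\mathrm{SB}(\mathcal C),\mathrm{SB}(\mathcal C))$-bimodules of degree zero (a bimodule chain map), and it is a homotopy equivalence in the dg category of bimodules: there are a bimodule chain map $\Theta$ of degree zero in the other direction and bimodule morphisms $h,h'$ of degree $-\iota$ with $\Theta\circ\Xi_{\mathrm{SB}}-\mathrm{id}=d(h)$ and $\Xi_{\mathrm{SB}}\circ\Theta-\mathrm{id}=d(h')$. -/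

import Mathlib

noncomputable section

open scoped TensorProduct

namespace DGEnv

/-- The grading data: an abelian group `Γ` with a symmetric bilinear form to `ℤ/2` and a
distinguished degree `ι` (the degree of all differentials) with `⟨ι, ι⟩ = 1`. -/
structure GradingDatum (Γ : Type*) [AddCommGroup Γ] where
  pair : Γ →+ Γ →+ ZMod 2
  symm : ∀ i j, pair i j = pair j i
  ι : Γ
  pair_ι : pair ι ι = 1

/-- The sign `(-1)^a`, for `a ∈ ℤ/2`, as an element of the ground ring. -/
def sgn (k : Type*) [CommRing k] (a : ZMod 2) : k := (-1) ^ a.val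

section sgn
variable {k : Type*} [CommRing k]

theorem sgn_zero : sgn k 0 = 1 := by simp [sgn]

theorem sgn_one : sgn k 1 = -1 := by
  have : (1 : ZMod 2).val = 1 := rfl
  simp [sgn, this]

theorem sgn_add (a b : ZMod 2) : sgn k (a + b) = sgn k a * sgn k b := by
  have h : ∀ c : ZMod 2, c = 0 ∨ c = 1 := by decide
  have h2 : (1 : ZMod 2) + 1 = 0 := by decide
  rcases h a with rfl | rfl <;> rcases h b with rfl | rfl <;> simp [sgn_zero, sgn_one, h2]

theorem sgn_mul_self (a : ZMod 2) : sgn k a * sgn k a = 1 := by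
  rw [← sgn_add, CharTwo.add_self_eq_zero, sgn_zero]

end sgn

/-- A criterion for independence of a family of submodules. -/
theorem iSupIndep_of_coaction {k : Type*} [CommRing k] {Γ M : Type*} [AddCommGroup M] [Module k M] (deg : Γ → Submodule k M)
    (ρ : M →ₗ[k] Γ →₀ M) (h : ∀ i, ∀ x ∈ deg i, ρ x = Finsupp.single i x) : iSupIndep deg := by
  rw [iSupIndep_def]
  intro i
  rw [Submodule.disjoint_def]
  intro x hx hx'
  have h1 : ρ x i = x := by rw [h i x hx]; simp
  have h2 : (⨆ j, ⨆ (_ : j ≠ i), deg j) ≤ LinearMap.ker (Finsupp.lapply i ∘ₗ ρ) := by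
    refine iSup_le fun j => iSup_le fun hj => fun y hy => ?_
    simp [h j y hy, hj]
  have h3 := h2 hx'
  rw [LinearMap.mem_ker, LinearMap.comp_apply, Finsupp.lapply_apply, h1] at h3
  exact h3

/-- A differential `Γ`-graded `k`-module: a `k`-module which is the (internal) direct sum of its
homogeneous components `deg i`, with a differential of degree `ι`. -/
structure DGModule (k : Type*) [CommRing k] {Γ : Type*} [AddCommGroup Γ]
    (S : GradingDatum Γ) where
  carrier : Type*
  [grp : AddCommGroup carrier]
  [mod : Module k carrier]
  deg : Γ → Submodule k carrier
  indep : iSupIndep deg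
  iSup_deg : ⨆ i, deg i = ⊤
  d : carrier →ₗ[k] carrier
  d_mem : ∀ {i : Γ} {x : carrier}, x ∈ deg i → d x ∈ deg (i + S.ι)
  d_d : ∀ x, d (d x) = 0

attribute [instance] DGModule.grp DGModule.mod

instance {k : Type*} [CommRing k] {Γ : Type*} [AddCommGroup Γ] {S : GradingDatum Γ} :
    CoeSort (DGModule k S) (Type _) := ⟨DGModule.carrier⟩

section DGModule
variable {k : Type*} [CommRing k] {Γ : Type*} [AddCommGroup Γ] {S : GradingDatum Γ}

namespace DGModule

theorem induction (M : DGModule k S) {p : M → Prop} (x : M)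
    (hom : ∀ i, ∀ x ∈ M.deg i, p x) (add : ∀ x y, p x → p y → p (x + y)) : p x :=
  Submodule.iSup_induction M.deg (motive := p) (x := x) (by rw [M.iSup_deg]; trivial)
    hom (hom 0 0 (Submodule.zero_mem _)) add

theorem hom_ext (M : DGModule k S) {N : Type*} [AddCommGroup N] [Module k N] {f g : M →ₗ[k] N}
    (h : ∀ i, ∀ x ∈ M.deg i, f x = g x) (x : M) : f x = g x :=
  M.induction x h fun x y hx hy => by rw [map_add, map_add, hx, hy]

/-- The decomposition of an element of a graded module into its homogeneous components. -/
def components (M : DGModule k S) : M →ₗ[k] Γ →₀ M := by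
  classical
  exact DirectSum.toModule k Γ (Γ →₀ M)
      (fun i => Finsupp.lsingle i ∘ₗ (M.deg i).subtype) ∘ₗ
    (LinearEquiv.ofBijective (DirectSum.coeLinearMap M.deg)
      (DirectSum.isInternal_submodule_of_iSupIndep_of_iSup_eq_top M.indep M.iSup_deg)).symm.toLinearMap

theorem components_of_mem (M : DGModule k S) {i : Γ} {x : M} (hx : x ∈ M.deg i) :
    M.components x = Finsupp.single i x := by
  classical
  have hb := DirectSum.isInternal_submodule_of_iSupIndep_of_iSup_eq_top M.indep M.iSup_deg
  have hb' : Function.Bijective (DirectSum.coeLinearMap M.deg) := hb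
  have : (LinearEquiv.ofBijective (DirectSum.coeLinearMap M.deg) hb').symm x =
      DirectSum.lof k Γ (fun i => M.deg i) i ⟨x, hx⟩ := by
    rw [LinearEquiv.symm_apply_eq, LinearEquiv.ofBijective_apply, DirectSum.coeLinearMap_lof]
  change DirectSum.toModule k Γ (Γ →₀ M) _ ((LinearEquiv.ofBijective _ hb').symm x) = _
  rw [this, DirectSum.toModule_lof]
  simp

/-- The operator that multiplies homogeneous elements `x` by the sign `(-1)^⟨a, |x|⟩`. -/
def signOp (M : DGModule k S) (a : Γ) : M →ₗ[k] M :=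
  Finsupp.lsum k (fun i => sgn k (S.pair a i) • LinearMap.id) ∘ₗ M.components

theorem signOp_of_mem (M : DGModule k S) (a : Γ) {i : Γ} {x : M} (hx : x ∈ M.deg i) :
    M.signOp a x = sgn k (S.pair a i) • x := by
  simp [signOp, M.components_of_mem hx]

theorem signOp_mem (M : DGModule k S) (a : Γ) {i : Γ} {x : M} (hx : x ∈ M.deg i) :
    M.signOp a x ∈ M.deg i := by
  rw [M.signOp_of_mem a hx]; exact Submodule.smul_mem _ _ hx

theorem signOp_d (M : DGModule k S) (a : Γ) (x : M) :
    M.signOp a (M.d x) = sgn k (S.pair a S.ι) • M.d (M.signOp a x) := by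
  refine M.hom_ext (f := M.signOp a ∘ₗ M.d) (g := sgn k (S.pair a S.ι) • M.d ∘ₗ M.signOp a) ?_ x
  intro i x hx
  simp only [LinearMap.comp_apply, LinearMap.smul_apply]
  rw [M.signOp_of_mem a (M.d_mem hx), M.signOp_of_mem a hx, map_add, add_comm, sgn_add, map_smul,
    mul_smul]

theorem signOp_add (M : DGModule k S) (a b : Γ) (x : M) :
    M.signOp (a + b) x = M.signOp a (M.signOp b x) := by
  refine M.hom_ext (f := M.signOp (a + b)) (g := M.signOp a ∘ₗ M.signOp b) ?_ x
  intro i x hx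
  simp only [LinearMap.comp_apply]
  rw [M.signOp_of_mem _ hx, M.signOp_of_mem b hx, map_smul, M.signOp_of_mem a hx, map_add,
    AddMonoidHom.add_apply, sgn_add, mul_comm, mul_smul]

theorem signOp_self (M : DGModule k S) (a : Γ) (x : M) : M.signOp a (M.signOp a x) = x := by
  refine M.hom_ext (f := M.signOp a ∘ₗ M.signOp a) (g := LinearMap.id) ?_ x
  intro i x hx
  simp only [LinearMap.comp_apply, LinearMap.id_apply]
  rw [M.signOp_of_mem a hx, map_smul, M.signOp_of_mem a hx, smul_smul, sgn_mul_self, one_smul]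

/-- The tensor product of dg modules, with differential `d ⊗ id + id ⊗ d` (Koszul sign rule). -/
def tensor (M N : DGModule k S) : DGModule k S where
  carrier := M ⊗[k] N
  deg n := Submodule.span k {t | ∃ i j, ∃ x ∈ M.deg i, ∃ y ∈ N.deg j, i + j = n ∧ t = x ⊗ₜ[k] y}
  indep := by
    refine iSupIndep_of_coaction _ (TensorProduct.lift
      ((LinearMap.compl₁₂ (Finsupp.lsum k fun i => LinearMap.flip (Finsupp.lsum k fun j =>
        LinearMap.flip ((TensorProduct.mk k M N).compr₂ (Finsupp.lsingle (i + j)))))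
        M.components N.components))) ?_
    intro n x hx
    induction hx using Submodule.span_induction with
    | mem x h =>
      obtain ⟨i, j, x, hx, y, hy, rfl, rfl⟩ := h
      simp [M.components_of_mem hx, N.components_of_mem hy]
    | zero => simp
    | add x y _ _ hx hy => rw [map_add, hx, hy, Finsupp.single_add]
    | smul a x _ hx => rw [map_smul, hx, Finsupp.smul_single]
  iSup_deg := by
    rw [eq_top_iff]
    intro t ht
    clear ht
    induction t using TensorProduct.induction_on with
    | zero => exact Submodule.zero_mem _
    | add x y hx hy => exact Submodule.add_mem _ hx hy
    | tmul x y =>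
      induction x using M.induction with
      | hom i x hx =>
        induction y using N.induction with
        | hom j y hy =>
          exact Submodule.mem_iSup_of_mem (i + j)
            (Submodule.subset_span ⟨i, j, x, hx, y, hy, rfl, rfl⟩)
        | add y y' h h' => rw [TensorProduct.tmul_add]; exact Submodule.add_mem _ h h'
      | add x x' h h' => rw [TensorProduct.add_tmul]; exact Submodule.add_mem _ h h'
  d := TensorProduct.map M.d LinearMap.id + TensorProduct.map (M.signOp S.ι) N.d
  d_mem := by
    intro n x hx
    induction hx using Submodule.span_induction with
    | mem x h =>
      obtain ⟨i, j, x, hx, y, hy, rfl, rfl⟩ := h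
      simp only [LinearMap.add_apply, TensorProduct.map_tmul, LinearMap.id_apply]
      exact Submodule.add_mem _
        (Submodule.subset_span ⟨_, _, _, M.d_mem hx, _, hy, by abel, rfl⟩)
        (Submodule.subset_span ⟨_, _, _, M.signOp_mem _ hx, _, N.d_mem hy, by abel, rfl⟩)
    | zero => simp
    | add x y _ _ hx hy => rw [map_add]; exact Submodule.add_mem _ hx hy
    | smul a x _ hx => rw [map_smul]; exact Submodule.smul_mem _ _ hx
  d_d := by
    intro x
    induction x using TensorProduct.induction_on with
    | zero => simp
    | add x y hx hy => rw [map_add, map_add, hx, hy, add_zero]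
    | tmul x y =>
      simp [M.d_d, N.d_d, M.signOp_d, S.pair_ι, sgn_one, TensorProduct.neg_tmul]

/-- The simple tensor `x ⊗ y`, as a bilinear map. -/
def tmul (M N : DGModule k S) : M →ₗ[k] N →ₗ[k] M.tensor N := TensorProduct.mk k M N

/-- The linear map out of a tensor product given by a bilinear map. -/
def lift {M N : DGModule k S} {P : Type*} [AddCommGroup P] [Module k P]
    (f : M →ₗ[k] N →ₗ[k] P) : M.tensor N →ₗ[k] P := TensorProduct.lift f

theorem lift_tmul {M N : DGModule k S} {P : Type*} [AddCommGroup P] [Module k P]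
    (f : M →ₗ[k] N →ₗ[k] P) (x : M) (y : N) : lift f (tmul M N x y) = f x y :=
  rfl

theorem tensor_induction (M N : DGModule k S) {p : M.tensor N → Prop} (t : M.tensor N)
    (zero : p 0) (tmul : ∀ x y, p (tmul M N x y)) (add : ∀ x y, p x → p y → p (x + y)) : p t :=
  TensorProduct.induction_on (motive := p) t zero tmul add

theorem tensor_ext (M N : DGModule k S) {P : Type*} [AddCommGroup P] [Module k P]
    {f g : M.tensor N →ₗ[k] P} (h : ∀ x y, f (tmul M N x y) = g (tmul M N x y))
    (t : M.tensor N) : f t = g t :=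
  tensor_induction M N (p := fun t => f t = g t) t (by rw [map_zero, map_zero]) h
    fun x y hx hy => by rw [map_add, map_add, hx, hy]

theorem tensor_d_tmul (M N : DGModule k S) (x : M) (y : N) :
    (M.tensor N).d (tmul M N x y) = tmul M N (M.d x) y + tmul M N (M.signOp S.ι x) (N.d y) := rfl

theorem tmul_mem (M N : DGModule k S) {i j n : Γ} {x : M} {y : N} (hx : x ∈ M.deg i)
    (hy : y ∈ N.deg j) (h : i + j = n) : tmul M N x y ∈ (M.tensor N).deg n :=
  Submodule.subset_span (M := M ⊗[k] N) ⟨i, j, x, hx, y, hy, h, rfl⟩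

/-- To send homogeneous elements of a tensor product to a given submodule it suffices to do so on
homogeneous simple tensors. -/
theorem map_mem_of_tmul {M N : DGModule k S} {P : Type*} [AddCommGroup P] [Module k P]
    (Q : Submodule k P) (f : M.tensor N →ₗ[k] P) (n : Γ)
    (h : ∀ i j, ∀ x ∈ M.deg i, ∀ y ∈ N.deg j, i + j = n → f (tmul M N x y) ∈ Q)
    {t : M.tensor N} (ht : t ∈ (M.tensor N).deg n) : f t ∈ Q := by
  have : (M.tensor N).deg n ≤ Q.comap f := by
    refine Submodule.span_le.2 ?_
    rintro _ ⟨i, j, x, hx, y, hy, hn, rfl⟩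
    exact h i j x hx y hy hn
  exact this ht

theorem signOp_tmul (M N : DGModule k S) (a : Γ) (x : M) (y : N) :
    (M.tensor N).signOp a (tmul M N x y) = tmul M N (M.signOp a x) (N.signOp a y) := by
  refine M.hom_ext (f := (M.tensor N).signOp a ∘ₗ (tmul M N).flip y)
    (g := (tmul M N).flip (N.signOp a y) ∘ₗ M.signOp a) ?_ x
  intro i x hx
  refine N.hom_ext (f := (M.tensor N).signOp a ∘ₗ tmul M N x)
    (g := tmul M N (M.signOp a x) ∘ₗ N.signOp a) ?_ y
  intro j y hy
  simp only [LinearMap.comp_apply]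
  rw [(M.tensor N).signOp_of_mem a (tmul_mem M N hx hy rfl), M.signOp_of_mem a hx,
    N.signOp_of_mem a hy, map_add, sgn_add, map_smul, map_smul, LinearMap.smul_apply, smul_smul,
    mul_comm]

/-- The grading shift `q^j M`: `(q^j M)^n = M^(n-j)`, with differential `(-1)^⟨j,ι⟩ d`. -/
def shift (M : DGModule k S) (j : Γ) : DGModule k S where
  carrier := M
  deg n := M.deg (n - j)
  indep := M.indep.comp (sub_left_injective)
  iSup_deg := by
    rw [← M.iSup_deg]
    exact (Equiv.subRight j).iSup_comp (g := M.deg)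
  d := sgn k (S.pair j S.ι) • M.d
  d_mem := by
    intro i x hx
    have := M.d_mem hx
    rw [show i - j + S.ι = i + S.ι - j by abel] at this
    exact Submodule.smul_mem _ _ this
  d_d := by intro x; simp [M.d_d]

/-- The direct sum of a family of dg modules. -/
def sum {I : Type*} (M : I → DGModule k S) : DGModule k S where
  carrier := DirectSum I fun a => M a
  deg n :=
    { carrier := {x | ∀ a, x a ∈ (M a).deg n}
      add_mem' := fun hx hy a => Submodule.add_mem _ (hx a) (hy a)
      zero_mem' := fun a => Submodule.zero_mem _
      smul_mem' := fun c _ hx a => Submodule.smul_mem _ c (hx a) }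
  indep := by
    classical
    refine iSupIndep_of_coaction _ (DirectSum.toModule k I _ fun a =>
      Finsupp.mapRange.linearMap (DirectSum.lof k I (fun a => M a) a) ∘ₗ (M a).components) ?_
    intro n x hx
    conv_lhs => rw [← DirectSum.sum_support_of x]
    conv_rhs => rw [← DirectSum.sum_support_of x]
    rw [map_sum, Finsupp.single_finsetSum]
    refine Finset.sum_congr rfl fun a _ => ?_
    rw [← DirectSum.lof_eq_of k, DirectSum.toModule_lof, LinearMap.comp_apply,
      (M a).components_of_mem (hx a)]
    simp
  iSup_deg := by
    classical
    rw [eq_top_iff]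
    intro x hx
    clear hx
    induction x using DirectSum.induction_on with
    | zero => exact Submodule.zero_mem _
    | add x y hx hy => exact Submodule.add_mem _ hx hy
    | of a x =>
      induction x using (M a).induction with
      | hom i x hx =>
        refine Submodule.mem_iSup_of_mem i ?_
        intro b
        by_cases h : a = b
        · subst h; simpa using hx
        · rw [DirectSum.of_eq_of_ne _ _ _ (Ne.symm h)]; exact Submodule.zero_mem _
      | add x x' h h' => rw [map_add]; exact Submodule.add_mem _ h h'
  d := DirectSum.lmap fun a => (M a).d
  d_mem := by
    intro i x hx a
    rw [DirectSum.lmap_apply]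
    exact (M a).d_mem (hx a)
  d_d := by
    intro x
    refine DFinsupp.ext fun a => ?_
    erw [DirectSum.lmap_apply, DirectSum.lmap_apply]
    exact (M a).d_d _

/-- The inclusion of a summand in a direct sum. -/
def inj {I : Type*} (M : I → DGModule k S) (a : I) : M a →ₗ[k] sum M := by
  classical exact DirectSum.lof k I (fun a => M a) a

/-- The linear map out of a direct sum given by its restrictions to the summands. -/
def desc {I : Type*} (M : I → DGModule k S) {N : Type*} [AddCommGroup N] [Module k N]
    (f : ∀ a, M a →ₗ[k] N) : sum M →ₗ[k] N := by
  classical exact DirectSum.toModule k I N f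

theorem desc_inj {I : Type*} (M : I → DGModule k S) {N : Type*} [AddCommGroup N] [Module k N]
    (f : ∀ a, M a →ₗ[k] N) (a : I) (x : M a) : desc M f (inj M a x) = f a x := by
  classical exact DirectSum.toModule_lof (φ := f) k a x

theorem sum_induction {I : Type*} (M : I → DGModule k S) {p : sum M → Prop} (x : sum M)
    (h0 : p 0) (hi : ∀ a x, p (inj M a x)) (add : ∀ x y, p x → p y → p (x + y)) : p x := by
  classical exact DirectSum.induction_on (motive := p) x h0 hi add

theorem sum_ext {I : Type*} (M : I → DGModule k S) {N : Type*} [AddCommGroup N] [Module k N]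
    {f g : sum M →ₗ[k] N} (h : ∀ a x, f (inj M a x) = g (inj M a x)) (x : sum M) : f x = g x :=
  sum_induction M (p := fun x => f x = g x) x (by rw [map_zero, map_zero]) h fun x y hx hy => by rw [map_add, map_add, hx, hy]

theorem sum_d_inj {I : Type*} (M : I → DGModule k S) (a : I) (x : M a) :
    (sum M).d (inj M a x) = inj M a ((M a).d x) := by
  classical exact DirectSum.lmap_lof (fun a => (M a).d) a x

theorem inj_mem {I : Type*} (M : I → DGModule k S) {a : I} {x : M a} {n : Γ}
    (hx : x ∈ (M a).deg n) : inj M a x ∈ (sum M).deg n := by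
  classical
  intro b
  by_cases h : a = b
  · subst h; erw [DirectSum.lof_apply]; exact hx
  · erw [DirectSum.of_eq_of_ne _ _ _ (Ne.symm h)]; exact Submodule.zero_mem _

/-- To be homogeneity-preserving on a direct sum it suffices to be so on each summand. -/
theorem map_mem_of_inj {I : Type*} (M : I → DGModule k S) {N : Type*} [AddCommGroup N]
    [Module k N] (P : Submodule k N) (f : sum M →ₗ[k] N) (n : Γ)
    (h : ∀ a, ∀ x ∈ (M a).deg n, f (inj M a x) ∈ P) {x : sum M} (hx : x ∈ (sum M).deg n) :
    f x ∈ P := by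
  classical
  have hs : ∑ a ∈ DFinsupp.support (β := fun a => M a) x,
      inj M a (DFinsupp.toFun (β := fun a => M a) x a) = x :=
    DirectSum.sum_support_of (β := fun a => M a) x
  rw [← hs, map_sum]
  exact Submodule.sum_mem _ fun a _ => h a _ (hx a)

theorem signOp_inj {I : Type*} (M : I → DGModule k S) (a : I) (c : Γ) (x : M a) :
    (sum M).signOp c (inj M a x) = inj M a ((M a).signOp c x) := by
  refine (M a).hom_ext (f := (sum M).signOp c ∘ₗ inj M a) (g := inj M a ∘ₗ (M a).signOp c) ?_ x
  intro i x hx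
  simp only [LinearMap.comp_apply]
  rw [(sum M).signOp_of_mem c (inj_mem M hx), (M a).signOp_of_mem c hx, map_smul]

/-- The twist `tw_α(M) = (M, d + α)`. -/
def twist (M : DGModule k S) (α : M →ₗ[k] M)
    (hα : ∀ i, ∀ x ∈ M.deg i, α x ∈ M.deg (i + S.ι))
    (hMC : ∀ x, M.d (α x) + α (M.d x) + α (α x) = 0) : DGModule k S where
  carrier := M
  deg := M.deg
  indep := M.indep
  iSup_deg := M.iSup_deg
  d := M.d + α
  d_mem := fun hx => Submodule.add_mem _ (M.d_mem hx) (hα _ _ hx)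
  d_d := by
    intro x
    have := hMC x
    simp only [LinearMap.add_apply, map_add, M.d_d, zero_add]
    rw [← this]; abel

/-- The quotient of a dg module by homogeneous relations, stable under the differential. -/
def quot (M : DGModule k S) (R : Set M) (hR : ∀ x ∈ R, ∃ i, x ∈ M.deg i)
    (hd : ∀ x ∈ R, M.d x ∈ Submodule.span k R) : DGModule k S where
  carrier := M ⧸ Submodule.span k R
  deg n := (M.deg n).map (Submodule.span k R).mkQ
  indep := by
    refine iSupIndep_of_coaction _ (Submodule.liftQ _
      (Finsupp.mapRange.linearMap (Submodule.span k R).mkQ ∘ₗ M.components) ?_) ?_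
    · rw [Submodule.span_le]
      intro x hx
      obtain ⟨i, hi⟩ := hR x hx
      have : (Submodule.Quotient.mk x : M ⧸ Submodule.span k R) = 0 :=
        (Submodule.Quotient.mk_eq_zero _).2 (Submodule.subset_span hx)
      simp [M.components_of_mem hi, this]
    · rintro n _ ⟨x, hx, rfl⟩
      simp [M.components_of_mem hx]
  iSup_deg := by
    rw [← Submodule.map_iSup, M.iSup_deg, Submodule.map_top, Submodule.range_mkQ]
  d := Submodule.mapQ _ _ M.d (by rw [Submodule.span_le]; exact hd)
  d_mem := by
    rintro i _ ⟨x, hx, rfl⟩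
    exact ⟨M.d x, M.d_mem hx, rfl⟩
  d_d := by
    intro x
    obtain ⟨x, rfl⟩ := Submodule.mkQ_surjective _ x
    simp [M.d_d]

end DGModule
end DGModule

theorem sgn_sub {k : Type*} [CommRing k] (a b : ZMod 2) : sgn k (a - b) = sgn k a * sgn k b := by
  rw [CharTwo.sub_eq_add, sgn_add]

section Bilinear
variable {k : Type*} [CommRing k] {Γ : Type*} [AddCommGroup Γ] {S : GradingDatum Γ}

namespace DGModule

theorem signOp_bilin {M N P : DGModule k S} (β : M →ₗ[k] N →ₗ[k] P)
    (h : ∀ i j x y, x ∈ M.deg i → y ∈ N.deg j → β x y ∈ P.deg (i + j)) (a : Γ) (x : M) (y : N) :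
    P.signOp a (β x y) = β (M.signOp a x) (N.signOp a y) := by
  refine M.hom_ext (f := P.signOp a ∘ₗ β.flip y) (g := β.flip (N.signOp a y) ∘ₗ M.signOp a) ?_ x
  intro i x hx
  refine N.hom_ext (f := P.signOp a ∘ₗ β x) (g := β (M.signOp a x) ∘ₗ N.signOp a) ?_ y
  intro j y hy
  simp only [LinearMap.comp_apply]
  rw [P.signOp_of_mem a (h i j x y hx hy), M.signOp_of_mem a hx, N.signOp_of_mem a hy, map_add,
    sgn_add, map_smul, map_smul, LinearMap.smul_apply, smul_smul, mul_comm]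

theorem leibniz_bilin {M N P : DGModule k S} (β : M →ₗ[k] N →ₗ[k] P)
    (h : ∀ i x y, x ∈ M.deg i →
      P.d (β x y) = β (M.d x) y + sgn k (S.pair S.ι i) • β x (N.d y)) (x : M) (y : N) :
    P.d (β x y) = β (M.d x) y + β (M.signOp S.ι x) (N.d y) := by
  refine M.hom_ext (f := P.d ∘ₗ β.flip y)
    (g := β.flip y ∘ₗ M.d + β.flip (N.d y) ∘ₗ M.signOp S.ι) ?_ x
  intro i x hx
  simp only [LinearMap.comp_apply, LinearMap.add_apply, LinearMap.flip_apply]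
  rw [h i x y hx, M.signOp_of_mem _ hx, map_smul, LinearMap.smul_apply]

/-- The two-sided shift `q^j M q^{-i}`: the component of degree `l` is `M^(l+i-j)`, and the
differential is `(-1)^⟨ι,j⟩ d`. -/
def bishift (M : DGModule k S) (j i : Γ) : DGModule k S where
  carrier := M
  deg l := M.deg (l + i - j)
  indep := M.indep.comp (f := fun l => l + i - j) fun a b h => by simpa using h
  iSup_deg := by
    rw [← M.iSup_deg]
    exact ((Equiv.addRight i).trans (Equiv.subRight j)).iSup_comp (g := M.deg)
  d := sgn k (S.pair S.ι j) • M.d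
  d_mem := by
    intro l x hx
    have := M.d_mem hx
    rw [show l + i - j + S.ι = l + S.ι + i - j by abel] at this
    exact Submodule.smul_mem _ _ this
  d_d := by intro x; simp [M.d_d]

end DGModule
end Bilinear

/-- A dg category: a category enriched in dg modules. Hom complexes are written from right to
left: `C.hom X Y` is `⟨X|C|Y⟩ = Hom(Y, X)`, and `C.comp f g` is `f ∘ g`. -/
structure DGCategory.{u, v, w, o} (k : Type u) [CommRing k] {Γ : Type v} [AddCommGroup Γ]
    (S : GradingDatum Γ) where
  Obj : Type o
  hom : Obj → Obj → DGModule.{u, v, w} k S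
  one : ∀ X, hom X X
  comp : ∀ {X Y Z}, hom X Y →ₗ[k] hom Y Z →ₗ[k] hom X Z
  one_mem : ∀ X, one X ∈ (hom X X).deg 0
  comp_mem : ∀ {X Y Z} {i j : Γ} {f : hom X Y} {g : hom Y Z},
    f ∈ (hom X Y).deg i → g ∈ (hom Y Z).deg j → comp f g ∈ (hom X Z).deg (i + j)
  d_one : ∀ X, (hom X X).d (one X) = 0
  d_comp : ∀ {X Y Z} {i : Γ} {f : hom X Y} (g : hom Y Z), f ∈ (hom X Y).deg i →
    (hom X Z).d (comp f g) =
      comp ((hom X Y).d f) g + sgn k (S.pair S.ι i) • comp f ((hom Y Z).d g)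
  one_comp : ∀ {X Y} (f : hom X Y), comp (one X) f = f
  comp_one : ∀ {X Y} (f : hom X Y), comp f (one Y) = f
  assoc : ∀ {W X Y Z} (f : hom W X) (g : hom X Y) (h : hom Y Z),
    comp (comp f g) h = comp f (comp g h)

/-- A dg functor. -/
structure DGFunctor {k : Type*} [CommRing k] {Γ : Type*} [AddCommGroup Γ]
    {S : GradingDatum Γ} (C : DGCategory k S) (D : DGCategory k S) where
  obj : C.Obj → D.Obj
  map : ∀ {X Y}, C.hom X Y →ₗ[k] D.hom (obj X) (obj Y)
  map_mem : ∀ {X Y} {i : Γ} {f : C.hom X Y}, f ∈ (C.hom X Y).deg i →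
    map f ∈ (D.hom (obj X) (obj Y)).deg i
  map_d : ∀ {X Y} (f : C.hom X Y), map ((C.hom X Y).d f) = (D.hom (obj X) (obj Y)).d (map f)
  map_one : ∀ X, map (C.one X) = D.one (obj X)
  map_comp : ∀ {X Y Z} (f : C.hom X Y) (g : C.hom Y Z), map (C.comp f g) = D.comp (map f) (map g)

/-- A `(C, D)`-bimodule: a family of dg modules `val X Y = ⟨X|M|Y⟩` with a left action of `C` and
a commuting right action of `D`, by degree zero chain maps. -/
structure DGBimodule.{u, v, w₁, o₁, w₂, o₂, w} {k : Type u} [CommRing k] {Γ : Type v}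
    [AddCommGroup Γ] {S : GradingDatum Γ} (C : DGCategory.{u, v, w₁, o₁} k S)
    (D : DGCategory.{u, v, w₂, o₂} k S) where
  val : C.Obj → D.Obj → DGModule.{u, v, w} k S
  lact : ∀ {X' X Y}, C.hom X' X →ₗ[k] val X Y →ₗ[k] val X' Y
  ract : ∀ {X Y Y'}, val X Y →ₗ[k] D.hom Y Y' →ₗ[k] val X Y'
  lact_mem : ∀ {X' X Y} {i j : Γ} {f : C.hom X' X} {m : val X Y},
    f ∈ (C.hom X' X).deg i → m ∈ (val X Y).deg j → lact f m ∈ (val X' Y).deg (i + j)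
  ract_mem : ∀ {X Y Y'} {i j : Γ} {m : val X Y} {g : D.hom Y Y'},
    m ∈ (val X Y).deg i → g ∈ (D.hom Y Y').deg j → ract m g ∈ (val X Y').deg (i + j)
  d_lact : ∀ {X' X Y} {i : Γ} {f : C.hom X' X} (m : val X Y), f ∈ (C.hom X' X).deg i →
    (val X' Y).d (lact f m) =
      lact ((C.hom X' X).d f) m + sgn k (S.pair S.ι i) • lact f ((val X Y).d m)
  d_ract : ∀ {X Y Y'} {i : Γ} {m : val X Y} (g : D.hom Y Y'), m ∈ (val X Y).deg i →
    (val X Y').d (ract m g) =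
      ract ((val X Y).d m) g + sgn k (S.pair S.ι i) • ract m ((D.hom Y Y').d g)
  one_lact : ∀ {X Y} (m : val X Y), lact (C.one X) m = m
  ract_one : ∀ {X Y} (m : val X Y), ract m (D.one Y) = m
  comp_lact : ∀ {X'' X' X Y} (f : C.hom X'' X') (g : C.hom X' X) (m : val X Y),
    lact (C.comp f g) m = lact f (lact g m)
  ract_comp : ∀ {X Y Y' Y''} (m : val X Y) (f : D.hom Y Y') (g : D.hom Y' Y''),
    ract m (D.comp f g) = ract (ract m f) g
  lact_ract : ∀ {X' X Y Y'} (f : C.hom X' X) (m : val X Y) (g : D.hom Y Y'),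
    ract (lact f m) g = lact f (ract m g)

section Cat
variable {k : Type*} [CommRing k] {Γ : Type*} [AddCommGroup Γ] {S : GradingDatum Γ}

namespace DGFunctor

/-- The identity dg functor. -/
def id (C : DGCategory k S) : DGFunctor C C where
  obj X := X
  map := LinearMap.id
  map_mem h := h
  map_d _ := rfl
  map_one _ := rfl
  map_comp _ _ := rfl

/-- Dg functors `F : A → D` and `G : B → D` make `D` into an `(A, B)`-bimodule, with
`⟨X|D|Y⟩ = ⟨F X|D|G Y⟩` and both actions given by composition in `D`. -/
def bimodule {A : DGCategory k S} {B : DGCategory k S} {D : DGCategory k S} (F : DGFunctor A D) (G : DGFunctor B D) :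
    DGBimodule A B where
  val X Y := D.hom (F.obj X) (G.obj Y)
  lact := D.comp ∘ₗ F.map
  ract := D.comp.compl₂ G.map
  lact_mem hf hm := D.comp_mem (F.map_mem hf) hm
  ract_mem hm hg := D.comp_mem hm (G.map_mem hg)
  d_lact m hf := by
    simp only [LinearMap.comp_apply]
    rw [D.d_comp m (F.map_mem hf), F.map_d]
  d_ract g hm := by
    simp only [LinearMap.compl₂_apply]
    rw [D.d_comp _ hm, G.map_d]
  one_lact m := by
    simp only [LinearMap.comp_apply]
    rw [F.map_one, D.one_comp]
  ract_one m := by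
    simp only [LinearMap.compl₂_apply]
    rw [G.map_one, D.comp_one]
  comp_lact f g m := by
    simp only [LinearMap.comp_apply]
    rw [F.map_comp, D.assoc]
  ract_comp m f g := by
    simp only [LinearMap.compl₂_apply]
    rw [G.map_comp, D.assoc]
  lact_ract f m g := by
    simp only [LinearMap.comp_apply, LinearMap.compl₂_apply]
    rw [D.assoc]

end DGFunctor

namespace DGCategory

theorem d_comp' (C : DGCategory k S) {X Y Z : C.Obj} (f : C.hom X Y) (g : C.hom Y Z) :
    (C.hom X Z).d (C.comp f g) =
      C.comp ((C.hom X Y).d f) g + C.comp ((C.hom X Y).signOp S.ι f) ((C.hom Y Z).d g) :=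
  DGModule.leibniz_bilin C.comp (fun _ _ y hx => C.d_comp y hx) f g

theorem signOp_comp (C : DGCategory k S) {X Y Z : C.Obj} (a : Γ) (f : C.hom X Y)
    (g : C.hom Y Z) : (C.hom X Z).signOp a (C.comp f g) =
      C.comp ((C.hom X Y).signOp a f) ((C.hom Y Z).signOp a g) :=
  DGModule.signOp_bilin C.comp (fun _ _ _ _ => C.comp_mem) a f g

theorem signOp_one (C : DGCategory k S) (a : Γ) (X : C.Obj) :
    (C.hom X X).signOp a (C.one X) = C.one X := by
  rw [(C.hom X X).signOp_of_mem a (C.one_mem X), map_zero, sgn_zero, one_smul]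

theorem d_comp_shift (C : DGCategory k S) {X Y Z : C.Obj} (a b i : Γ) (f : C.hom X Y)
    (g : C.hom Y Z) (hf : f ∈ (C.hom X Y).deg (i + b - a)) :
    sgn k (S.pair S.ι a) • (C.hom X Z).d (C.comp f g) =
      C.comp (sgn k (S.pair S.ι a) • (C.hom X Y).d f) g +
        sgn k (S.pair S.ι i) • C.comp f (sgn k (S.pair S.ι b) • (C.hom Y Z).d g) := by
  rw [C.d_comp g hf, map_sub, map_add (S.pair S.ι), sgn_sub, sgn_add, map_smul,
    LinearMap.smul_apply, map_smul, smul_add, smul_smul, smul_smul]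
  congr 2
  linear_combination (sgn k (S.pair S.ι i) * sgn k (S.pair S.ι b)) *
    sgn_mul_self (k := k) (S.pair S.ι a)

/-- The objects `q^i X` of the suspended envelope. -/
structure SBObj (C : DGCategory k S) where
  shift : Γ
  obj : C.Obj

/-- The suspended envelope `SB(C)`: `Hom^l(q^i X, q^j Y) = Hom^(l+i-j)(X, Y)`, with differential
`(-1)^⟨ι,j⟩ d`. -/
def SB (C : DGCategory k S) : DGCategory k S where
  Obj := SBObj C
  hom A B := (C.hom A.obj B.obj).bishift A.shift B.shift
  one A := C.one A.obj
  comp {A B D} := C.comp (X := A.obj) (Y := B.obj) (Z := D.obj)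
  one_mem A := by
    change C.one A.obj ∈ (C.hom A.obj A.obj).deg (0 + A.shift - A.shift)
    rw [zero_add, sub_self]; exact C.one_mem _
  comp_mem {A B D i j f g} hf hg := by
    have := C.comp_mem hf hg
    rwa [show i + B.shift - A.shift + (j + D.shift - B.shift) = i + j + D.shift - A.shift by abel]
      at this
  d_one A := by
    change sgn k _ • (C.hom A.obj A.obj).d (C.one A.obj) = 0
    rw [C.d_one, smul_zero]
  d_comp {A B D i f} g hf := by
    exact C.d_comp_shift A.shift B.shift i f g hf
  one_comp f := C.one_comp f
  comp_one f := C.comp_one f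
  assoc f g h := C.assoc f g h

/-- The morphism `f^j_i : q^i Y → q^j X` of `SB(C)` corresponding to a morphism `f : Y → X` of
`C`. -/
def susp (C : DGCategory k S) {X Y : C.Obj} (j i : Γ) :
    C.hom X Y →ₗ[k] C.SB.hom ⟨j, X⟩ ⟨i, Y⟩ := LinearMap.id

/-- The dg functor `η : C → SB(C)`, `X ↦ q^0 X`, `f ↦ f^0_0`. -/
def η (C : DGCategory k S) : DGFunctor C C.SB where
  obj X := ⟨0, X⟩
  map := C.susp 0 0
  map_mem {X Y i f} hf := by
    change f ∈ (C.hom X Y).deg (i + 0 - 0)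
    rwa [add_zero, sub_zero]
  map_d {X Y} f := by
    change (C.hom X Y).d f = sgn k (S.pair S.ι 0) • (C.hom X Y).d f
    rw [map_zero, sgn_zero, one_smul]
  map_one _ := rfl
  map_comp _ _ := rfl

/-- The structure map `φ_{X,i} = (id_X)^i_0 : X → q^i X`. -/
def φ (C : DGCategory k S) (X : C.Obj) (i : Γ) : C.SB.hom ⟨i, X⟩ ⟨0, X⟩ := C.susp i 0 (C.one X)

/-- The inverse `φ_{X,i}⁻¹ = (id_X)^0_i : q^i X → X`. -/
def φinv (C : DGCategory k S) (X : C.Obj) (i : Γ) : C.SB.hom ⟨0, X⟩ ⟨i, X⟩ :=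
  C.susp 0 i (C.one X)

end DGCategory

namespace DGBimodule

theorem d_lact' {C : DGCategory k S} {D : DGCategory k S} (M : DGBimodule C D) {X' X : C.Obj} {Y : D.Obj}
    (f : C.hom X' X) (m : M.val X Y) :
    (M.val X' Y).d (M.lact f m) = M.lact ((C.hom X' X).d f) m +
      M.lact ((C.hom X' X).signOp S.ι f) ((M.val X Y).d m) :=
  DGModule.leibniz_bilin M.lact (fun _ _ y hx => M.d_lact y hx) f m

theorem d_ract' {C : DGCategory k S} {D : DGCategory k S} (M : DGBimodule C D) {X : C.Obj} {Y Y' : D.Obj}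
    (m : M.val X Y) (g : D.hom Y Y') :
    (M.val X Y').d (M.ract m g) = M.ract ((M.val X Y).d m) g +
      M.ract ((M.val X Y).signOp S.ι m) ((D.hom Y Y').d g) :=
  DGModule.leibniz_bilin M.ract (fun _ _ y hx => M.d_ract y hx) m g

variable {A : DGCategory k S} {B : DGCategory k S} {C : DGCategory k S}
  (M : DGBimodule A B) (N : DGBimodule B C)

/-- The dg module `⨁_Y ⟨X|M|Y⟩ ⊗ ⟨Y|N|Z⟩`. -/
def preTensor (X : A.Obj) (Z : C.Obj) : DGModule k S :=
  DGModule.sum fun Y : B.Obj => (M.val X Y).tensor (N.val Y Z)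

/-- The element `m ⊗ n` of `⨁_Y ⟨X|M|Y⟩ ⊗ ⟨Y|N|Z⟩`. -/
def preTmul {X : A.Obj} {Z : C.Obj} (Y : B.Obj) :
    M.val X Y →ₗ[k] N.val Y Z →ₗ[k] preTensor M N X Z :=
  (DGModule.tmul (M.val X Y) (N.val Y Z)).compr₂
    (DGModule.inj (fun Y : B.Obj => (M.val X Y).tensor (N.val Y Z)) Y)

/-- The relations `m f ⊗ n - m ⊗ f n`, for homogeneous `m`, `f`, `n`. -/
def tensorRel (X : A.Obj) (Z : C.Obj) : Set (preTensor M N X Z) :=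
  {t | ∃ (Y Y' : B.Obj) (a b c : Γ), ∃ m ∈ (M.val X Y).deg a, ∃ f ∈ (B.hom Y Y').deg b,
    ∃ n ∈ (N.val Y' Z).deg c,
      t = preTmul M N Y' (M.ract m f) n - preTmul M N Y m (N.lact f n)}

theorem preTmul_mem {X : A.Obj} {Z : C.Obj} {Y : B.Obj} {a b c : Γ} {m : M.val X Y}
    {n : N.val Y Z} (hm : m ∈ (M.val X Y).deg a) (hn : n ∈ (N.val Y Z).deg b) (h : a + b = c) :
    preTmul M N Y m n ∈ (preTensor M N X Z).deg c :=
  DGModule.inj_mem (fun Y : B.Obj => (M.val X Y).tensor (N.val Y Z)) (DGModule.tmul_mem _ _ hm hn h)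

theorem preTmul_d {X : A.Obj} {Z : C.Obj} {Y : B.Obj} {a : Γ} {m : M.val X Y}
    (n : N.val Y Z) (hm : m ∈ (M.val X Y).deg a) :
    (preTensor M N X Z).d (preTmul M N Y m n) = preTmul M N Y ((M.val X Y).d m) n +
      sgn k (S.pair S.ι a) • preTmul M N Y m ((N.val Y Z).d n) := by
  refine (DGModule.sum_d_inj (fun Y : B.Obj => (M.val X Y).tensor (N.val Y Z)) Y _).trans ?_
  rw [DGModule.tensor_d_tmul, map_add, (M.val X Y).signOp_of_mem _ hm, map_smul,
    LinearMap.smul_apply, map_smul]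
  rfl

theorem preTmul_ext {X : A.Obj} {Z : C.Obj} {P : Type*} [AddCommGroup P] [Module k P]
    {f g : preTensor M N X Z →ₗ[k] P}
    (h : ∀ Y a b, ∀ m ∈ (M.val X Y).deg a, ∀ n ∈ (N.val Y Z).deg b,
      f (preTmul M N Y m n) = g (preTmul M N Y m n)) (t : preTensor M N X Z) : f t = g t := by
  refine DGModule.sum_ext _ (f := f) (g := g) (fun Y t => ?_) t
  refine DGModule.tensor_ext _ _
    (f := f ∘ₗ DGModule.inj (fun Y : B.Obj => (M.val X Y).tensor (N.val Y Z)) Y)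
    (g := g ∘ₗ DGModule.inj (fun Y : B.Obj => (M.val X Y).tensor (N.val Y Z)) Y)
    (fun m n => ?_) t
  refine (M.val X Y).hom_ext (f := f ∘ₗ (preTmul M N Y).flip n)
    (g := g ∘ₗ (preTmul M N Y).flip n) (fun a m hm => ?_) m
  exact (N.val Y Z).hom_ext (f := f ∘ₗ preTmul M N Y m)
    (g := g ∘ₗ preTmul M N Y m) (fun b n hn => h Y a b m hm n hn) n

theorem tensorRel_homogeneous {X : A.Obj} {Z : C.Obj} :
    ∀ t ∈ tensorRel M N X Z, ∃ i, t ∈ (preTensor M N X Z).deg i := by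
  rintro _ ⟨Y, Y', a, b, c, m, hm, f, hf, n, hn, rfl⟩
  exact ⟨a + b + c, Submodule.sub_mem _ (preTmul_mem M N (M.ract_mem hm hf) hn rfl)
    (preTmul_mem M N hm (N.lact_mem hf hn) (by abel))⟩

theorem tensorRel_d {X : A.Obj} {Z : C.Obj} : ∀ t ∈ tensorRel M N X Z,
    (preTensor M N X Z).d t ∈ Submodule.span k (tensorRel M N X Z) := by
  rintro _ ⟨Y, Y', a, b, c, m, hm, f, hf, n, hn, rfl⟩
  have h1 : preTmul M N Y' (M.ract ((M.val X Y).d m) f) n -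
      preTmul M N Y ((M.val X Y).d m) (N.lact f n) ∈ Submodule.span k (tensorRel M N X Z) :=
    Submodule.subset_span ⟨Y, Y', _, _, _, _, (M.val X Y).d_mem hm, _, hf, _, hn, rfl⟩
  have h2 : preTmul M N Y' (M.ract m ((B.hom Y Y').d f)) n -
      preTmul M N Y m (N.lact ((B.hom Y Y').d f) n) ∈ Submodule.span k (tensorRel M N X Z) :=
    Submodule.subset_span ⟨Y, Y', _, _, _, _, hm, _, (B.hom Y Y').d_mem hf, _, hn, rfl⟩
  have h3 : preTmul M N Y' (M.ract m f) ((N.val Y' Z).d n) -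
      preTmul M N Y m (N.lact f ((N.val Y' Z).d n)) ∈ Submodule.span k (tensorRel M N X Z) :=
    Submodule.subset_span ⟨Y, Y', _, _, _, _, hm, _, hf, _, (N.val Y' Z).d_mem hn, rfl⟩
  have := Submodule.add_mem _ (Submodule.add_mem _ h1
    (Submodule.smul_mem _ (sgn k (S.pair S.ι a)) h2))
    (Submodule.smul_mem _ (sgn k (S.pair S.ι (a + b))) h3)
  convert this using 1
  rw [map_sub, preTmul_d M N _ (M.ract_mem hm hf), preTmul_d M N _ hm, M.d_ract _ hm,
    N.d_lact _ hf, map_add (S.pair S.ι), sgn_add]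
  simp only [map_add, map_smul, LinearMap.add_apply, LinearMap.smul_apply]
  module

/-- The dg module `⟨X|M ⊗_B N|Z⟩`: the quotient of `⨁_Y ⟨X|M|Y⟩ ⊗ ⟨Y|N|Z⟩` by the relations
`m f ⊗ n = m ⊗ f n`. -/
def tensorVal (X : A.Obj) (Z : C.Obj) : DGModule k S :=
  (preTensor M N X Z).quot (tensorRel M N X Z) (tensorRel_homogeneous M N) (tensorRel_d M N)

/-- The class of `m ⊗ n` in `⟨X|M ⊗_B N|Z⟩`. -/
def tmul {X : A.Obj} {Y : B.Obj} {Z : C.Obj} :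
    M.val X Y →ₗ[k] N.val Y Z →ₗ[k] tensorVal M N X Z :=
  (preTmul M N Y).compr₂ (Submodule.mkQ (Submodule.span k (tensorRel M N X Z)))

theorem tmul_mem {X : A.Obj} {Z : C.Obj} {Y : B.Obj} {a b c : Γ} {m : M.val X Y}
    {n : N.val Y Z} (hm : m ∈ (M.val X Y).deg a) (hn : n ∈ (N.val Y Z).deg b) (h : a + b = c) :
    tmul M N m n ∈ (tensorVal M N X Z).deg c :=
  ⟨_, preTmul_mem M N hm hn h, rfl⟩

theorem tmul_d {X : A.Obj} {Z : C.Obj} {Y : B.Obj} {a : Γ} {m : M.val X Y}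
    (n : N.val Y Z) (hm : m ∈ (M.val X Y).deg a) :
    (tensorVal M N X Z).d (tmul M N m n) = tmul M N ((M.val X Y).d m) n +
      sgn k (S.pair S.ι a) • tmul M N m ((N.val Y Z).d n) := by
  have := congrArg (Submodule.mkQ (Submodule.span k (tensorRel M N X Z))) (preTmul_d M N n hm)
  rw [map_add, map_smul] at this
  exact this

theorem tmul_ext {X : A.Obj} {Z : C.Obj} {P : Type*} [AddCommGroup P] [Module k P]
    {f g : tensorVal M N X Z →ₗ[k] P}
    (h : ∀ Y a b, ∀ m ∈ (M.val X Y).deg a, ∀ n ∈ (N.val Y Z).deg b,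
      f (tmul M N m n) = g (tmul M N m n)) (t : tensorVal M N X Z) : f t = g t := by
  obtain ⟨t, rfl⟩ := Submodule.mkQ_surjective _ t
  exact preTmul_ext M N (f := f ∘ₗ Submodule.mkQ _) (g := g ∘ₗ Submodule.mkQ _) h t

theorem tmul_balanced {X : A.Obj} {Z : C.Obj} {Y Y' : B.Obj} (m : M.val X Y) (f : B.hom Y Y')
    (n : N.val Y' Z) : tmul M N (M.ract m f) n = tmul M N m (N.lact f n) := by
  refine (M.val X Y).hom_ext (f := (tmul M N).flip n ∘ₗ M.ract.flip f)
    (g := (tmul M N).flip (N.lact f n)) (fun a m hm => ?_) m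
  refine (B.hom Y Y').hom_ext (f := (tmul M N).flip n ∘ₗ M.ract m)
    (g := tmul M N m ∘ₗ N.lact.flip n) (fun b f hf => ?_) f
  refine (N.val Y' Z).hom_ext (f := tmul M N (M.ract m f))
    (g := tmul M N m ∘ₗ N.lact f) (fun c n hn => ?_) n
  exact (Submodule.Quotient.eq _).2
    (Submodule.subset_span ⟨Y, Y', a, b, c, m, hm, f, hf, n, hn, rfl⟩)

/-- The linear map out of `⨁_Y ⟨X|M|Y⟩ ⊗ ⟨Y|N|Z⟩` given by a family of bilinear maps. -/
def preLift {X : A.Obj} {Z : C.Obj} {P : Type*} [AddCommGroup P] [Module k P]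
    (β : ∀ Y, M.val X Y →ₗ[k] N.val Y Z →ₗ[k] P) : preTensor M N X Z →ₗ[k] P :=
  DGModule.desc (fun Y : B.Obj => (M.val X Y).tensor (N.val Y Z)) fun Y => DGModule.lift (β Y)

theorem preLift_preTmul {X : A.Obj} {Z : C.Obj} {P : Type*} [AddCommGroup P] [Module k P]
    (β : ∀ Y, M.val X Y →ₗ[k] N.val Y Z →ₗ[k] P) (Y : B.Obj) (m : M.val X Y) (n : N.val Y Z) :
    preLift M N β (preTmul M N Y m n) = β Y m n :=
  (DGModule.desc_inj (fun Y : B.Obj => (M.val X Y).tensor (N.val Y Z))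
    (fun Y => DGModule.lift (β Y)) Y (DGModule.tmul _ _ m n)).trans (DGModule.lift_tmul _ _ _)

/-- The linear map out of `⟨X|M ⊗_B N|Z⟩` given by a balanced family of bilinear maps. -/
def tensorLift {X : A.Obj} {Z : C.Obj} {P : Type*} [AddCommGroup P] [Module k P]
    (β : ∀ Y, M.val X Y →ₗ[k] N.val Y Z →ₗ[k] P)
    (hβ : ∀ Y Y' m f n, β Y' (M.ract m f) n = β Y m (N.lact f n)) :
    tensorVal M N X Z →ₗ[k] P :=
  Submodule.liftQ (Submodule.span k (tensorRel M N X Z)) (preLift M N β)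
    (by
      rw [Submodule.span_le]
      rintro _ ⟨Y, Y', a, b, c, m, hm, f, hf, n, hn, rfl⟩
      rw [SetLike.mem_coe, LinearMap.mem_ker, map_sub, preLift_preTmul, preLift_preTmul, hβ,
        sub_self])

theorem tensorLift_tmul {X : A.Obj} {Z : C.Obj} {P : Type*} [AddCommGroup P] [Module k P]
    (β : ∀ Y, M.val X Y →ₗ[k] N.val Y Z →ₗ[k] P)
    (hβ : ∀ Y Y' m f n, β Y' (M.ract m f) n = β Y m (N.lact f n)) (Y : B.Obj) (m : M.val X Y)
    (n : N.val Y Z) : tensorLift M N β hβ (tmul M N m n) = β Y m n :=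
  preLift_preTmul M N β Y m n

/-- The left action `f (m ⊗ n) = (f m) ⊗ n` on `M ⊗_B N`. -/
def tensorLact {X' X : A.Obj} {Z : C.Obj} :
    A.hom X' X →ₗ[k] tensorVal M N X Z →ₗ[k] tensorVal M N X' Z :=
  LinearMap.flip (tensorLift M N
    (fun Y => LinearMap.mk₂ k
      (fun (m : M.val X Y) (n : N.val Y Z) => (tmul M N).flip n ∘ₗ M.lact.flip m)
      (fun m m' n => by ext f; simp) (fun c m n => by ext f; simp)
      (fun m n n' => by ext f; simp) (fun c m n => by ext f; simp))
    (fun Y Y' m g n => by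
      ext f
      simp only [LinearMap.mk₂_apply, LinearMap.comp_apply, LinearMap.flip_apply]
      rw [← M.lact_ract, tmul_balanced]))

theorem tensorLact_tmul {X' X : A.Obj} {Y : B.Obj} {Z : C.Obj} (f : A.hom X' X) (m : M.val X Y)
    (n : N.val Y Z) : tensorLact M N f (tmul M N m n) = tmul M N (M.lact f m) n := by
  rw [tensorLact, LinearMap.flip_apply, tensorLift_tmul]
  rfl

/-- The right action `(m ⊗ n) g = m ⊗ (n g)` on `M ⊗_B N`. -/
def tensorRact {X : A.Obj} {Z Z' : C.Obj} :
    tensorVal M N X Z →ₗ[k] C.hom Z Z' →ₗ[k] tensorVal M N X Z' :=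
  tensorLift M N
    (fun Y => LinearMap.mk₂ k
      (fun (m : M.val X Y) (n : N.val Y Z) => tmul M N m ∘ₗ N.ract n)
      (fun m m' n => by ext f; simp) (fun c m n => by ext f; simp)
      (fun m n n' => by ext f; simp) (fun c m n => by ext f; simp))
    (fun Y Y' m f n => by
      ext g
      simp only [LinearMap.mk₂_apply, LinearMap.comp_apply]
      rw [tmul_balanced, N.lact_ract])

theorem tensorRact_tmul {X : A.Obj} {Y : B.Obj} {Z Z' : C.Obj} (m : M.val X Y) (n : N.val Y Z)
    (g : C.hom Z Z') : tensorRact M N (tmul M N m n) g = tmul M N m (N.ract n g) := by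
  rw [tensorRact, tensorLift_tmul]
  rfl

theorem tensorVal_le {X : A.Obj} {Z : C.Obj} {P : Type*} [AddCommGroup P] [Module k P]
    (Q : Submodule k P) (f : tensorVal M N X Z →ₗ[k] P) (c : Γ)
    (h : ∀ Y a b, ∀ m ∈ (M.val X Y).deg a, ∀ n ∈ (N.val Y Z).deg b, a + b = c →
      f (tmul M N m n) ∈ Q) {t : tensorVal M N X Z} (ht : t ∈ (tensorVal M N X Z).deg c) :
    f t ∈ Q := by
  obtain ⟨t, ht, rfl⟩ := ht
  refine DGModule.map_mem_of_inj (fun Y : B.Obj => (M.val X Y).tensor (N.val Y Z)) Q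
    (f ∘ₗ Submodule.mkQ (Submodule.span k (tensorRel M N X Z))) c (fun Y t ht => ?_) ht
  exact DGModule.map_mem_of_tmul Q ((f ∘ₗ Submodule.mkQ (Submodule.span k (tensorRel M N X Z))) ∘ₗ
    DGModule.inj (fun Y : B.Obj => (M.val X Y).tensor (N.val Y Z)) Y) c
    (fun i j x hx y hy hij => h Y i j x hx y hy hij) ht

/-- The tensor product `M ⊗_B N` of bimodules. -/
def tensor : DGBimodule A C where
  val := tensorVal M N
  lact := tensorLact M N
  ract := tensorRact M N
  lact_mem {X' X Z i j f t} hf ht := by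
    refine tensorVal_le M N _ (tensorLact M N f) j (fun Y a b m hm n hn hab => ?_) ht
    rw [tensorLact_tmul]
    exact tmul_mem M N (M.lact_mem hf hm) hn (by rw [← hab, add_assoc])
  ract_mem {X Z Z' i j t g} ht hg := by
    refine tensorVal_le M N _ ((tensorRact M N).flip g) i (fun Y a b m hm n hn hab => ?_) ht
    rw [LinearMap.flip_apply, tensorRact_tmul]
    exact tmul_mem M N hm (N.ract_mem hn hg) (by rw [← hab, add_assoc])
  d_lact {X' X Z i f} t hf := by
    refine tmul_ext M N (f := (tensorVal M N X' Z).d ∘ₗ tensorLact M N f)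
      (g := tensorLact M N ((A.hom X' X).d f) +
        sgn k (S.pair S.ι i) • (tensorLact M N f ∘ₗ (tensorVal M N X Z).d))
      (fun Y a b m hm n hn => ?_) t
    simp only [LinearMap.comp_apply, LinearMap.add_apply, LinearMap.smul_apply]
    rw [tensorLact_tmul, tmul_d M N n (M.lact_mem hf hm), tmul_d M N n hm, M.d_lact m hf,
      map_add (tensorLact M N f), map_smul (tensorLact M N f), tensorLact_tmul, tensorLact_tmul,
      tensorLact_tmul, map_add (tmul M N), map_smul (tmul M N), LinearMap.add_apply,
      LinearMap.smul_apply, map_add (S.pair S.ι), sgn_add]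
    module
  d_ract {X Z Z' i t} g ht := by
    have := tensorVal_le M N ⊥ ((tensorVal M N X Z').d ∘ₗ (tensorRact M N).flip g -
      ((tensorRact M N).flip g ∘ₗ (tensorVal M N X Z).d +
        sgn k (S.pair S.ι i) • (tensorRact M N).flip ((C.hom Z Z').d g))) i
      (fun Y a b m hm n hn hab => ?_) ht
    · exact sub_eq_zero.1 this
    · simp only [LinearMap.comp_apply, LinearMap.add_apply, LinearMap.smul_apply,
        LinearMap.sub_apply, LinearMap.flip_apply]
      rw [Submodule.mem_bot, tensorRact_tmul, tensorRact_tmul, tmul_d M N _ hm, tmul_d M N n hm,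
        N.d_ract g hn, map_add (tensorRact M N), map_smul (tensorRact M N), LinearMap.add_apply,
        LinearMap.smul_apply, tensorRact_tmul, tensorRact_tmul, map_add (tmul M N m),
        map_smul (tmul M N m), ← hab, map_add (S.pair S.ι), sgn_add]
      module
  one_lact {X Z} t := by
    refine tmul_ext M N (f := tensorLact M N (A.one X)) (g := LinearMap.id)
      (fun Y a b m hm n hn => ?_) t
    rw [tensorLact_tmul, M.one_lact, LinearMap.id_apply]
  ract_one {X Z} t := by
    refine tmul_ext M N (f := (tensorRact M N).flip (C.one Z)) (g := LinearMap.id)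
      (fun Y a b m hm n hn => ?_) t
    rw [LinearMap.flip_apply, tensorRact_tmul, N.ract_one, LinearMap.id_apply]
  comp_lact f g t := by
    refine tmul_ext M N (f := tensorLact M N (A.comp f g))
      (g := tensorLact M N f ∘ₗ tensorLact M N g) (fun Y a b m hm n hn => ?_) t
    rw [LinearMap.comp_apply, tensorLact_tmul, tensorLact_tmul, tensorLact_tmul, M.comp_lact]
  ract_comp t f g := by
    refine tmul_ext M N (f := (tensorRact M N).flip (C.comp f g))
      (g := (tensorRact M N).flip g ∘ₗ (tensorRact M N).flip f) (fun Y a b m hm n hn => ?_) t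
    simp only [LinearMap.comp_apply, LinearMap.flip_apply]
    rw [tensorRact_tmul, tensorRact_tmul, tensorRact_tmul, N.ract_comp]
  lact_ract f t g := by
    refine tmul_ext M N (f := (tensorRact M N).flip g ∘ₗ tensorLact M N f)
      (g := tensorLact M N f ∘ₗ (tensorRact M N).flip g) (fun Y a b m hm n hn => ?_) t
    simp only [LinearMap.comp_apply, LinearMap.flip_apply]
    rw [tensorRact_tmul, tensorLact_tmul, tensorLact_tmul, tensorRact_tmul]

end DGBimodule
end Cat

section Bar
universe u v w o
variable {k : Type u} [CommRing k] {Γ : Type v} [AddCommGroup Γ] {S : GradingDatum Γ}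

namespace DGCategory
variable (C : DGCategory.{u, v, w, o} k S)

/-- For `L = [X₀, …, X_r]`, the dg module `⟨Y|X₀⟩ ⊗ ⟨X₀|X₁⟩ ⊗ ⋯ ⊗ ⟨X_r|Y'⟩`
(and `⟨Y|Y'⟩` if `L` is empty). -/
def chain : C.Obj → List C.Obj → C.Obj → DGModule.{u, v, w} k S
  | Y, [], Y' => C.hom Y Y'
  | Y, X :: L, Y' => (C.hom Y X).tensor (chain X L Y')

variable {C}

/-- The tensor `f ⊗ c`, for `f ∈ ⟨Y|X⟩` and `c` a chain starting at `X`. -/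
def chainCons {Y X Y' : C.Obj} {L : List C.Obj} :
    C.hom Y X →ₗ[k] C.chain X L Y' →ₗ[k] C.chain Y (X :: L) Y' :=
  DGModule.tmul (C.hom Y X) (C.chain X L Y')

/-- The linear map out of the chains `f ⊗ c` given by a bilinear map. -/
def chainLift {Y X Y' : C.Obj} {L : List C.Obj} {P : Type*} [AddCommGroup P] [Module k P]
    (β : C.hom Y X →ₗ[k] C.chain X L Y' →ₗ[k] P) : C.chain Y (X :: L) Y' →ₗ[k] P :=
  DGModule.lift (M := C.hom Y X) (N := C.chain X L Y') β

theorem chainLift_cons {Y X Y' : C.Obj} {L : List C.Obj} {P : Type*} [AddCommGroup P] [Module k P]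
    (β : C.hom Y X →ₗ[k] C.chain X L Y' →ₗ[k] P) (f : C.hom Y X) (c : C.chain X L Y') :
    chainLift β (chainCons f c) = β f c :=
  DGModule.lift_tmul _ _ _

theorem chain_ext {Y X Y' : C.Obj} {L : List C.Obj} {P : Type*} [AddCommGroup P] [Module k P]
    {F G : C.chain Y (X :: L) Y' →ₗ[k] P}
    (h : ∀ f c, F (chainCons f c) = G (chainCons f c)) (t : C.chain Y (X :: L) Y') : F t = G t :=
  DGModule.tensor_ext (C.hom Y X) (C.chain X L Y') h t

theorem chain_d_cons {Y X Y' : C.Obj} {L : List C.Obj} (f : C.hom Y X) (c : C.chain X L Y') :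
    (C.chain Y (X :: L) Y').d (chainCons f c) =
      chainCons ((C.hom Y X).d f) c +
        chainCons ((C.hom Y X).signOp S.ι f) ((C.chain X L Y').d c) :=
  DGModule.tensor_d_tmul _ _ _ _

theorem chain_signOp_cons {Y X Y' : C.Obj} {L : List C.Obj} (a : Γ) (f : C.hom Y X)
    (c : C.chain X L Y') : (C.chain Y (X :: L) Y').signOp a (chainCons f c) =
      chainCons ((C.hom Y X).signOp a f) ((C.chain X L Y').signOp a c) :=
  DGModule.signOp_tmul _ _ _ _ _

/-- Composition on the left: `f · (f₀ ⊗ ⋯ ⊗ f_{r+1}) = (f ∘ f₀) ⊗ ⋯ ⊗ f_{r+1}`. -/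
def lmul {W Y Z : C.Obj} : (L : List C.Obj) →
    (C.hom W Y →ₗ[k] C.chain Y L Z →ₗ[k] C.chain W L Z)
  | [] => C.comp
  | _ :: _ => LinearMap.flip (chainLift (LinearMap.mk₂ k
      (fun g c => chainCons.flip c ∘ₗ C.comp.flip g)
      (fun m m' n => by ext f; simp) (fun c m n => by ext f; simp)
      (fun m n n' => by ext f; simp) (fun c m n => by ext f; simp)))

/-- Composition on the right: `(f₀ ⊗ ⋯ ⊗ f_{r+1}) · g = f₀ ⊗ ⋯ ⊗ (f_{r+1} ∘ g)`. -/
def rmul {Z Z' : C.Obj} : (L : List C.Obj) → (Y : C.Obj) →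
    (C.chain Y L Z →ₗ[k] C.hom Z Z' →ₗ[k] C.chain Y L Z')
  | [], _ => C.comp
  | X :: L, _ => chainLift (LinearMap.mk₂ k
      (fun f c => chainCons f ∘ₗ rmul L X c)
      (fun m m' n => by ext f; simp) (fun c m n => by ext f; simp)
      (fun m n n' => by ext f; simp) (fun c m n => by ext f; simp))

/-- The `i`-th face `f₀ ⊗ ⋯ ⊗ f_{r+1} ↦ f₀ ⊗ ⋯ ⊗ (f_i ∘ f_{i+1}) ⊗ ⋯ ⊗ f_{r+1}`, which removes
the `i`-th intermediate object (and is zero if there is no such object). -/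
def face {Z : C.Obj} : (L : List C.Obj) → (Y : C.Obj) → (i : ℕ) →
    (C.chain Y L Z →ₗ[k] C.chain Y (L.eraseIdx i) Z)
  | [], _, _ => 0
  | _ :: L, _, 0 => chainLift (lmul L)
  | X :: L, _, i + 1 => chainLift (chainCons.compl₂ (face L X i))

theorem lmul_cons {W Y X Z : C.Obj} {L : List C.Obj} (f : C.hom W Y) (g : C.hom Y X)
    (c : C.chain X L Z) : lmul (X :: L) f (chainCons g c) = chainCons (C.comp f g) c := by
  rw [lmul, LinearMap.flip_apply, chainLift_cons]; rfl

theorem rmul_cons {Z Z' Y X : C.Obj} {L : List C.Obj} (f : C.hom Y X) (c : C.chain X L Z)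
    (g : C.hom Z Z') : rmul (X :: L) Y (chainCons f c) g = chainCons f (rmul L X c g) := by
  rw [rmul, chainLift_cons]; rfl

theorem face_zero {Z Y X : C.Obj} {L : List C.Obj} (f : C.hom Y X) (c : C.chain X L Z) :
    face (X :: L) Y 0 (chainCons f c) = lmul L f c := by
  rw [face]; exact chainLift_cons _ _ _

theorem face_succ {Z Y X : C.Obj} {L : List C.Obj} (i : ℕ) (f : C.hom Y X) (c : C.chain X L Z) :
    face (X :: L) Y (i + 1) (chainCons f c) = chainCons f (face L X i c) := by
  rw [face]; exact chainLift_cons _ _ _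

theorem lmul_mem {W Y Z : C.Obj} (L : List C.Obj) {i j : Γ} {f : C.hom W Y} {c : C.chain Y L Z}
    (hf : f ∈ (C.hom W Y).deg i) (hc : c ∈ (C.chain Y L Z).deg j) :
    lmul L f c ∈ (C.chain W L Z).deg (i + j) := by
  cases L with
  | nil => exact C.comp_mem hf hc
  | cons X L =>
    refine DGModule.map_mem_of_tmul (M := C.hom Y X) (N := C.chain X L Z) _
      (lmul (X :: L) f) j (fun a b g hg c hc hab => ?_) hc
    have := lmul_cons f g c
    exact this ▸ DGModule.tmul_mem (C.hom W X) (C.chain X L Z) (C.comp_mem hf hg) hc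
      (by rw [← hab, add_assoc])

theorem rmul_mem {Z Z' : C.Obj} (L : List C.Obj) {Y : C.Obj} {i j : Γ} {c : C.chain Y L Z}
    {g : C.hom Z Z'} (hc : c ∈ (C.chain Y L Z).deg i) (hg : g ∈ (C.hom Z Z').deg j) :
    rmul L Y c g ∈ (C.chain Y L Z').deg (i + j) := by
  induction L generalizing Y i with
  | nil => exact C.comp_mem hc hg
  | cons X L ih =>
    refine DGModule.map_mem_of_tmul (M := C.hom Y X) (N := C.chain X L Z) _
      ((rmul (X :: L) Y).flip g) i (fun a b f hf c hc hab => ?_) hc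
    have := rmul_cons f c g
    exact this ▸ DGModule.tmul_mem (C.hom Y X) (C.chain X L Z') hf (ih hc)
      (by rw [← hab, add_assoc])

theorem face_mem {Z : C.Obj} (L : List C.Obj) {Y : C.Obj} (i : ℕ) {a : Γ} {c : C.chain Y L Z}
    (hc : c ∈ (C.chain Y L Z).deg a) : face L Y i c ∈ (C.chain Y (L.eraseIdx i) Z).deg a := by
  induction L generalizing Y i a with
  | nil => exact Submodule.zero_mem _
  | cons X L ih =>
    refine DGModule.map_mem_of_tmul (M := C.hom Y X) (N := C.chain X L Z) _
      (face (X :: L) Y i) a (fun p q f hf c hc hpq => ?_) hc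
    cases i with
    | zero =>
      have := face_zero f c
      exact this ▸ hpq ▸ lmul_mem L hf hc
    | succ i =>
      have := face_succ i f c
      exact this ▸ DGModule.tmul_mem (C.hom Y X) (C.chain X (L.eraseIdx i) Z) hf (ih i hc) hpq

theorem comp_lmul {V W Y Z : C.Obj} (L : List C.Obj) (f : C.hom V W) (g : C.hom W Y)
    (c : C.chain Y L Z) : lmul L (C.comp f g) c = lmul L f (lmul L g c) := by
  cases L with
  | nil => exact C.assoc f g c
  | cons X L =>
    refine chain_ext (F := lmul (X :: L) (C.comp f g))
      (G := lmul (X :: L) f ∘ₗ lmul (X :: L) g) (fun h c => ?_) c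
    rw [LinearMap.comp_apply, lmul_cons, lmul_cons, lmul_cons, C.assoc]

theorem one_lmul {Y Z : C.Obj} (L : List C.Obj) (c : C.chain Y L Z) : lmul L (C.one Y) c = c := by
  cases L with
  | nil => exact C.one_comp c
  | cons X L =>
    refine chain_ext (F := lmul (X :: L) (C.one Y)) (G := LinearMap.id) (fun h c => ?_) c
    rw [LinearMap.id_apply, lmul_cons, C.one_comp]

theorem rmul_one {Z : C.Obj} (L : List C.Obj) {Y : C.Obj} (c : C.chain Y L Z) :
    rmul L Y c (C.one Z) = c := by
  induction L generalizing Y with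
  | nil => exact C.comp_one c
  | cons X L ih =>
    refine chain_ext (F := (rmul (X :: L) Y).flip (C.one Z)) (G := LinearMap.id)
      (fun h c => ?_) c
    rw [LinearMap.id_apply, LinearMap.flip_apply, rmul_cons, ih]

theorem rmul_comp {Z Z' Z'' : C.Obj} (L : List C.Obj) {Y : C.Obj} (c : C.chain Y L Z)
    (f : C.hom Z Z') (g : C.hom Z' Z'') :
    rmul L Y c (C.comp f g) = rmul L Y (rmul L Y c f) g := by
  induction L generalizing Y with
  | nil => exact (C.assoc c f g).symm
  | cons X L ih =>
    refine chain_ext (F := (rmul (X :: L) Y).flip (C.comp f g))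
      (G := (rmul (X :: L) Y).flip g ∘ₗ (rmul (X :: L) Y).flip f) (fun h c => ?_) c
    simp only [LinearMap.comp_apply, LinearMap.flip_apply]
    rw [rmul_cons, rmul_cons, rmul_cons, ih]

theorem lmul_rmul {W Y Z Z' : C.Obj} (L : List C.Obj) (f : C.hom W Y) (c : C.chain Y L Z)
    (g : C.hom Z Z') : rmul L W (lmul L f c) g = lmul L f (rmul L Y c g) := by
  cases L with
  | nil => exact C.assoc f c g
  | cons X L =>
    refine chain_ext (F := (rmul (X :: L) W).flip g ∘ₗ lmul (X :: L) f)
      (G := lmul (X :: L) f ∘ₗ (rmul (X :: L) Y).flip g) (fun h c => ?_) c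
    simp only [LinearMap.comp_apply, LinearMap.flip_apply]
    rw [rmul_cons, lmul_cons, lmul_cons, rmul_cons]

theorem d_lmul {W Y Z : C.Obj} (L : List C.Obj) (f : C.hom W Y) (c : C.chain Y L Z) :
    (C.chain W L Z).d (lmul L f c) = lmul L ((C.hom W Y).d f) c +
      lmul L ((C.hom W Y).signOp S.ι f) ((C.chain Y L Z).d c) := by
  cases L with
  | nil => exact C.d_comp' f c
  | cons X L =>
    refine chain_ext (F := (C.chain W (X :: L) Z).d ∘ₗ lmul (X :: L) f)
      (G := lmul (X :: L) ((C.hom W Y).d f) +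
        lmul (X :: L) ((C.hom W Y).signOp S.ι f) ∘ₗ (C.chain Y (X :: L) Z).d) (fun g c => ?_) c
    simp only [LinearMap.comp_apply, LinearMap.add_apply]
    rw [lmul_cons, lmul_cons, chain_d_cons, chain_d_cons, map_add (lmul (X :: L) _), lmul_cons,
      lmul_cons, C.d_comp', C.signOp_comp, map_add chainCons, LinearMap.add_apply, add_assoc]

theorem d_rmul {Z Z' : C.Obj} (L : List C.Obj) {Y : C.Obj} (c : C.chain Y L Z)
    (g : C.hom Z Z') : (C.chain Y L Z').d (rmul L Y c g) = rmul L Y ((C.chain Y L Z).d c) g +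
      rmul L Y ((C.chain Y L Z).signOp S.ι c) ((C.hom Z Z').d g) := by
  induction L generalizing Y with
  | nil => exact C.d_comp' c g
  | cons X L ih =>
    refine chain_ext (F := (C.chain Y (X :: L) Z').d ∘ₗ (rmul (X :: L) Y).flip g)
      (G := (rmul (X :: L) Y).flip g ∘ₗ (C.chain Y (X :: L) Z).d +
        (rmul (X :: L) Y).flip ((C.hom Z Z').d g) ∘ₗ (C.chain Y (X :: L) Z).signOp S.ι)
      (fun f c => ?_) c
    simp only [LinearMap.comp_apply, LinearMap.add_apply, LinearMap.flip_apply]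
    rw [rmul_cons, chain_d_cons, chain_d_cons, chain_signOp_cons, map_add (rmul (X :: L) Y),
      LinearMap.add_apply, rmul_cons, rmul_cons, rmul_cons, ih, map_add (chainCons _), add_assoc]

theorem face_lmul {W Y Z : C.Obj} (L : List C.Obj) (i : ℕ) (f : C.hom W Y) (c : C.chain Y L Z) :
    face L W i (lmul L f c) = lmul (L.eraseIdx i) f (face L Y i c) := by
  cases L with
  | nil => exact (map_zero (lmul [] f)).symm
  | cons X L =>
    refine chain_ext (F := face (X :: L) W i ∘ₗ lmul (X :: L) f)
      (G := lmul ((X :: L).eraseIdx i) f ∘ₗ face (X :: L) Y i) (fun g c => ?_) c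
    rw [LinearMap.comp_apply, LinearMap.comp_apply]
    cases i with
    | zero => rw [lmul_cons, face_zero, face_zero]; exact comp_lmul L f g c
    | succ i => rw [lmul_cons, face_succ, face_succ]; exact (lmul_cons f g _).symm

theorem face_rmul {Z Z' : C.Obj} (L : List C.Obj) {Y : C.Obj} (i : ℕ) (c : C.chain Y L Z)
    (g : C.hom Z Z') :
    face L Y i (rmul L Y c g) = rmul (L.eraseIdx i) Y (face L Y i c) g := by
  induction L generalizing Y i with
  | nil => exact (LinearMap.congr_fun (map_zero (rmul [] Y)) g).symm
  | cons X L ih =>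
    refine chain_ext (F := face (X :: L) Y i ∘ₗ (rmul (X :: L) Y).flip g)
      (G := (rmul ((X :: L).eraseIdx i) Y).flip g ∘ₗ face (X :: L) Y i) (fun f c => ?_) c
    simp only [LinearMap.comp_apply, LinearMap.flip_apply]
    cases i with
    | zero => rw [rmul_cons, face_zero, face_zero]; exact (lmul_rmul L f c g).symm
    | succ i =>
      rw [rmul_cons, face_succ, face_succ, ih]
      exact (rmul_cons f _ g).symm

theorem face_d {Z : C.Obj} (L : List C.Obj) {Y : C.Obj} (i : ℕ) (c : C.chain Y L Z) :
    face L Y i ((C.chain Y L Z).d c) = (C.chain Y (L.eraseIdx i) Z).d (face L Y i c) := by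
  induction L generalizing Y i with
  | nil => exact (map_zero (C.chain Y [] Z).d).symm
  | cons X L ih =>
    refine chain_ext (F := face (X :: L) Y i ∘ₗ (C.chain Y (X :: L) Z).d)
      (G := (C.chain Y ((X :: L).eraseIdx i) Z).d ∘ₗ face (X :: L) Y i) (fun f c => ?_) c
    simp only [LinearMap.comp_apply]
    rw [chain_d_cons, map_add]
    cases i with
    | zero => rw [face_zero, face_zero, face_zero]; exact (d_lmul L f c).symm
    | succ i =>
      rw [face_succ, face_succ, face_succ, ih]
      exact (chain_d_cons f _).symm

end DGCategory
end Bar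

section BarComplex
universe u v w o
variable {k : Type u} [CommRing k] {Γ : Type v} [AddCommGroup Γ] {S : GradingDatum Γ}

/-- The shift `-r ι` of the `r`-th term of the bar complex. -/
def barShift (S : GradingDatum Γ) (r : ℕ) : Γ := -(r • S.ι)

theorem barShift_succ (r : ℕ) : barShift S (r + 1) + S.ι = barShift S r := by
  simp only [barShift, succ_nsmul]; abel

theorem sgn_barShift_succ (r : ℕ) :
    sgn k (S.pair (barShift S (r + 1)) S.ι) = -sgn k (S.pair (barShift S r) S.ι) := by
  rw [← barShift_succ r, map_add, AddMonoidHom.add_apply, sgn_add, S.pair_ι, sgn_one]; ring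

namespace DGCategory
variable (C : DGCategory.{u, v, w, o} k S)

/-- The direct sum of all chains. -/
def allChains (Y Y' : C.Obj) : DGModule k S := DGModule.sum fun L : List C.Obj => C.chain Y L Y'

/-- The untwisted bar complex
`⨁_{r ≥ 0} q^{-rι} ⨁_{X₀, …, X_r} ⟨Y|X₀⟩ ⊗ ⟨X₀|X₁⟩ ⊗ ⋯ ⊗ ⟨X_r|Y'⟩`. The summands are indexed by
the pairs `(X₀, [X₁, …, X_r])`. -/
def barSum (Y Y' : C.Obj) : DGModule k S :=
  DGModule.sum fun p : C.Obj × List C.Obj =>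
    (C.chain Y (p.1 :: p.2) Y').shift (barShift S p.2.length)

/-- The inclusion of a summand in the bar complex. -/
def barInj {Y Y' : C.Obj} (X : C.Obj) (L : List C.Obj) :
    C.chain Y (X :: L) Y' →ₗ[k] C.barSum Y Y' :=
  DGModule.inj (fun p : C.Obj × List C.Obj =>
    (C.chain Y (p.1 :: p.2) Y').shift (barShift S p.2.length)) (X, L)

/-- The chain `f₀ ⊗ ⋯ ⊗ f_{r+1}` as an element of the bar complex (zero if there are no intermediate
objects). -/
def ofChain {Y Y' : C.Obj} : (L : List C.Obj) → (C.chain Y L Y' →ₗ[k] C.barSum Y Y')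
  | [] => 0
  | X :: L => C.barInj X L

/-- The linear map out of the bar complex given by its restrictions to the summands. -/
def barDesc {Y Y' : C.Obj} {P : Type*} [AddCommGroup P] [Module k P]
    (f : ∀ X L, C.chain Y (X :: L) Y' →ₗ[k] P) : C.barSum Y Y' →ₗ[k] P :=
  DGModule.desc (fun p : C.Obj × List C.Obj =>
    (C.chain Y (p.1 :: p.2) Y').shift (barShift S p.2.length)) fun p => f p.1 p.2

theorem barDesc_inj {Y Y' : C.Obj} {P : Type*} [AddCommGroup P] [Module k P]
    (f : ∀ X L, C.chain Y (X :: L) Y' →ₗ[k] P) (X : C.Obj) (L : List C.Obj)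
    (c : C.chain Y (X :: L) Y') : C.barDesc f (C.barInj X L c) = f X L c :=
  DGModule.desc_inj (fun p : C.Obj × List C.Obj =>
    (C.chain Y (p.1 :: p.2) Y').shift (barShift S p.2.length)) (fun p => f p.1 p.2) (X, L) c

theorem bar_ext {Y Y' : C.Obj} {P : Type*} [AddCommGroup P] [Module k P]
    {f g : C.barSum Y Y' →ₗ[k] P}
    (h : ∀ X L c, f (C.barInj X L c) = g (C.barInj X L c)) (x : C.barSum Y Y') : f x = g x :=
  DGModule.sum_ext (fun p : C.Obj × List C.Obj =>
    (C.chain Y (p.1 :: p.2) Y').shift (barShift S p.2.length)) (fun p c => h p.1 p.2 c) x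

theorem bar_mem {Y Y' : C.Obj} {P : Type*} [AddCommGroup P] [Module k P]
    (Q : Submodule k P) (f : C.barSum Y Y' →ₗ[k] P) (n : Γ)
    (h : ∀ X L, ∀ c ∈ (C.chain Y (X :: L) Y').deg (n - barShift S L.length),
      f (C.barInj X L c) ∈ Q) {x : C.barSum Y Y'} (hx : x ∈ (C.barSum Y Y').deg n) : f x ∈ Q :=
  DGModule.map_mem_of_inj (fun p : C.Obj × List C.Obj =>
    (C.chain Y (p.1 :: p.2) Y').shift (barShift S p.2.length)) Q f n
    (fun p c hc => h p.1 p.2 c hc) hx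

theorem barInj_mem {Y Y' X : C.Obj} {L : List C.Obj} {n : Γ} {c : C.chain Y (X :: L) Y'}
    (hc : c ∈ (C.chain Y (X :: L) Y').deg (n - barShift S L.length)) :
    C.barInj X L c ∈ (C.barSum Y Y').deg n :=
  DGModule.inj_mem (fun p : C.Obj × List C.Obj =>
    (C.chain Y (p.1 :: p.2) Y').shift (barShift S p.2.length)) (a := (X, L)) hc

theorem barSum_d_inj {Y Y' : C.Obj} (X : C.Obj) (L : List C.Obj) (c : C.chain Y (X :: L) Y') :
    (C.barSum Y Y').d (C.barInj X L c) = sgn k (S.pair (barShift S L.length) S.ι) •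
      C.barInj X L ((C.chain Y (X :: L) Y').d c) := by
  rw [← map_smul]
  exact DGModule.sum_d_inj (fun p : C.Obj × List C.Obj =>
    (C.chain Y (p.1 :: p.2) Y').shift (barShift S p.2.length)) (X, L) c

/-- The bar differential
`δ [f₀, …, f_{r+1}] = ∑_{i=0}^r (-1)^i [f₀, …, f_i ∘ f_{i+1}, …, f_{r+1}]` (and `δ = 0` for
`r = 0`). -/
def barδ (Y Y' : C.Obj) : C.barSum Y Y' →ₗ[k] C.barSum Y Y' :=
  C.barDesc fun X L => ∑ i ∈ Finset.range (L.length + 1),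
    (-1 : k) ^ i • (C.ofChain ((X :: L).eraseIdx i) ∘ₗ face (X :: L) Y i)

theorem barδ_inj {Y Y' : C.Obj} (X : C.Obj) (L : List C.Obj) (c : C.chain Y (X :: L) Y') :
    C.barδ Y Y' (C.barInj X L c) = ∑ i ∈ Finset.range (L.length + 1),
      (-1 : k) ^ i • C.ofChain ((X :: L).eraseIdx i) (face (X :: L) Y i c) := by
  rw [barδ, barDesc_inj]
  simp only [LinearMap.sum_apply, LinearMap.smul_apply, LinearMap.comp_apply]

/-- The inclusion of a summand in the sum of all chains. -/
def allInj {Y Y' : C.Obj} (L : List C.Obj) : C.chain Y L Y' →ₗ[k] C.allChains Y Y' :=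
  DGModule.inj (fun L : List C.Obj => C.chain Y L Y') L

/-- The linear map out of the sum of all chains given by its restrictions to the summands. -/
def allDesc {Y Y' : C.Obj} {P : Type*} [AddCommGroup P] [Module k P]
    (f : ∀ L, C.chain Y L Y' →ₗ[k] P) : C.allChains Y Y' →ₗ[k] P :=
  DGModule.desc (fun L : List C.Obj => C.chain Y L Y') f

theorem allDesc_inj {Y Y' : C.Obj} {P : Type*} [AddCommGroup P] [Module k P]
    (f : ∀ L, C.chain Y L Y' →ₗ[k] P) (L : List C.Obj) (c : C.chain Y L Y') :
    C.allDesc f (C.allInj L c) = f L c :=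
  DGModule.desc_inj (fun L : List C.Obj => C.chain Y L Y') f L c

theorem all_ext {Y Y' : C.Obj} {P : Type*} [AddCommGroup P] [Module k P]
    {f g : C.allChains Y Y' →ₗ[k] P}
    (h : ∀ L c, f (C.allInj L c) = g (C.allInj L c)) (x : C.allChains Y Y') : f x = g x :=
  DGModule.sum_ext (fun L : List C.Obj => C.chain Y L Y') h x

/-- The augmented bar differential, on the sum of all chains. -/
def allδ (Y Y' : C.Obj) : C.allChains Y Y' →ₗ[k] C.allChains Y Y' :=
  C.allDesc fun L => ∑ i ∈ Finset.range L.length,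
    (-1 : k) ^ i • (C.allInj (L.eraseIdx i) ∘ₗ face L Y i)

theorem allδ_inj {Y Y' : C.Obj} (L : List C.Obj) (c : C.chain Y L Y') :
    C.allδ Y Y' (C.allInj L c) = ∑ i ∈ Finset.range L.length,
      (-1 : k) ^ i • C.allInj (L.eraseIdx i) (face L Y i c) := by
  rw [allδ, allDesc_inj]
  simp only [LinearMap.sum_apply, LinearMap.smul_apply, LinearMap.comp_apply]

/-- Tensoring with `f` on the left, on the sum of all chains. -/
def allCons {Y X Y' : C.Obj} (f : C.hom Y X) : C.allChains X Y' →ₗ[k] C.allChains Y Y' :=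
  C.allDesc fun L => C.allInj (X :: L) ∘ₗ chainCons f

theorem allCons_inj {Y X Y' : C.Obj} (f : C.hom Y X) (L : List C.Obj) (c : C.chain X L Y') :
    C.allCons f (C.allInj L c) = C.allInj (X :: L) (chainCons f c) := by
  rw [allCons, allDesc_inj]; rfl

/-- Composing with `f` on the left, on the sum of all chains. -/
def allLmul {Y X Y' : C.Obj} (f : C.hom Y X) : C.allChains X Y' →ₗ[k] C.allChains Y Y' :=
  C.allDesc fun L => C.allInj L ∘ₗ lmul L f

theorem allLmul_inj {Y X Y' : C.Obj} (f : C.hom Y X) (L : List C.Obj) (c : C.chain X L Y') :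
    C.allLmul f (C.allInj L c) = C.allInj L (lmul L f c) := by
  rw [allLmul, allDesc_inj]; rfl

theorem allδ_cons {Y X Y' : C.Obj} (f : C.hom Y X) (x : C.allChains X Y') :
    C.allδ Y Y' (C.allCons f x) = C.allLmul f x - C.allCons f (C.allδ X Y' x) := by
  refine C.all_ext (f := C.allδ Y Y' ∘ₗ C.allCons f)
    (g := C.allLmul f - C.allCons f ∘ₗ C.allδ X Y') (fun L c => ?_) x
  simp only [LinearMap.comp_apply, LinearMap.sub_apply]
  rw [allCons_inj, allδ_inj, allδ_inj, allLmul_inj, List.length_cons, Finset.sum_range_succ',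
    map_sum, pow_zero, one_smul, face_zero, add_comm, sub_eq_add_neg, ← Finset.sum_neg_distrib]
  refine congrArg₂ _ rfl (Finset.sum_congr rfl fun i _ => ?_)
  rw [face_succ, map_smul, allCons_inj, pow_succ, mul_neg_one, neg_smul]
  rfl

theorem allδ_lmul {Y X Y' : C.Obj} (f : C.hom Y X) (x : C.allChains X Y') :
    C.allδ Y Y' (C.allLmul f x) = C.allLmul f (C.allδ X Y' x) := by
  refine C.all_ext (f := C.allδ Y Y' ∘ₗ C.allLmul f)
    (g := C.allLmul f ∘ₗ C.allδ X Y') (fun L c => ?_) x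
  simp only [LinearMap.comp_apply]
  rw [allLmul_inj, allδ_inj, allδ_inj, map_sum]
  refine Finset.sum_congr rfl fun i _ => ?_
  rw [map_smul, allLmul_inj, face_lmul]

theorem allδ_allδ {Y Y' : C.Obj} (x : C.allChains Y Y') :
    C.allδ Y Y' (C.allδ Y Y' x) = 0 := by
  refine C.all_ext (f := C.allδ Y Y' ∘ₗ C.allδ Y Y') (g := 0) (fun L c => ?_) x
  rw [LinearMap.comp_apply, LinearMap.zero_apply]
  induction L generalizing Y with
  | nil => rw [allδ_inj, List.length_nil, Finset.sum_range_zero, map_zero]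
  | cons X L ih =>
    refine chain_ext (F := C.allδ Y Y' ∘ₗ C.allδ Y Y' ∘ₗ C.allInj (X :: L)) (G := 0)
      (fun f c => ?_) c
    simp only [LinearMap.comp_apply, LinearMap.zero_apply]
    rw [← allCons_inj, allδ_cons, map_sub, allδ_cons, allδ_lmul, ih (C.allInj L c), map_zero,
      sub_zero, sub_self]

theorem barδ_allDesc {Y Y' : C.Obj} (x : C.allChains Y Y') :
    C.barδ Y Y' (C.allDesc C.ofChain x) = C.allDesc C.ofChain (C.allδ Y Y' x) := by
  refine C.all_ext (f := C.barδ Y Y' ∘ₗ C.allDesc C.ofChain)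
    (g := C.allDesc C.ofChain ∘ₗ C.allδ Y Y') (fun L c => ?_) x
  simp only [LinearMap.comp_apply]
  rw [allDesc_inj, allδ_inj, map_sum]
  cases L with
  | nil =>
    rw [List.length_nil, Finset.sum_range_zero]
    exact map_zero (C.barδ Y Y')
  | cons X L =>
    rw [ofChain, barδ_inj]
    refine Finset.sum_congr rfl fun i _ => ?_
    rw [map_smul, allDesc_inj]

theorem barδ_barδ {Y Y' : C.Obj} (x : C.barSum Y Y') :
    C.barδ Y Y' (C.barδ Y Y' x) = 0 := by
  refine C.bar_ext (f := C.barδ Y Y' ∘ₗ C.barδ Y Y') (g := 0) (fun X L c => ?_) x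
  have h : C.barInj X L c = C.allDesc C.ofChain (C.allInj (X :: L) c) :=
    (C.allDesc_inj C.ofChain (X :: L) c).symm
  rw [LinearMap.comp_apply, h, barδ_allDesc, barδ_allDesc, allδ_allδ, map_zero,
    LinearMap.zero_apply]

theorem length_eraseIdx_cons (X : C.Obj) (L : List C.Obj) {i : ℕ}
    (hi : i ∈ Finset.range (L.length + 1)) : ((X :: L).eraseIdx i).length = L.length := by
  rw [Finset.mem_range] at hi
  rw [List.length_eraseIdx_of_lt (by simpa using hi)]; simp

theorem ofChain_mem {Y Y' : C.Obj} (L : List C.Obj) {r : ℕ} (hL : L.length = r) {n : Γ}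
    {c : C.chain Y L Y'} (hc : c ∈ (C.chain Y L Y').deg (n - barShift S r)) :
    C.ofChain L c ∈ (C.barSum Y Y').deg (n + S.ι) := by
  cases L with
  | nil => exact Submodule.zero_mem _
  | cons X L =>
    refine C.barInj_mem ?_
    rw [List.length_cons] at hL
    rwa [← barShift_succ, hL, add_sub_add_right_eq_sub]

theorem ofChain_d {Y Y' : C.Obj} (L : List C.Obj) {r : ℕ} (hL : L.length = r)
    (c : C.chain Y L Y') : (C.barSum Y Y').d (C.ofChain L c) =
      -(sgn k (S.pair (barShift S r) S.ι) • C.ofChain L ((C.chain Y L Y').d c)) := by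
  cases L with
  | nil =>
    refine (map_zero (C.barSum Y Y').d).trans ?_
    exact (neg_eq_zero.2 (smul_zero _)).symm
  | cons X L =>
    rw [List.length_cons] at hL
    rw [ofChain, barSum_d_inj, ← hL, sgn_barShift_succ, neg_smul, neg_neg]

theorem barδ_mem {Y Y' : C.Obj} (n : Γ) (x : C.barSum Y Y') (hx : x ∈ (C.barSum Y Y').deg n) :
    C.barδ Y Y' x ∈ (C.barSum Y Y').deg (n + S.ι) := by
  refine C.bar_mem _ (C.barδ Y Y') n (fun X L c hc => ?_) hx
  rw [barδ_inj]
  exact Submodule.sum_mem _ fun i hi => Submodule.smul_mem _ _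
    (C.ofChain_mem _ (C.length_eraseIdx_cons X L hi) (face_mem (X :: L) i hc))

theorem barδ_d {Y Y' : C.Obj} (x : C.barSum Y Y') :
    (C.barSum Y Y').d (C.barδ Y Y' x) + C.barδ Y Y' ((C.barSum Y Y').d x) = 0 := by
  refine C.bar_ext (f := (C.barSum Y Y').d ∘ₗ C.barδ Y Y' + C.barδ Y Y' ∘ₗ (C.barSum Y Y').d)
    (g := 0) (fun X L c => ?_) x
  simp only [LinearMap.comp_apply, LinearMap.add_apply, LinearMap.zero_apply]
  rw [barδ_inj, barSum_d_inj, map_smul, barδ_inj, map_sum, Finset.smul_sum,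
    ← Finset.sum_add_distrib]
  refine Finset.sum_eq_zero fun i hi => ?_
  rw [map_smul, C.ofChain_d _ (C.length_eraseIdx_cons X L hi), face_d]
  module

/-- The dg module `⟨Y|Bar(C)|Y'⟩ = tw_δ(⨁_{r ≥ 0} q^{-rι} ⨁ ⟨Y|X₀⟩ ⊗ ⋯ ⊗ ⟨X_r|Y'⟩)`. -/
def barVal (Y Y' : C.Obj) : DGModule k S :=
  (C.barSum Y Y').twist (C.barδ Y Y') (C.barδ_mem) fun x => by
    rw [barδ_d, barδ_barδ, add_zero]

/-- The left action on the bar complex: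
`g · [f₀, …, f_{r+1}] = (-1)^(r ⟨ι,|g|⟩) [g ∘ f₀, …, f_{r+1}]`. -/
def barLact {W Y Y' : C.Obj} : C.hom W Y →ₗ[k] C.barSum Y Y' →ₗ[k] C.barSum W Y' :=
  LinearMap.flip (C.barDesc fun X L => LinearMap.flip
    ((lmul (X :: L)).compr₂ (C.barInj X L) ∘ₗ (C.hom W Y).signOp (barShift S L.length)))

/-- The right action on the bar complex: `[f₀, …, f_{r+1}] · g = [f₀, …, f_{r+1} ∘ g]`. -/
def barRact {Y Y' Z : C.Obj} : C.barSum Y Y' →ₗ[k] C.hom Y' Z →ₗ[k] C.barSum Y Z :=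
  C.barDesc fun X L => (rmul (X :: L) Y).compr₂ (C.barInj X L)

theorem barLact_inj {W Y Y' : C.Obj} (f : C.hom W Y) (X : C.Obj) (L : List C.Obj)
    (c : C.chain Y (X :: L) Y') : C.barLact f (C.barInj X L c) =
      C.barInj X L (lmul (X :: L) ((C.hom W Y).signOp (barShift S L.length) f) c) := by
  rw [barLact, LinearMap.flip_apply, barDesc_inj]; rfl

theorem barRact_inj {Y Y' Z : C.Obj} (X : C.Obj) (L : List C.Obj) (c : C.chain Y (X :: L) Y')
    (g : C.hom Y' Z) :
    C.barRact (C.barInj X L c) g = C.barInj X L (rmul (X :: L) Y c g) := by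
  rw [barRact, barDesc_inj]; rfl

theorem barLact_ofChain {W Y Y' : C.Obj} (f : C.hom W Y) (L : List C.Obj) {r : ℕ}
    (hL : L.length = r) (c : C.chain Y L Y') :
    C.barLact ((C.hom W Y).signOp S.ι f) (C.ofChain L c) =
      C.ofChain L (lmul L ((C.hom W Y).signOp (barShift S r) f) c) := by
  cases L with
  | nil => exact map_zero (C.barLact ((C.hom W Y).signOp S.ι f))
  | cons X L =>
    rw [List.length_cons] at hL
    rw [ofChain, barLact_inj, ← barShift_succ, DGModule.signOp_add, DGModule.signOp_self, hL]
    rfl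

theorem barRact_ofChain {Y Y' Z : C.Obj} (L : List C.Obj) (c : C.chain Y L Y')
    (g : C.hom Y' Z) : C.barRact (C.ofChain L c) g = C.ofChain L (rmul L Y c g) := by
  cases L with
  | nil => exact LinearMap.congr_fun (map_zero C.barRact) g
  | cons X L => exact C.barRact_inj X L c g

theorem barδ_lact {W Y Y' : C.Obj} (f : C.hom W Y) (x : C.barSum Y Y') :
    C.barδ W Y' (C.barLact f x) = C.barLact ((C.hom W Y).signOp S.ι f) (C.barδ Y Y' x) := by
  refine C.bar_ext (f := C.barδ W Y' ∘ₗ C.barLact f)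
    (g := C.barLact ((C.hom W Y).signOp S.ι f) ∘ₗ C.barδ Y Y') (fun X L c => ?_) x
  simp only [LinearMap.comp_apply]
  rw [barLact_inj, barδ_inj, barδ_inj, map_sum]
  refine Finset.sum_congr rfl fun i hi => ?_
  rw [map_smul, C.barLact_ofChain f _ (C.length_eraseIdx_cons X L hi), face_lmul]

theorem barδ_ract {Y Y' Z : C.Obj} (x : C.barSum Y Y') (g : C.hom Y' Z) :
    C.barδ Y Z (C.barRact x g) = C.barRact (C.barδ Y Y' x) g := by
  refine C.bar_ext (f := C.barδ Y Z ∘ₗ C.barRact.flip g)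
    (g := C.barRact.flip g ∘ₗ C.barδ Y Y') (fun X L c => ?_) x
  simp only [LinearMap.comp_apply, LinearMap.flip_apply]
  rw [barRact_inj, barδ_inj, barδ_inj, map_sum, LinearMap.sum_apply]
  refine Finset.sum_congr rfl fun i hi => ?_
  rw [map_smul, LinearMap.smul_apply, barRact_ofChain, face_rmul]

theorem barSum_signOp_inj {Y Y' X : C.Obj} {L : List C.Obj} {n : Γ} {c : C.chain Y (X :: L) Y'}
    (hc : c ∈ (C.chain Y (X :: L) Y').deg (n - barShift S L.length)) (a : Γ) :
    (C.barSum Y Y').signOp a (C.barInj X L c) = sgn k (S.pair a n) • C.barInj X L c :=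
  DGModule.signOp_of_mem _ _ (C.barInj_mem hc)

/-- The two-sided bar complex of `C`. -/
def Bar : DGBimodule C C where
  val := C.barVal
  lact := C.barLact
  ract := C.barRact
  lact_mem {W Y Y' i j f x} hf hx := by
    refine C.bar_mem _ (C.barLact f) j (fun X L c hc => ?_) hx
    rw [barLact_inj]
    refine C.barInj_mem ?_
    have := lmul_mem (X :: L) (DGModule.signOp_mem _ (barShift S L.length) hf) hc
    rwa [← add_sub_assoc] at this
  ract_mem {Y Y' Z i j x g} hx hg := by
    refine C.bar_mem _ (C.barRact.flip g) i (fun X L c hc => ?_) hx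
    rw [LinearMap.flip_apply, barRact_inj]
    refine C.barInj_mem ?_
    have := rmul_mem (X :: L) hc hg
    rwa [sub_add_eq_add_sub] at this
  d_lact {W Y Y' i f} x hf := by
    refine C.bar_ext (f := ((C.barSum W Y').d + C.barδ W Y') ∘ₗ C.barLact f)
      (g := C.barLact ((C.hom W Y).d f) +
        sgn k (S.pair S.ι i) • (C.barLact f ∘ₗ ((C.barSum Y Y').d + C.barδ Y Y')))
      (fun X L c => ?_) x
    simp only [LinearMap.comp_apply, LinearMap.add_apply, LinearMap.smul_apply]
    rw [barδ_lact, map_add (C.barLact f), DGModule.signOp_of_mem _ _ hf, map_smul C.barLact,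
      LinearMap.smul_apply, smul_add, ← add_assoc]
    refine congrArg₂ _ ?_ rfl
    rw [barSum_d_inj, map_smul (C.barLact f), barLact_inj, barLact_inj, barLact_inj, barSum_d_inj,
      d_lmul, DGModule.signOp_d, DGModule.signOp_of_mem _ (barShift S L.length) hf,
      map_smul ((C.hom W Y).signOp S.ι), DGModule.signOp_of_mem _ _ hf]
    simp only [map_add, map_smul, LinearMap.smul_apply]
    module
  d_ract {Y Y' Z i x} g hx := by
    have := C.bar_mem ⊥ (((C.barSum Y Z).d + C.barδ Y Z) ∘ₗ C.barRact.flip g -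
      (C.barRact.flip g ∘ₗ ((C.barSum Y Y').d + C.barδ Y Y') +
        sgn k (S.pair S.ι i) • C.barRact.flip ((C.hom Y' Z).d g))) i (fun X L c hc => ?_) hx
    · exact sub_eq_zero.1 this
    · simp only [LinearMap.comp_apply, LinearMap.add_apply, LinearMap.smul_apply,
        LinearMap.sub_apply, LinearMap.flip_apply]
      rw [Submodule.mem_bot, map_add C.barRact, LinearMap.add_apply, barδ_ract, barSum_d_inj,
        map_smul C.barRact, LinearMap.smul_apply, barRact_inj, barRact_inj, barRact_inj,
        barSum_d_inj, d_rmul, DGModule.signOp_of_mem _ _ hc, map_smul (rmul (X :: L) Y),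
        LinearMap.smul_apply, map_add (C.barInj X L), map_smul (C.barInj X L),
        map_sub (S.pair S.ι), sgn_sub, S.symm S.ι (barShift S L.length), smul_add, smul_smul,
        mul_comm, mul_assoc, sgn_mul_self]
      module
  one_lact {Y Y'} x := by
    refine C.bar_ext (f := C.barLact (C.one Y)) (g := LinearMap.id) (fun X L c => ?_) x
    rw [barLact_inj, signOp_one, one_lmul, LinearMap.id_apply]
  ract_one {Y Y'} x := by
    refine C.bar_ext (f := C.barRact.flip (C.one Y')) (g := LinearMap.id) (fun X L c => ?_) x
    rw [LinearMap.flip_apply, barRact_inj, rmul_one, LinearMap.id_apply]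
  comp_lact {V W Y Y'} f g x := by
    refine C.bar_ext (f := C.barLact (C.comp f g)) (g := C.barLact f ∘ₗ C.barLact g)
      (fun X L c => ?_) x
    rw [LinearMap.comp_apply, barLact_inj, barLact_inj, barLact_inj, signOp_comp, comp_lmul]
  ract_comp {Y Y' Z Z'} x f g := by
    refine C.bar_ext (f := C.barRact.flip (C.comp f g))
      (g := C.barRact.flip g ∘ₗ C.barRact.flip f) (fun X L c => ?_) x
    simp only [LinearMap.comp_apply, LinearMap.flip_apply]
    rw [barRact_inj, barRact_inj, barRact_inj, rmul_comp]
  lact_ract {W Y Y' Z} f x g := by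
    refine C.bar_ext (f := C.barRact.flip g ∘ₗ C.barLact f)
      (g := C.barLact f ∘ₗ C.barRact.flip g) (fun X L c => ?_) x
    simp only [LinearMap.comp_apply, LinearMap.flip_apply]
    rw [barLact_inj, barRact_inj, barRact_inj, barLact_inj, lmul_rmul]

variable {C}

/-- Composable sequences of morphisms: for `L = [X₀, …, X_r]`, an element of `C.Seq Y L Y'` is a
sequence `(f₀, …, f_{r+1})` with `f₀ ∈ ⟨Y|X₀⟩`, `f_u ∈ ⟨X_{u-1}|X_u⟩`, `f_{r+1} ∈ ⟨X_r|Y'⟩`. -/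
inductive Seq (C : DGCategory.{u, v, w, o} k S) : C.Obj → List C.Obj → C.Obj → Type (max o w)
  | last {Y Y' : C.Obj} (f : C.hom Y Y') : Seq C Y [] Y'
  | cons {Y X Y' : C.Obj} {L : List C.Obj} (f : C.hom Y X) (s : Seq C X L Y') : Seq C Y (X :: L) Y'

/-- The simple tensor `f₀ ⊗ ⋯ ⊗ f_{r+1}` of a composable sequence. -/
def Seq.pure {Y Y' : C.Obj} : {L : List C.Obj} → C.Seq Y L Y' → C.chain Y L Y'
  | _, .last f => f
  | _, .cons f s => chainCons f s.pure

/-- The element `[f₀, …, f_{r+1}]` of the bar complex. -/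
def bracket {Y Y' X : C.Obj} {L : List C.Obj} (s : C.Seq Y (X :: L) Y') : C.Bar.val Y Y' :=
  C.barInj X L s.pure

/-- The morphism `f` of `C` underlying a morphism `f^j_i` of `SB(C)`. -/
def bare {A B : C.SB.Obj} : C.SB.hom A B →ₗ[k] C.hom A.obj B.obj := LinearMap.id

/-- The sequence `(f₀, …, f_{r+1})` in `C` underlying a composable sequence
`((f₀)^{i_{-1}}_{i_0}, …, (f_{r+1})^{i_r}_{i_{r+1}})` in `SB(C)`. -/
def Seq.bare : {A B : C.SB.Obj} → {L : List C.SB.Obj} → C.SB.Seq A L B →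
    C.Seq A.obj (L.map SBObj.obj) B.obj
  | _, _, _, .last f => .last (DGCategory.bare f)
  | _, _, _, .cons f s => .cons (DGCategory.bare f) s.bare

variable (C)

/-- The bimodule `SB(C) ⊗_C Bar(C) ⊗_C SB(C)` over `SB(C)`. -/
def SBBarSB : DGBimodule C.SB C.SB :=
  (((DGFunctor.id C.SB).bimodule C.η).tensor C.Bar).tensor (C.η.bimodule (DGFunctor.id C.SB))

variable {C}

/-- The element `g · x · g'` of `SB(C) ⊗_C Bar(C) ⊗_C SB(C)`, for `x ∈ ⟨Y|Bar(C)|Y'⟩`. -/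
def sandwich {A B : C.SB.Obj} {Y Y' : C.Obj} (g : C.SB.hom A ⟨0, Y⟩) (x : C.Bar.val Y Y')
    (g' : C.SB.hom ⟨0, Y'⟩ B) : C.SBBarSB.val A B :=
  DGBimodule.tmul (((DGFunctor.id C.SB).bimodule C.η).tensor C.Bar)
    (C.η.bimodule (DGFunctor.id C.SB)) (Y := Y')
    (DGBimodule.tmul ((DGFunctor.id C.SB).bimodule C.η) C.Bar (Y := Y) g x) g'

variable (C)

/-- A family of linear maps `ξ : Bar(SB(C)) → SB(C) ⊗_C Bar(C) ⊗_C SB(C)` is given by the formula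
`ξ [f₀, …, f_{r+1}] = (-1)^(r ⟨ι,j⟩) φ_{Y,j} · [f₀, …, f_{r+1}] · φ_{Y',j'}⁻¹` on the composable
sequences of morphisms of `SB(C)` from `B = q^{j'} Y'` to `A = q^j Y` through `r + 1` objects (on
the right, `f_u` stands for the morphism of `C` underlying the given morphism of `SB(C)`). -/
def IsXiSB (ξ : ∀ A B : C.SB.Obj, C.SB.Bar.val A B →ₗ[k] C.SBBarSB.val A B) : Prop :=
  ∀ (A B X : C.SB.Obj) (L : List C.SB.Obj) (s : C.SB.Seq A (X :: L) B),
    ξ A B (bracket s) = sgn k ((L.length : ZMod 2) * S.pair S.ι A.shift) •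
      sandwich (C.φ A.obj A.shift) (bracket s.bare) (C.φinv B.obj B.shift)

end DGCategory

namespace DGBimodule

/-- A morphism of bimodules of degree `l`, i.e. an element of `Hom^l(M, N)` in the dg category of
bimodules. -/
structure Hom {C : DGCategory k S} {D : DGCategory k S} (M : DGBimodule C D)
    (N : DGBimodule C D) (l : Γ) where
  app : ∀ X Y, M.val X Y →ₗ[k] N.val X Y
  app_mem : ∀ {X Y} {i : Γ} {m : M.val X Y}, m ∈ (M.val X Y).deg i →
    app X Y m ∈ (N.val X Y).deg (i + l)
  app_lact : ∀ {X' X Y} {i : Γ} {f : C.hom X' X} (m : M.val X Y), f ∈ (C.hom X' X).deg i →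
    app X' Y (M.lact f m) = sgn k (S.pair l i) • N.lact f (app X Y m)
  app_ract : ∀ {X Y Y'} (m : M.val X Y) (g : D.hom Y Y'),
    app X Y' (M.ract m g) = N.ract (app X Y m) g

variable {C : DGCategory k S} {D : DGCategory k S} {M : DGBimodule C D} {N : DGBimodule C D}

/-- The differential of the hom complex: `d(F) = d ∘ F - (-1)^⟨ι,|F|⟩ F ∘ d`. -/
def Hom.diff {l : Γ} (F : Hom M N l) (X : C.Obj) (Y : D.Obj) : M.val X Y →ₗ[k] N.val X Y :=
  (N.val X Y).d ∘ₗ F.app X Y - sgn k (S.pair S.ι l) • (F.app X Y ∘ₗ (M.val X Y).d)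

/-- `F` is closed, i.e. commutes with the differentials up to the Koszul sign. -/
def Hom.IsClosed {l : Γ} (F : Hom M N l) : Prop := ∀ X Y, F.diff X Y = 0

/-- A degree zero morphism `F : M → N` is a homotopy equivalence if it is closed and there are a
closed degree zero morphism `G : N → M` and bimodule homotopies `h`, `h'` of degree `-ι` with
`G ∘ F - id = d(h)` and `F ∘ G - id = d(h')`. -/
def Hom.IsHomotopyEquiv (F : Hom M N 0) : Prop :=
  F.IsClosed ∧ ∃ (G : Hom N M 0) (h : Hom M M (-S.ι)) (h' : Hom N N (-S.ι)), G.IsClosed ∧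
    (∀ X Y, G.app X Y ∘ₗ F.app X Y - LinearMap.id = h.diff X Y) ∧
    ∀ X Y, F.app X Y ∘ₗ G.app X Y - LinearMap.id = h'.diff X Y

end DGBimodule
end BarComplex

end DGEnv

end

/-! The structural isomorphisms `φ` form a natural isomorphism between the identity of `SB(C)` and
the operation that replaces every `q^i X` by `q^0 X` and every `f^j_i` by `f^0_0`. Up to signs and
degree shifts, the theorem is the familiar fact that naturally isomorphic functors induce homotopic
maps on bar complexes.

Forgetting shifts, `f^j_i ↦ f`, is a functor except that it changes degrees by amounts depending on
the end objects (`SuspFunctor`). It still induces a map of bar complexes (`SuspFunctor.barMap`),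
once the `r`-th term is multiplied by `(-1)^(r⟨ι,j⟩)`. That map commutes with differentials up to
`(-1)^⟨ι,j⟩` and changes degrees by `j' - j`; placing `φ` on the left and `φ⁻¹` on the right repairs
both defects and gives `Ξ_SB`. Bilinearity is the naturality of `φ` and `φ⁻¹` combined with the
balancing relations. Uniqueness holds because the brackets span the bar complex.

The inverse `Θ` is `g ⊗ x ⊗ g' ↦ g · η(x) · g'`. Since `φ_{Y,0}` is an identity, `Ξ ∘ Θ` is the
identity on the nose (`xiSB_thetaSB`). In the other direction `Θ ∘ Ξ` sends `[f₀, …, f_{r+1}]` to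
`[φ ∘ f₀, f₁, …, f_r, f_{r+1} ∘ φ⁻¹]` with all intermediate objects unshifted (`thetaSB_xiSB_inj`).
It is joined to the identity by the prism operator that inserts `φ` after `f_u`, unshifts everything
to its right, and sums over `u` with alternating signs.

The homotopy identity is proved on the augmented complex `allChains`, where the empty list of
intermediate objects is allowed. There, with `σ` for `allStrip`, the operators obey `δ(f ⊗ x) = f·x
- f ⊗ δx` and `H(f ⊗ x) = f ⊗ φ ⊗ σx - f ⊗ Hx`, so that `δH + Hδ = φ·σ - id` follows by induction on
the length (`allδ_allHomotopy`). The bar complex is obtained by discarding the empty lists, and the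
internal differential anticommutes with `H` (`barHomotopy_d`), so it contributes nothing. -/

noncomputable section

open scoped TensorProduct

namespace DGEnv

/-! ### Functors up to a degree shift, and their action on chains. -/

section SuspendedFunctor
universe u v w o w' o'
variable {k : Type u} [CommRing k] {Γ : Type v} [AddCommGroup Γ] {S : GradingDatum Γ}

/-- A functor between dg categories which shifts degrees by a function `shift` of the objects:
a morphism `X ← Y` of degree `i` is sent to one of degree `i + shift Y - shift X`. -/
structure SuspFunctor (C : DGCategory.{u, v, w, o} k S) (D : DGCategory.{u, v, w', o'} k S) where
  obj : C.Obj → D.Obj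
  shift : C.Obj → Γ
  map : ∀ {X Y}, C.hom X Y →ₗ[k] D.hom (obj X) (obj Y)
  map_mem : ∀ {X Y} {i : Γ} {f : C.hom X Y}, f ∈ (C.hom X Y).deg i →
    map f ∈ (D.hom (obj X) (obj Y)).deg (i + shift Y - shift X)
  d_map : ∀ {X Y} (f : C.hom X Y), (D.hom (obj X) (obj Y)).d (map f) =
    sgn k (S.pair S.ι (shift X)) • map ((C.hom X Y).d f)
  map_comp : ∀ {X Y Z} (f : C.hom X Y) (g : C.hom Y Z), map (C.comp f g) = D.comp (map f) (map g)

namespace DGCategory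
variable {C : DGCategory.{u, v, w, o} k S} {D : DGCategory.{u, v, w', o'} k S}

theorem chain_map_mem {Y X Y' : C.Obj} {L : List C.Obj} {P : Type*} [AddCommGroup P] [Module k P]
    (Q : Submodule k P) (F : C.chain Y (X :: L) Y' →ₗ[k] P) (n : Γ)
    (h : ∀ i j, ∀ f ∈ (C.hom Y X).deg i, ∀ c ∈ (C.chain X L Y').deg j, i + j = n →
      F (chainCons f c) ∈ Q)
    {t : C.chain Y (X :: L) Y'} (ht : t ∈ (C.chain Y (X :: L) Y').deg n) : F t ∈ Q :=
  DGModule.map_mem_of_tmul (M := C.hom Y X) (N := C.chain X L Y') Q F n h ht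

theorem chainCons_mem {Y X Y' : C.Obj} {L : List C.Obj} {i j n : Γ} {f : C.hom Y X}
    {c : C.chain X L Y'} (hf : f ∈ (C.hom Y X).deg i) (hc : c ∈ (C.chain X L Y').deg j)
    (h : i + j = n) : chainCons f c ∈ (C.chain Y (X :: L) Y').deg n :=
  DGModule.tmul_mem (C.hom Y X) (C.chain X L Y') hf hc h

end DGCategory

namespace SuspFunctor
open DGCategory
variable {C : DGCategory.{u, v, w, o} k S} {D : DGCategory.{u, v, w', o'} k S}
  (F : SuspFunctor C D)

/-- The degree of `F f` exceeds that of `f` by the difference of the shifts of source and target,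
and the pairing is additive. -/
theorem signOp_map (a : Γ) {X Y : C.Obj} (f : C.hom X Y) :
    (D.hom (F.obj X) (F.obj Y)).signOp a (F.map f) =
      sgn k (S.pair a (F.shift Y - F.shift X)) • F.map ((C.hom X Y).signOp a f) := by
  refine (C.hom X Y).hom_ext (f := (D.hom (F.obj X) (F.obj Y)).signOp a ∘ₗ F.map)
    (g := sgn k (S.pair a (F.shift Y - F.shift X)) • F.map ∘ₗ (C.hom X Y).signOp a) ?_ f
  intro i x hx
  simp only [LinearMap.comp_apply, LinearMap.smul_apply]
  rw [DGModule.signOp_of_mem _ _ (F.map_mem hx), DGModule.signOp_of_mem _ _ hx, map_smul,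
    smul_smul, add_sub_assoc, map_add, sgn_add, mul_comm]

/-- The map on chains induced by a suspended functor. -/
def chainMap {Z : C.Obj} : (L : List C.Obj) → (Y : C.Obj) →
    (C.chain Y L Z →ₗ[k] D.chain (F.obj Y) (L.map F.obj) (F.obj Z))
  | [], _ => F.map
  | X :: L, _ => chainLift ((chainCons (L := L.map F.obj)).compl₁₂ F.map (chainMap L X))

theorem chainMap_cons {Y X Z : C.Obj} {L : List C.Obj} (f : C.hom Y X) (c : C.chain X L Z) :
    F.chainMap (X :: L) Y (chainCons f c) =
      chainCons (L := L.map F.obj) (F.map f) (F.chainMap L X c) := by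
  rw [chainMap]; exact chainLift_cons _ _ _

theorem chainMap_lmul {W Y Z : C.Obj} (L : List C.Obj) (f : C.hom W Y) (c : C.chain Y L Z) :
    F.chainMap L W (lmul L f c) = lmul (L.map F.obj) (F.map f) (F.chainMap L Y c) := by
  cases L with
  | nil => exact F.map_comp f c
  | cons X L =>
    refine chain_ext (F := F.chainMap (X :: L) W ∘ₗ lmul (X :: L) f)
      (G := lmul ((X :: L).map F.obj) (F.map f) ∘ₗ F.chainMap (X :: L) Y) (fun g c => ?_) c
    simp only [LinearMap.comp_apply]
    rw [lmul_cons, chainMap_cons, chainMap_cons, F.map_comp]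
    exact (lmul_cons (L := L.map F.obj) _ _ _).symm

theorem chainMap_rmul {Z Z' : C.Obj} (L : List C.Obj) {Y : C.Obj} (c : C.chain Y L Z)
    (g : C.hom Z Z') :
    F.chainMap L Y (rmul L Y c g) = rmul (L.map F.obj) (F.obj Y) (F.chainMap L Y c) (F.map g) := by
  induction L generalizing Y with
  | nil => exact F.map_comp c g
  | cons X L ih =>
    refine chain_ext (F := F.chainMap (X :: L) Y ∘ₗ (rmul (X :: L) Y).flip g)
      (G := (rmul ((X :: L).map F.obj) (F.obj Y)).flip (F.map g) ∘ₗ F.chainMap (X :: L) Y)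
      (fun f c => ?_) c
    simp only [LinearMap.comp_apply, LinearMap.flip_apply]
    rw [rmul_cons, chainMap_cons, chainMap_cons, ih]
    exact (rmul_cons (L := L.map F.obj) _ _ _).symm

theorem chainMap_mem {Z : C.Obj} (L : List C.Obj) {Y : C.Obj} {i : Γ} {c : C.chain Y L Z}
    (hc : c ∈ (C.chain Y L Z).deg i) : F.chainMap L Y c ∈
      (D.chain (F.obj Y) (L.map F.obj) (F.obj Z)).deg (i + F.shift Z - F.shift Y) := by
  induction L generalizing Y i with
  | nil => exact F.map_mem hc
  | cons X L ih =>
    refine chain_map_mem _ (F.chainMap (X :: L) Y) i (fun a b f hf c hc hab => ?_) hc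
    rw [chainMap_cons]
    exact chainCons_mem (L := L.map F.obj) (F.map_mem hf) (ih hc) (by rw [← hab]; abel)

/-- The signs telescope. Moving `d` past `F f₀ : F Y ← F X` costs, besides the usual Koszul sign,
the sign of `shift X - shift Y`; the inductive hypothesis contributes the sign of `shift X`, so only
that of `shift Y` is left. -/
theorem d_chainMap {Z : C.Obj} (L : List C.Obj) {Y : C.Obj} (c : C.chain Y L Z) :
    (D.chain (F.obj Y) (L.map F.obj) (F.obj Z)).d (F.chainMap L Y c) =
      sgn k (S.pair S.ι (F.shift Y)) • F.chainMap L Y ((C.chain Y L Z).d c) := by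
  induction L generalizing Y with
  | nil => exact F.d_map c
  | cons X L ih =>
    refine chain_ext
      (F := (D.chain (F.obj Y) ((X :: L).map F.obj) (F.obj Z)).d ∘ₗ F.chainMap (X :: L) Y)
      (G := sgn k (S.pair S.ι (F.shift Y)) • F.chainMap (X :: L) Y ∘ₗ (C.chain Y (X :: L) Z).d)
      (fun f c => ?_) c
    simp only [LinearMap.comp_apply, LinearMap.smul_apply]
    rw [chain_d_cons, map_add (F.chainMap (X :: L) Y), chainMap_cons, chainMap_cons,
      chainMap_cons]
    refine (chain_d_cons (L := L.map F.obj) _ _).trans ?_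
    rw [ih, F.d_map, F.signOp_map, map_smul chainCons, map_smul chainCons, LinearMap.smul_apply,
      LinearMap.smul_apply, map_smul (chainCons _), smul_smul, smul_add, map_sub (S.pair S.ι),
      sgn_sub, mul_right_comm, sgn_mul_self, one_mul]

/-- The map on the sum of all chains induced by a suspended functor. -/
def allMap {Y Z : C.Obj} : C.allChains Y Z →ₗ[k] D.allChains (F.obj Y) (F.obj Z) :=
  C.allDesc fun L => D.allInj (L.map F.obj) ∘ₗ F.chainMap L Y

theorem allMap_inj {Y Z : C.Obj} (L : List C.Obj) (c : C.chain Y L Z) :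
    F.allMap (C.allInj L c) = D.allInj (L.map F.obj) (F.chainMap L Y c) := by
  rw [allMap, allDesc_inj]; rfl

theorem allMap_cons {Y X Z : C.Obj} (f : C.hom Y X) (x : C.allChains X Z) :
    F.allMap (C.allCons f x) = D.allCons (F.map f) (F.allMap x) := by
  refine C.all_ext (f := F.allMap ∘ₗ C.allCons f) (g := D.allCons (F.map f) ∘ₗ F.allMap)
    (fun L c => ?_) x
  simp only [LinearMap.comp_apply]
  rw [allCons_inj, allMap_inj, allMap_inj, allCons_inj, chainMap_cons]
  rfl

theorem allMap_lmul {Y X Z : C.Obj} (f : C.hom Y X) (x : C.allChains X Z) :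
    F.allMap (C.allLmul f x) = D.allLmul (F.map f) (F.allMap x) := by
  refine C.all_ext (f := F.allMap ∘ₗ C.allLmul f) (g := D.allLmul (F.map f) ∘ₗ F.allMap)
    (fun L c => ?_) x
  simp only [LinearMap.comp_apply]
  rw [allLmul_inj, allMap_inj, allMap_inj, allLmul_inj, chainMap_lmul]

/-- Faces only compose neighbours, so functoriality suffices and no sign appears. Working in the sum
over all lists, with the recursion `allδ_cons`, avoids identifying the lists obtained by erasing an
object before and after applying `F`. -/
theorem allδ_allMap {Y Z : C.Obj} (x : C.allChains Y Z) :
    D.allδ _ _ (F.allMap x) = F.allMap (C.allδ Y Z x) := by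
  refine C.all_ext (f := D.allδ _ _ ∘ₗ F.allMap) (g := F.allMap ∘ₗ C.allδ Y Z) (fun L c => ?_) x
  simp only [LinearMap.comp_apply]
  induction L generalizing Y with
  | nil =>
    rw [allMap_inj, allδ_inj, allδ_inj, List.length_nil, Finset.sum_range_zero, map_zero]
    rfl
  | cons X L ih =>
    refine chain_ext (F := D.allδ _ _ ∘ₗ F.allMap ∘ₗ C.allInj (X :: L))
      (G := F.allMap ∘ₗ C.allδ Y Z ∘ₗ C.allInj (X :: L)) (fun f c => ?_) c
    simp only [LinearMap.comp_apply]
    rw [← allCons_inj, allMap_cons, allδ_cons, allδ_cons, map_sub, allMap_cons, allMap_lmul,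
      ih (C.allInj L c)]

end SuspFunctor
end SuspendedFunctor

/-! ### The induced maps of bar complexes. -/

section SuspendedFunctorBar
universe u v w o w' o'
variable {k : Type u} [CommRing k] {Γ : Type v} [AddCommGroup Γ] {S : GradingDatum Γ}

namespace DGCategory
variable (C : DGCategory.{u, v, w, o} k S)

theorem allDesc_ofChain_inj {Y Y' : C.Obj} (L : List C.Obj) (c : C.chain Y L Y') :
    C.allDesc C.ofChain (C.allInj L c) = C.ofChain L c :=
  C.allDesc_inj C.ofChain L c

end DGCategory

namespace SuspFunctor
open DGCategory
variable {C : DGCategory.{u, v, w, o} k S} {D : DGCategory.{u, v, w', o'} k S}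
  (F : SuspFunctor C D)

/-- The map on bar complexes induced by a suspended functor:
`[f₀, …, f_{r+1}] ↦ (-1)^(r ⟨ι, shift Y⟩) [F f₀, …, F f_{r+1}]`. -/
def barMap (Y Y' : C.Obj) : C.barSum Y Y' →ₗ[k] D.barSum (F.obj Y) (F.obj Y') :=
  C.barDesc fun X L =>
    sgn k (S.pair (barShift S L.length) (F.shift Y)) •
      (D.barInj (F.obj X) (L.map F.obj) ∘ₗ F.chainMap (X :: L) Y)

theorem barMap_inj {Y Y' : C.Obj} (X : C.Obj) (L : List C.Obj) (c : C.chain Y (X :: L) Y') :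
    F.barMap Y Y' (C.barInj X L c) = sgn k (S.pair (barShift S L.length) (F.shift Y)) •
      D.barInj (F.obj X) (L.map F.obj) (F.chainMap (X :: L) Y c) :=
  C.barDesc_inj _ X L c

/-- A list of `r` intermediate objects lies in the summand shifted by `-(r-1)ι`, so its sign is that
of `barShift S r + ι`. This is written as a product of two signs in order to cover `r = 0` as well,
where both sides vanish. -/
theorem barMap_ofChain {Y Y' : C.Obj} (L : List C.Obj) {r : ℕ} (hL : L.length = r)
    (c : C.chain Y L Y') : F.barMap Y Y' (C.ofChain L c) =
      sgn k (S.pair (barShift S r) (F.shift Y)) • sgn k (S.pair S.ι (F.shift Y)) •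
        D.allDesc D.ofChain (F.allMap (C.allInj L c)) := by
  rw [allMap_inj, allDesc_ofChain_inj]
  cases L with
  | nil =>
    refine (map_zero (F.barMap Y Y')).trans ?_
    refine Eq.trans ?_ (congrArg _ (smul_zero _).symm)
    exact (smul_zero _).symm
  | cons X L =>
    rw [List.length_cons] at hL
    refine (F.barMap_inj X L c).trans ?_
    rw [smul_smul, ← sgn_add, ← AddMonoidHom.add_apply, ← map_add, ← hL, barShift_succ]
    rfl

/-- The bar differential lowers `r` by one, and the prefactor of `barMap` then changes by exactly
`(-1)^⟨ι, shift Y⟩`. -/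
theorem barδ_barMap {Y Y' : C.Obj} (x : C.barSum Y Y') :
    D.barδ _ _ (F.barMap Y Y' x) =
      sgn k (S.pair S.ι (F.shift Y)) • F.barMap Y Y' (C.barδ Y Y' x) := by
  refine C.bar_ext (f := D.barδ _ _ ∘ₗ F.barMap Y Y')
    (g := sgn k (S.pair S.ι (F.shift Y)) • F.barMap Y Y' ∘ₗ C.barδ Y Y') (fun X L c => ?_) x
  simp only [LinearMap.comp_apply, LinearMap.smul_apply]
  -- Lifting to the sum of all chains reduces the unsigned part of the claim to `allδ_allMap`.
  have h : D.barInj (F.obj X) (L.map F.obj) (F.chainMap (X :: L) Y c) =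
      D.allDesc D.ofChain (F.allMap (C.allInj (X :: L) c)) := by
    rw [allMap_inj, allDesc_ofChain_inj]; rfl
  rw [barMap_inj, h, barδ_inj, map_sum]
  rw [map_smul, barδ_allDesc, allδ_allMap, allδ_inj, map_sum, map_sum, Finset.smul_sum,
    Finset.smul_sum]
  refine Finset.sum_congr rfl fun i hi => ?_
  rw [map_smul, map_smul, map_smul, F.barMap_ofChain _ (C.length_eraseIdx_cons X L hi)]
  simp only [smul_smul]
  congr 1
  linear_combination (-(-1) ^ i * sgn k (S.pair (barShift S L.length) (F.shift Y))) *
    sgn_mul_self (k := k) (S.pair S.ι (F.shift Y))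

theorem barSum_d_barMap {Y Y' : C.Obj} (x : C.barSum Y Y') :
    (D.barSum _ _).d (F.barMap Y Y' x) =
      sgn k (S.pair S.ι (F.shift Y)) • F.barMap Y Y' ((C.barSum Y Y').d x) := by
  refine C.bar_ext (f := (D.barSum _ _).d ∘ₗ F.barMap Y Y')
    (g := sgn k (S.pair S.ι (F.shift Y)) • F.barMap Y Y' ∘ₗ (C.barSum Y Y').d)
    (fun X L c => ?_) x
  simp only [LinearMap.comp_apply, LinearMap.smul_apply]
  have hd : (D.chain (F.obj Y) (F.obj X :: L.map F.obj) (F.obj Y')).d (F.chainMap (X :: L) Y c) =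
      sgn k (S.pair S.ι (F.shift Y)) •
        (show D.chain (F.obj Y) (F.obj X :: L.map F.obj) (F.obj Y') from
          F.chainMap (X :: L) Y ((C.chain Y (X :: L) Y').d c)) := F.d_chainMap (X :: L) c
  rw [barMap_inj, barSum_d_inj, map_smul, map_smul, barMap_inj, barSum_d_inj, hd,
    map_smul (D.barInj _ _), List.length_map]
  simp only [smul_smul]
  congr 1
  ring

/-- The two parts of the differential acquire the same sign for different reasons: the internal part
from the degree shift of `F`, the bar part from the `r`-dependent prefactor of `barMap`. This
agreement is what the prefactor is chosen for. -/
theorem d_barMap {Y Y' : C.Obj} (x : C.barSum Y Y') :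
    ((D.barSum (F.obj Y) (F.obj Y')).d + D.barδ (F.obj Y) (F.obj Y')) (F.barMap Y Y' x) =
      sgn k (S.pair S.ι (F.shift Y)) • F.barMap Y Y' (((C.barSum Y Y').d + C.barδ Y Y') x) := by
  rw [LinearMap.add_apply, LinearMap.add_apply, barSum_d_barMap, barδ_barMap, map_add, smul_add]

theorem barMap_mem {Y Y' : C.Obj} {i : Γ} {x : C.barSum Y Y'} (hx : x ∈ (C.barSum Y Y').deg i) :
    F.barMap Y Y' x ∈ (D.barSum _ _).deg (i + F.shift Y' - F.shift Y) := by
  refine C.bar_mem _ (F.barMap Y Y') i (fun X L c hc => ?_) hx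
  rw [barMap_inj]
  refine Submodule.smul_mem _ _ (D.barInj_mem ?_)
  have := F.chainMap_mem (X :: L) hc
  rwa [show i - barShift S L.length + F.shift Y' - F.shift Y =
    i + F.shift Y' - F.shift Y - barShift S (L.map F.obj).length by rw [List.length_map]; abel]
    at this

/-- The left action carries the sign `(-1)^(r⟨ι,|f|⟩)`, and `|F f|` differs from `|f|` by `shift Y -
shift W`. The discrepancy is the quotient of the prefactors of `barMap` at `W` and at `Y`. -/
theorem barMap_lact {W Y Y' : C.Obj} (f : C.hom W Y) (x : C.barSum Y Y') :
    F.barMap W Y' (C.barLact f x) = D.barLact (F.map f) (F.barMap Y Y' x) := by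
  refine C.bar_ext (f := F.barMap W Y' ∘ₗ C.barLact f)
    (g := D.barLact (F.map f) ∘ₗ F.barMap Y Y') (fun X L c => ?_) x
  simp only [LinearMap.comp_apply]
  rw [barLact_inj, barMap_inj, barMap_inj, map_smul (D.barLact (F.map f)), barLact_inj,
    List.length_map, F.signOp_map, map_smul (lmul (F.obj X :: L.map F.obj)),
    LinearMap.smul_apply, map_smul (D.barInj _ _), chainMap_lmul, smul_smul, map_sub, sgn_sub,
    ← mul_assoc, sgn_mul_self, one_mul]
  rfl

theorem barMap_ract {Y Y' Z : C.Obj} (x : C.barSum Y Y') (g : C.hom Y' Z) :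
    F.barMap Y Z (C.barRact x g) = D.barRact (F.barMap Y Y' x) (F.map g) := by
  refine C.bar_ext (f := F.barMap Y Z ∘ₗ C.barRact.flip g)
    (g := D.barRact.flip (F.map g) ∘ₗ F.barMap Y Y') (fun X L c => ?_) x
  simp only [LinearMap.comp_apply, LinearMap.flip_apply]
  rw [barRact_inj, barMap_inj, barMap_inj, map_smul D.barRact, LinearMap.smul_apply, barRact_inj,
    chainMap_rmul]
  rfl

theorem barMap_ofChain_of_shift_eq_zero {Y Y' : C.Obj} (L : List C.Obj) (c : C.chain Y L Y')
    (h : F.shift Y = 0) :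
    F.barMap Y Y' (C.ofChain L c) = D.allDesc D.ofChain (F.allMap (C.allInj L c)) := by
  rw [F.barMap_ofChain L rfl, h, map_zero, map_zero, sgn_zero, one_smul, one_smul]

end SuspFunctor

/-! ### The embedding `η` and the forgetful suspended functor. -/

namespace DGCategory
variable (C : DGCategory.{u, v, w, o} k S)

/-- The embedding `η : C → SB(C)` as a suspended functor (with zero shifts). -/
def ηSusp : SuspFunctor C C.SB where
  obj := C.η.obj
  shift _ := 0
  map := C.η.map
  map_mem hf := by rw [add_zero, sub_zero]; exact C.η.map_mem hf
  d_map f := by rw [map_zero, sgn_zero, one_smul, C.η.map_d]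
  map_comp := C.η.map_comp

/-- Forgetting the shifts, `f^j_i ↦ f`, as a suspended functor `SB(C) → C`. -/
def bareSusp : SuspFunctor C.SB C where
  obj := SBObj.obj
  shift := SBObj.shift
  map := bare
  map_mem hf := hf
  d_map {A B} f := by
    -- The differential of `SB(C)` already contains the sign of the shift of `A`, so that sign
    -- occurs twice and cancels.
    change (C.hom A.obj B.obj).d f = sgn k (S.pair S.ι A.shift) •
      (sgn k (S.pair S.ι A.shift) • (C.hom A.obj B.obj).d f)
    rw [smul_smul, sgn_mul_self, one_smul]
  map_comp _ _ := rfl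

theorem bareSusp_chainMap_pure {A B : C.SB.Obj} {L : List C.SB.Obj} (s : C.SB.Seq A L B) :
    C.bareSusp.chainMap L A s.pure = s.bare.pure := by
  induction s with
  | last f => rfl
  | cons f s ih => exact (C.bareSusp.chainMap_cons f s.pure).trans (congrArg _ ih)

/-- Simple tensors span an iterated tensor product; this is the source of the uniqueness of `Ξ_SB`.
-/
theorem seq_pure_ext {Y Y' : C.Obj} {L : List C.Obj} {P : Type*} [AddCommGroup P] [Module k P]
    {F G : C.chain Y L Y' →ₗ[k] P} (h : ∀ s : C.Seq Y L Y', F s.pure = G s.pure)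
    (c : C.chain Y L Y') : F c = G c := by
  induction L generalizing Y with
  | nil => exact h (.last c)
  | cons X L ih =>
    refine chain_ext (fun f c => ?_) c
    exact ih (F := F ∘ₗ chainCons f) (G := G ∘ₗ chainCons f) (fun s => h (.cons f s)) c

/-- The two list maps compose to the identity only propositionally, so the comparison is made in the
sum over all lists, by recursion on the first factor. -/
theorem bareSusp_allMap_ηSusp {Y Y' : C.Obj} (x : C.allChains Y Y') :
    C.bareSusp.allMap (C.ηSusp.allMap x) = x := by
  refine C.all_ext (f := C.bareSusp.allMap ∘ₗ C.ηSusp.allMap) (g := LinearMap.id)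
    (fun L c => ?_) x
  induction L generalizing Y with
  | nil =>
    rw [LinearMap.comp_apply, SuspFunctor.allMap_inj, SuspFunctor.allMap_inj]
    rfl
  | cons X L ih =>
    refine chain_ext (F := (C.bareSusp.allMap ∘ₗ C.ηSusp.allMap) ∘ₗ C.allInj (X :: L))
      (G := LinearMap.id ∘ₗ C.allInj (X :: L)) (fun f c => ?_) c
    simp only [LinearMap.comp_apply]
    rw [← allCons_inj, SuspFunctor.allMap_cons, SuspFunctor.allMap_cons]
    exact (congrArg (C.allCons f) (ih (C.allInj L c) c)).trans (C.allCons_inj f L c)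

theorem bareSusp_barMap_ηSusp {Y Y' : C.Obj} (x : C.barSum Y Y') :
    C.bareSusp.barMap _ _ (C.ηSusp.barMap Y Y' x) = x := by
  refine C.bar_ext (f := C.bareSusp.barMap _ _ ∘ₗ C.ηSusp.barMap Y Y') (g := LinearMap.id)
    (fun X L c => ?_) x
  -- The identity on all chains is pushed forward to the bar complex along `ofChain`; the signs are
  -- trivial because the shifts of `ηSusp` are zero.
  have h := C.bareSusp_allMap_ηSusp (C.allInj (X :: L) c)
  rw [SuspFunctor.allMap_inj] at h
  have h' := congrArg (C.allDesc C.ofChain) h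
  rw [LinearMap.comp_apply, C.ηSusp.barMap_inj]
  refine Eq.trans ?_ ((C.bareSusp.barMap_ofChain_of_shift_eq_zero _ _ rfl).trans
    (h'.trans (C.allDesc_ofChain_inj _ _)))
  congr 1
  change sgn k (S.pair _ 0) • _ = _
  rw [map_zero, sgn_zero, one_smul]
  rfl

end DGCategory
end SuspendedFunctorBar

/-! ### Naturality of `φ`, unshifting of chains and insertion of `φ`. -/

section SuspendedEnvelope
universe u v w o
variable {k : Type u} [CommRing k] {Γ : Type v} [AddCommGroup Γ] {S : GradingDatum Γ}

namespace DGCategory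
variable (C : DGCategory.{u, v, w, o} k S)

theorem φ_mem (X : C.Obj) (i : Γ) : C.φ X i ∈ (C.SB.hom ⟨i, X⟩ ⟨0, X⟩).deg i := by
  change C.one X ∈ (C.hom X X).deg (i + 0 - i)
  rw [add_zero, sub_self]
  exact C.one_mem X

theorem φinv_mem (X : C.Obj) (i : Γ) : C.φinv X i ∈ (C.SB.hom ⟨0, X⟩ ⟨i, X⟩).deg (-i) := by
  change C.one X ∈ (C.hom X X).deg (-i + i - 0)
  rw [neg_add_cancel, sub_self]
  exact C.one_mem X

theorem d_φ (X : C.Obj) (i : Γ) : (C.SB.hom ⟨i, X⟩ ⟨0, X⟩).d (C.φ X i) = 0 := by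
  change sgn k _ • (C.hom X X).d (C.one X) = 0
  rw [C.d_one, smul_zero]

theorem d_φinv (X : C.Obj) (i : Γ) : (C.SB.hom ⟨0, X⟩ ⟨i, X⟩).d (C.φinv X i) = 0 := by
  change sgn k _ • (C.hom X X).d (C.one X) = 0
  rw [C.d_one, smul_zero]

/-- The object `q^0 X` underlying an object `q^i X` of the suspended envelope. -/
abbrev unshift (A : C.SB.Obj) : C.SB.Obj := C.ηSusp.obj (C.bareSusp.obj A)

/-- The objects `q^0 X` underlying a list of objects `q^i X` of the suspended envelope. -/
abbrev unshiftList (L : List C.SB.Obj) : List C.SB.Obj :=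
  (L.map C.bareSusp.obj).map C.ηSusp.obj

/-- The morphism `f^0_0` underlying `f^j_i`. -/
abbrev unshiftHom {A B : C.SB.Obj} (f : C.SB.hom A B) : C.SB.hom (C.unshift A) (C.unshift B) :=
  C.ηSusp.map (C.bareSusp.map f)

/-- The isomorphism `q^0 X → q^i X`. -/
def toShift (A : C.SB.Obj) : C.SB.hom A (C.unshift A) := C.φ A.obj A.shift

/-- The isomorphism `q^i X → q^0 X`. -/
def ofShift (A : C.SB.Obj) : C.SB.hom (C.unshift A) A := C.φinv A.obj A.shift

/-- Naturality of `φ`: both composites are the morphism of `C` underlying `f`, composed with an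
identity. -/
theorem toShift_comp {A B : C.SB.Obj} (f : C.SB.hom A B) :
    C.SB.comp (C.toShift A) (C.unshiftHom f) = C.SB.comp f (C.toShift B) :=
  (C.one_comp (X := A.obj) (Y := B.obj) f).trans (C.comp_one (X := A.obj) (Y := B.obj) f).symm

theorem comp_ofShift {A B : C.SB.Obj} (f : C.SB.hom A B) :
    C.SB.comp (C.unshiftHom f) (C.ofShift B) = C.SB.comp (C.ofShift A) f :=
  (C.comp_one (X := A.obj) (Y := B.obj) f).trans (C.one_comp (X := A.obj) (Y := B.obj) f).symm

theorem toShift_ofShift (A : C.SB.Obj) :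
    C.SB.comp (C.toShift A) (C.ofShift A) = C.SB.one A :=
  C.one_comp (C.one A.obj)

/-- The map `f₀ ⊗ ⋯ ⊗ f_{r+1} ↦ (f₀)^0_0 ⊗ ⋯ ⊗ (f_r)^0_0 ⊗ (f_{r+1})^0_i` which replaces all
objects but the last one by their unshifted versions. -/
def strip {B : C.SB.Obj} (L : List C.SB.Obj) (A : C.SB.Obj) :
    C.SB.chain A L B →ₗ[k] C.SB.chain (C.unshift A) (C.unshiftList L) B :=
  (rmul (C.unshiftList L) (C.unshift A)).flip (C.ofShift B) ∘ₗ
    C.ηSusp.chainMap (L.map C.bareSusp.obj) (C.bareSusp.obj A) ∘ₗ C.bareSusp.chainMap L A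

theorem strip_cons {A X B : C.SB.Obj} {L : List C.SB.Obj} (f : C.SB.hom A X)
    (c : C.SB.chain X L B) : C.strip (X :: L) A (chainCons f c) =
      chainCons (L := C.unshiftList L) (C.unshiftHom f) (C.strip L X c) := by
  rw [strip, LinearMap.comp_apply, LinearMap.comp_apply, SuspFunctor.chainMap_cons]
  refine (congrArg _ (C.ηSusp.chainMap_cons (L := L.map C.bareSusp.obj) _ _)).trans ?_
  exact rmul_cons (L := C.unshiftList L) _ _ _

theorem strip_lmul {A' A B : C.SB.Obj} (L : List C.SB.Obj) (f : C.SB.hom A' A)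
    (c : C.SB.chain A L B) : C.strip L A' (lmul L f c) =
      lmul (C.unshiftList L) (C.unshiftHom f) (C.strip L A c) := by
  simp only [strip, LinearMap.comp_apply, LinearMap.flip_apply]
  rw [SuspFunctor.chainMap_lmul, SuspFunctor.chainMap_lmul, lmul_rmul]

/-- At the right end the factor `φ⁻¹` has to pass through `g`, which is its naturality
`comp_ofShift`. Keeping the last object shifted is what makes `strip` right linear. -/
theorem strip_rmul {A B B' : C.SB.Obj} (L : List C.SB.Obj) (c : C.SB.chain A L B)
    (g : C.SB.hom B B') : C.strip L A (rmul L A c g) =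
      rmul (C.unshiftList L) (C.unshift A) (C.strip L A c) g := by
  simp only [strip, LinearMap.comp_apply, LinearMap.flip_apply]
  rw [SuspFunctor.chainMap_rmul, SuspFunctor.chainMap_rmul, ← rmul_comp, ← rmul_comp,
    comp_ofShift]

/-- Unshifting changes the degree by `B.shift - A.shift`, and the final `φ⁻¹` has degree `-B.shift`,
so only the shift of the left end remains. -/
theorem strip_mem {A B : C.SB.Obj} (L : List C.SB.Obj) {i : Γ} {c : C.SB.chain A L B}
    (hc : c ∈ (C.SB.chain A L B).deg i) :
    C.strip L A c ∈ (C.SB.chain (C.unshift A) (C.unshiftList L) B).deg (i - A.shift) := by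
  have := rmul_mem (C.unshiftList L) (C.ηSusp.chainMap_mem _ (C.bareSusp.chainMap_mem L hc))
    (C.φinv_mem B.obj B.shift)
  rwa [show i + C.bareSusp.shift B - C.bareSusp.shift A + C.ηSusp.shift (C.bareSusp.obj B) -
    C.ηSusp.shift (C.bareSusp.obj A) + -B.shift = i - A.shift by
      change i + B.shift - A.shift + 0 - 0 + -B.shift = i - A.shift; abel] at this

theorem d_strip {A B : C.SB.Obj} (L : List C.SB.Obj) (c : C.SB.chain A L B) :
    (C.SB.chain (C.unshift A) (C.unshiftList L) B).d (C.strip L A c) =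
      sgn k (S.pair S.ι A.shift) • C.strip L A ((C.SB.chain A L B).d c) := by
  simp only [strip, LinearMap.comp_apply, LinearMap.flip_apply]
  have h : (C.SB.hom (C.unshift B) B).d (C.ofShift B) = 0 := C.d_φinv B.obj B.shift
  have h0 : C.ηSusp.shift (C.bareSusp.obj A) = 0 := rfl
  rw [d_rmul, h, map_zero, add_zero, SuspFunctor.d_chainMap, SuspFunctor.d_chainMap, h0, map_zero,
    sgn_zero, one_smul, map_smul, map_smul, LinearMap.smul_apply]
  rfl

/-- The list of objects obtained by inserting an unshifted copy after the `u`-th object and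
unshifting everything after it. -/
def insertList : ℕ → List C.SB.Obj → List C.SB.Obj
  | _, [] => []
  | 0, X :: L => X :: C.unshift X :: C.unshiftList L
  | u + 1, X :: L => X :: insertList u L

theorem length_insertList {u : ℕ} {L : List C.SB.Obj} (h : u < L.length) :
    (C.insertList u L).length = L.length + 1 := by
  induction L generalizing u with
  | nil => simp at h
  | cons X L ih =>
    cases u with
    | zero => simp [insertList]
    | succ u => simp [insertList, ih (Nat.lt_of_succ_lt_succ h)]

/-- The map `f₀ ⊗ ⋯ ⊗ f_{r+1} ↦ f₀ ⊗ ⋯ ⊗ f_u ⊗ φ ⊗ (f_{u+1})^0_0 ⊗ ⋯ ⊗ (f_{r+1})^0_i`. -/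
def insertion {B : C.SB.Obj} : (u : ℕ) → (L : List C.SB.Obj) → (A : C.SB.Obj) →
    (C.SB.chain A L B →ₗ[k] C.SB.chain A (C.insertList u L) B)
  | _, [], _ => 0
  | 0, X :: L, _ => chainLift ((chainCons (L := C.unshift X :: C.unshiftList L)).compl₂
      (chainCons (L := C.unshiftList L) (C.toShift X) ∘ₗ C.strip L X))
  | u + 1, X :: L, _ => chainLift ((chainCons (L := C.insertList u L)).compl₂ (insertion u L X))

theorem insertion_zero {A X B : C.SB.Obj} {L : List C.SB.Obj} (f : C.SB.hom A X)
    (c : C.SB.chain X L B) : C.insertion 0 (X :: L) A (chainCons f c) =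
      chainCons (L := C.unshift X :: C.unshiftList L) f
        (chainCons (L := C.unshiftList L) (C.toShift X) (C.strip L X c)) := by
  rw [insertion]; exact chainLift_cons _ _ _

theorem insertion_succ {A X B : C.SB.Obj} {L : List C.SB.Obj} (u : ℕ) (f : C.SB.hom A X)
    (c : C.SB.chain X L B) : C.insertion (u + 1) (X :: L) A (chainCons f c) =
      chainCons (L := C.insertList u L) f (C.insertion u L X c) := by
  rw [insertion]; exact chainLift_cons _ _ _

/-- The inserted `φ` has degree `X.shift`, exactly what `strip` removes from the tail. -/
theorem insertion_mem {A B : C.SB.Obj} (u : ℕ) (L : List C.SB.Obj) {i : Γ}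
    {c : C.SB.chain A L B} (hc : c ∈ (C.SB.chain A L B).deg i) :
    C.insertion u L A c ∈ (C.SB.chain A (C.insertList u L) B).deg i := by
  induction L generalizing u A i with
  | nil => cases u <;> exact Submodule.zero_mem _
  | cons X L ih =>
    refine chain_map_mem _ (C.insertion u (X :: L) A) i (fun a b f hf c hc hab => ?_) hc
    cases u with
    | zero =>
      rw [insertion_zero]
      exact chainCons_mem (L := C.unshift X :: C.unshiftList L) hf
        (chainCons_mem (L := C.unshiftList L) (C.φ_mem X.obj X.shift) (C.strip_mem L hc)
          (add_sub_cancel _ _)) hab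
    | succ u =>
      rw [insertion_succ]
      exact chainCons_mem (L := C.insertList u L) hf (ih u hc) hab

/-- Since `φ` is closed, `d` only moves past it, at the cost of `(-1)^⟨ι, X.shift⟩`; the same sign
occurs in `d_strip` for the tail, and the two cancel. -/
theorem d_insertion {A B : C.SB.Obj} (u : ℕ) (L : List C.SB.Obj) (c : C.SB.chain A L B) :
    (C.SB.chain A (C.insertList u L) B).d (C.insertion u L A c) =
      C.insertion u L A ((C.SB.chain A L B).d c) := by
  induction L generalizing u A with
  | nil => cases u <;> exact map_zero (C.SB.chain A [] B).d
  | cons X L ih =>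
    refine chain_ext (F := (C.SB.chain A (C.insertList u (X :: L)) B).d ∘ₗ C.insertion u (X :: L) A)
      (G := C.insertion u (X :: L) A ∘ₗ (C.SB.chain A (X :: L) B).d) (fun f c => ?_) c
    simp only [LinearMap.comp_apply]
    rw [chain_d_cons, map_add (C.insertion u (X :: L) A)]
    cases u with
    | zero =>
      rw [insertion_zero, insertion_zero, insertion_zero]
      refine (chain_d_cons (L := C.unshift X :: C.unshiftList L) _ _).trans ?_
      have h : (C.SB.hom X (C.unshift X)).d (C.toShift X) = 0 := C.d_φ X.obj X.shift
      have h' : (C.SB.hom X (C.unshift X)).signOp S.ι (C.toShift X) =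
          sgn k (S.pair S.ι X.shift) • C.toShift X :=
        DGModule.signOp_of_mem _ _ (C.φ_mem X.obj X.shift)
      rw [chain_d_cons (L := C.unshiftList L), h, map_zero, LinearMap.zero_apply, zero_add, h',
        d_strip, map_smul chainCons, LinearMap.smul_apply, map_smul (chainCons (C.toShift X)),
        smul_smul, sgn_mul_self, one_smul]
      rfl
    | succ u =>
      rw [insertion_succ, insertion_succ, insertion_succ, ← ih]
      exact chain_d_cons (L := C.insertList u L) _ _

theorem insertion_lmul {A' A B : C.SB.Obj} (u : ℕ) (L : List C.SB.Obj) (f : C.SB.hom A' A)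
    (c : C.SB.chain A L B) : C.insertion u L A' (lmul L f c) =
      lmul (C.insertList u L) f (C.insertion u L A c) := by
  cases L with
  | nil => cases u <;> exact (map_zero (lmul [] f)).symm
  | cons X L =>
    refine chain_ext (F := C.insertion u (X :: L) A' ∘ₗ lmul (X :: L) f)
      (G := lmul (C.insertList u (X :: L)) f ∘ₗ C.insertion u (X :: L) A) (fun g c => ?_) c
    simp only [LinearMap.comp_apply]
    cases u with
    | zero =>
      rw [lmul_cons, insertion_zero, insertion_zero]
      exact (lmul_cons (L := C.unshift X :: C.unshiftList L) f g _).symm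
    | succ u =>
      rw [lmul_cons, insertion_succ, insertion_succ]
      exact (lmul_cons (L := C.insertList u L) f g _).symm

theorem insertion_rmul {A B B' : C.SB.Obj} (u : ℕ) (L : List C.SB.Obj) (c : C.SB.chain A L B)
    (g : C.SB.hom B B') : C.insertion u L A (rmul L A c g) =
      rmul (C.insertList u L) A (C.insertion u L A c) g := by
  induction L generalizing u A with
  | nil => cases u <;> exact (LinearMap.congr_fun (map_zero (rmul [] A)) g).symm
  | cons X L ih =>
    refine chain_ext (F := C.insertion u (X :: L) A ∘ₗ (rmul (X :: L) A).flip g)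
      (G := (rmul (C.insertList u (X :: L)) A).flip g ∘ₗ C.insertion u (X :: L) A)
      (fun f c => ?_) c
    simp only [LinearMap.comp_apply, LinearMap.flip_apply]
    cases u with
    | zero =>
      rw [rmul_cons, insertion_zero, insertion_zero, strip_rmul]
      refine Eq.trans ?_ (rmul_cons (L := C.unshift X :: C.unshiftList L) f _ g).symm
      rw [rmul_cons (L := C.unshiftList L)]
    | succ u =>
      rw [rmul_cons, insertion_succ, insertion_succ, ih]
      exact (rmul_cons (L := C.insertList u L) f _ g).symm

/-! ### The prism operator on the augmented complex. -/

/-- The map induced by `strip` on the sum of all chains. -/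
def allStrip {A B : C.SB.Obj} : C.SB.allChains A B →ₗ[k] C.SB.allChains (C.unshift A) B :=
  C.SB.allDesc fun L => C.SB.allInj (C.unshiftList L) ∘ₗ C.strip L A

theorem allStrip_inj {A B : C.SB.Obj} (L : List C.SB.Obj) (c : C.SB.chain A L B) :
    C.allStrip (C.SB.allInj L c) = C.SB.allInj (C.unshiftList L) (C.strip L A c) := by
  rw [allStrip, allDesc_inj]; rfl

theorem allStrip_cons {A X B : C.SB.Obj} (f : C.SB.hom A X) (x : C.SB.allChains X B) :
    C.allStrip (C.SB.allCons f x) = C.SB.allCons (C.unshiftHom f) (C.allStrip x) := by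
  refine C.SB.all_ext (f := C.allStrip ∘ₗ C.SB.allCons f)
    (g := C.SB.allCons (C.unshiftHom f) ∘ₗ C.allStrip) (fun L c => ?_) x
  simp only [LinearMap.comp_apply]
  rw [allCons_inj, allStrip_inj, allStrip_inj, allCons_inj, strip_cons]
  rfl

theorem allStrip_lmul {A X B : C.SB.Obj} (f : C.SB.hom A X) (x : C.SB.allChains X B) :
    C.allStrip (C.SB.allLmul f x) = C.SB.allLmul (C.unshiftHom f) (C.allStrip x) := by
  refine C.SB.all_ext (f := C.allStrip ∘ₗ C.SB.allLmul f)
    (g := C.SB.allLmul (C.unshiftHom f) ∘ₗ C.allStrip) (fun L c => ?_) x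
  simp only [LinearMap.comp_apply]
  rw [allLmul_inj, allStrip_inj, allStrip_inj, allLmul_inj, strip_lmul]

theorem allδ_allStrip {A B : C.SB.Obj} (x : C.SB.allChains A B) :
    C.SB.allδ _ _ (C.allStrip x) = C.allStrip (C.SB.allδ A B x) := by
  refine C.SB.all_ext (f := C.SB.allδ _ _ ∘ₗ C.allStrip) (g := C.allStrip ∘ₗ C.SB.allδ A B)
    (fun L c => ?_) x
  simp only [LinearMap.comp_apply]
  induction L generalizing A with
  | nil =>
    rw [allStrip_inj, allδ_inj, allδ_inj, List.length_nil, Finset.sum_range_zero, map_zero]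
    rfl
  | cons X L ih =>
    refine chain_ext (F := C.SB.allδ _ _ ∘ₗ C.allStrip ∘ₗ C.SB.allInj (X :: L))
      (G := C.allStrip ∘ₗ C.SB.allδ A B ∘ₗ C.SB.allInj (X :: L)) (fun f c => ?_) c
    simp only [LinearMap.comp_apply]
    rw [← allCons_inj, allStrip_cons, allδ_cons, allδ_cons, map_sub, allStrip_cons,
      allStrip_lmul, ih (C.SB.allInj L c)]

/-- The alternating sum of the insertions. -/
def allHomotopy (A B : C.SB.Obj) : C.SB.allChains A B →ₗ[k] C.SB.allChains A B :=
  C.SB.allDesc fun L => ∑ u ∈ Finset.range L.length,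
    (-1 : k) ^ u • (C.SB.allInj (C.insertList u L) ∘ₗ C.insertion u L A)

theorem allHomotopy_inj {A B : C.SB.Obj} (L : List C.SB.Obj) (c : C.SB.chain A L B) :
    C.allHomotopy A B (C.SB.allInj L c) = ∑ u ∈ Finset.range L.length,
      (-1 : k) ^ u • C.SB.allInj (C.insertList u L) (C.insertion u L A c) := by
  rw [allHomotopy, allDesc_inj]
  simp only [LinearMap.sum_apply, LinearMap.smul_apply, LinearMap.comp_apply]

/-- The term `u = 0` inserts `φ` directly after `f`. The other terms are insertions into the tail
`x` with the index lowered by one, whence the minus sign. -/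
theorem allHomotopy_cons {A X B : C.SB.Obj} (f : C.SB.hom A X) (x : C.SB.allChains X B) :
    C.allHomotopy A B (C.SB.allCons f x) =
      C.SB.allCons f (C.SB.allCons (C.toShift X) (C.allStrip x)) -
        C.SB.allCons f (C.allHomotopy X B x) := by
  refine C.SB.all_ext (f := C.allHomotopy A B ∘ₗ C.SB.allCons f)
    (g := C.SB.allCons f ∘ₗ C.SB.allCons (C.toShift X) ∘ₗ C.allStrip -
      C.SB.allCons f ∘ₗ C.allHomotopy X B) (fun L c => ?_) x
  simp only [LinearMap.comp_apply, LinearMap.sub_apply]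
  rw [allCons_inj, allHomotopy_inj, allHomotopy_inj, allStrip_inj, allCons_inj, allCons_inj,
    List.length_cons, Finset.sum_range_succ', map_sum, pow_zero, one_smul, insertion_zero,
    add_comm, sub_eq_add_neg, ← Finset.sum_neg_distrib]
  refine congrArg₂ _ rfl (Finset.sum_congr rfl fun i _ => ?_)
  rw [insertion_succ, map_smul, allCons_inj, pow_succ, mul_neg_one, neg_smul]
  rfl

theorem allHomotopy_lmul {A' A B : C.SB.Obj} (f : C.SB.hom A' A) (x : C.SB.allChains A B) :
    C.allHomotopy A' B (C.SB.allLmul f x) = C.SB.allLmul f (C.allHomotopy A B x) := by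
  refine C.SB.all_ext (f := C.allHomotopy A' B ∘ₗ C.SB.allLmul f)
    (g := C.SB.allLmul f ∘ₗ C.allHomotopy A B) (fun L c => ?_) x
  simp only [LinearMap.comp_apply]
  rw [allLmul_inj, allHomotopy_inj, allHomotopy_inj, map_sum]
  refine Finset.sum_congr rfl fun u _ => ?_
  rw [map_smul, allLmul_inj, insertion_lmul]

theorem toShift_comp_unshiftHom_ofShift {A B : C.SB.Obj} (f : C.SB.hom A B) :
    C.SB.comp (C.toShift A) (C.SB.comp (C.unshiftHom f) (C.ofShift B)) = f := by
  rw [← C.SB.assoc, toShift_comp, C.SB.assoc, toShift_ofShift, C.SB.comp_one]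

theorem allLmul_allCons {D : DGCategory.{u, v, w, o} k S} {W Y X Z : D.Obj} (f : D.hom W Y)
    (g : D.hom Y X) (x : D.allChains X Z) :
    D.allLmul f (D.allCons g x) = D.allCons (D.comp f g) x := by
  refine D.all_ext (f := D.allLmul f ∘ₗ D.allCons g) (g := D.allCons (D.comp f g))
    (fun L c => ?_) x
  rw [LinearMap.comp_apply, allCons_inj, allCons_inj, allLmul_inj, lmul_cons]

/-- The heart of the argument, by induction on the length. Expanding both composites on `f ⊗ x`, the
terms `f·Hx` cancel, as do those with `φ ⊗ σ(δx)`. What survives is `(f ∘ φ) ⊗ σx - f ⊗ (φ·σx) + f ⊗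
(δH + Hδ)x`; the inductive hypothesis turns this into `(f ∘ φ) ⊗ σx - f ⊗ x`, and naturality
identifies its first term with `φ·σ(f ⊗ x)`. -/
theorem allδ_allHomotopy {A B : C.SB.Obj} (x : C.SB.allChains A B) :
    C.SB.allδ A B (C.allHomotopy A B x) + C.allHomotopy A B (C.SB.allδ A B x) =
      C.SB.allLmul (C.toShift A) (C.allStrip x) - x := by
  refine C.SB.all_ext
    (f := C.SB.allδ A B ∘ₗ C.allHomotopy A B + C.allHomotopy A B ∘ₗ C.SB.allδ A B)
    (g := C.SB.allLmul (C.toShift A) ∘ₗ C.allStrip - LinearMap.id) (fun L c => ?_) x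
  simp only [LinearMap.comp_apply, LinearMap.add_apply, LinearMap.sub_apply, LinearMap.id_apply]
  induction L generalizing A with
  | nil =>
    -- For an empty list both operators vanish, and the right side vanishes because `φ ∘ f^0_0 ∘ φ⁻¹
    -- = f`.
    rw [allδ_inj, allHomotopy_inj, List.length_nil, Finset.sum_range_zero, Finset.sum_range_zero,
      map_zero, map_zero, add_zero, allStrip_inj, allLmul_inj, eq_comm, sub_eq_zero]
    exact congrArg _ (C.toShift_comp_unshiftHom_ofShift c)
  | cons X L ih =>
    refine chain_ext
      (F := (C.SB.allδ A B ∘ₗ C.allHomotopy A B + C.allHomotopy A B ∘ₗ C.SB.allδ A B) ∘ₗ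
        C.SB.allInj (X :: L))
      (G := (C.SB.allLmul (C.toShift A) ∘ₗ C.allStrip - LinearMap.id) ∘ₗ C.SB.allInj (X :: L))
      (fun f c => ?_) c
    simp only [LinearMap.comp_apply, LinearMap.add_apply, LinearMap.sub_apply, LinearMap.id_apply]
    -- The inductive hypothesis for the tail, tensored with `f` on the left.
    have h := congrArg (C.SB.allCons f) (ih (C.SB.allInj L c) c)
    rw [map_add, map_sub] at h
    rw [← allCons_inj, allHomotopy_cons, map_sub, allδ_cons, allδ_cons, allδ_cons, allδ_cons,
      map_sub, map_sub, allHomotopy_cons, allHomotopy_lmul, allδ_allStrip, allStrip_cons,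
      allLmul_allCons, allLmul_allCons, toShift_comp]
    rw [← sub_eq_zero] at h ⊢
    rw [← h]
    abel

end DGCategory
end SuspendedEnvelope

/-! ### The prism operator as a bimodule homotopy on `Bar(SB(C))`. -/

section BarSuspendedEnvelope
universe u v w o
variable {k : Type u} [CommRing k] {Γ : Type v} [AddCommGroup Γ] {S : GradingDatum Γ}

theorem sgn_pair_barShift_add_two (r : ℕ) (a : Γ) :
    sgn k (S.pair (barShift S (r + 2)) a) = sgn k (S.pair (barShift S r) a) := by
  rw [← barShift_succ r, ← barShift_succ (r + 1)]
  simp only [map_add, AddMonoidHom.add_apply, sgn_add, mul_assoc, sgn_mul_self, mul_one]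

theorem DGModule.signOp_barShift_add_two (M : DGModule k S) (r : ℕ) (x : M) :
    M.signOp (barShift S (r + 2)) x = M.signOp (barShift S r) x := by
  rw [← barShift_succ r, ← barShift_succ (r + 1)]
  simp only [signOp_add, signOp_self]

namespace DGCategory
variable (C : DGCategory.{u, v, w, o} k S)

/-- The homotopy `[f₀, …, f_{r+1}] ↦ ∑_u (-1)^u [f₀, …, f_u, φ, (f_{u+1})^0_0, …]`. -/
def barHomotopy (A B : C.SB.Obj) : C.SB.barSum A B →ₗ[k] C.SB.barSum A B :=
  C.SB.barDesc fun X L => ∑ u ∈ Finset.range (L.length + 1),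
    (-1 : k) ^ u • (C.SB.ofChain (C.insertList u (X :: L)) ∘ₗ C.insertion u (X :: L) A)

theorem barHomotopy_inj {A B : C.SB.Obj} (X : C.SB.Obj) (L : List C.SB.Obj)
    (c : C.SB.chain A (X :: L) B) : C.barHomotopy A B (C.SB.barInj X L c) =
      ∑ u ∈ Finset.range (L.length + 1),
        (-1 : k) ^ u • C.SB.ofChain (C.insertList u (X :: L)) (C.insertion u (X :: L) A c) := by
  rw [barHomotopy, barDesc_inj]
  simp only [LinearMap.sum_apply, LinearMap.smul_apply, LinearMap.comp_apply]

theorem length_insertList_cons (X : C.SB.Obj) (L : List C.SB.Obj) {u : ℕ}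
    (hu : u ∈ Finset.range (L.length + 1)) :
    (C.insertList u (X :: L)).length = L.length + 2 := by
  rw [Finset.mem_range] at hu
  rw [C.length_insertList (by simpa using hu), List.length_cons]

/-- Truncation kills the empty list, and so does the prism operator, whose sum is then empty; hence
it descends to the bar complex. -/
theorem barHomotopy_allDesc {A B : C.SB.Obj} (x : C.SB.allChains A B) :
    C.barHomotopy A B (C.SB.allDesc C.SB.ofChain x) =
      C.SB.allDesc C.SB.ofChain (C.allHomotopy A B x) := by
  refine C.SB.all_ext (f := C.barHomotopy A B ∘ₗ C.SB.allDesc C.SB.ofChain)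
    (g := C.SB.allDesc C.SB.ofChain ∘ₗ C.allHomotopy A B) (fun L c => ?_) x
  simp only [LinearMap.comp_apply]
  rw [allDesc_inj, allHomotopy_inj, map_sum]
  cases L with
  | nil =>
    rw [List.length_nil, Finset.sum_range_zero]
    exact map_zero (C.barHomotopy A B)
  | cons X L =>
    rw [ofChain, barHomotopy_inj]
    refine Finset.sum_congr rfl fun i _ => ?_
    rw [map_smul, allDesc_inj]

theorem barHomotopy_mem {A B : C.SB.Obj} {n : Γ} {x : C.SB.barSum A B}
    (hx : x ∈ (C.SB.barSum A B).deg n) :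
    C.barHomotopy A B x ∈ (C.SB.barSum A B).deg (n + -S.ι) := by
  refine C.SB.bar_mem _ (C.barHomotopy A B) n (fun X L c hc => ?_) hx
  rw [barHomotopy_inj]
  refine Submodule.sum_mem _ fun u hu => Submodule.smul_mem _ _ ?_
  -- An insertion produces `L.length + 2` intermediate objects. `ofChain_mem` raises the degree by
  -- `ι`, so it is applied at `n - 2ι` to land in `n - ι`.
  have h := C.SB.ofChain_mem (n := n + -S.ι + -S.ι) _ (C.length_insertList_cons X L hu)
    (c := C.insertion u (X :: L) A c) (by
      rw [show n + -S.ι + -S.ι - barShift S (L.length + 2) = n - barShift S L.length by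
        rw [← barShift_succ L.length, ← barShift_succ (L.length + 1)]; abel]
      exact C.insertion_mem u (X :: L) hc)
  rwa [neg_add_cancel_right] at h

/-- Insertion commutes with the differential of chains, while raising `r` by one flips the sign
which the shift `q^{-rι}` puts on it. So the internal differential contributes nothing to the
differential of the homotopy. -/
theorem barHomotopy_d {A B : C.SB.Obj} (x : C.SB.barSum A B) :
    (C.SB.barSum A B).d (C.barHomotopy A B x) + C.barHomotopy A B ((C.SB.barSum A B).d x) = 0 := by
  refine C.SB.bar_ext (f := (C.SB.barSum A B).d ∘ₗ C.barHomotopy A B +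
    C.barHomotopy A B ∘ₗ (C.SB.barSum A B).d) (g := 0) (fun X L c => ?_) x
  simp only [LinearMap.comp_apply, LinearMap.add_apply, LinearMap.zero_apply]
  rw [barHomotopy_inj, barSum_d_inj, map_smul, barHomotopy_inj, map_sum, Finset.smul_sum,
    ← Finset.sum_add_distrib]
  refine Finset.sum_eq_zero fun u hu => ?_
  rw [map_smul, C.SB.ofChain_d _ (C.length_insertList_cons X L hu), d_insertion,
    sgn_pair_barShift_add_two]
  module

/-- Insertions never touch `f₀`, hence commute with unsigned left multiplication; the sign comes
from the raised `r` in the definition of the left action. -/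
theorem barHomotopy_lact {A' A B : C.SB.Obj} (f : C.SB.hom A' A) (x : C.SB.barSum A B) :
    C.barHomotopy A' B (C.SB.barLact f x) =
      C.SB.barLact ((C.SB.hom A' A).signOp S.ι f) (C.barHomotopy A B x) := by
  refine C.SB.bar_ext (f := C.barHomotopy A' B ∘ₗ C.SB.barLact f)
    (g := C.SB.barLact ((C.SB.hom A' A).signOp S.ι f) ∘ₗ C.barHomotopy A B) (fun X L c => ?_) x
  simp only [LinearMap.comp_apply]
  rw [barLact_inj, barHomotopy_inj, barHomotopy_inj, map_sum]
  refine Finset.sum_congr rfl fun u hu => ?_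
  rw [map_smul, C.SB.barLact_ofChain f _ (C.length_insertList_cons X L hu), insertion_lmul,
    DGModule.signOp_barShift_add_two]

theorem barHomotopy_ract {A B B' : C.SB.Obj} (x : C.SB.barSum A B) (g : C.SB.hom B B') :
    C.barHomotopy A B' (C.SB.barRact x g) = C.SB.barRact (C.barHomotopy A B x) g := by
  refine C.SB.bar_ext (f := C.barHomotopy A B' ∘ₗ C.SB.barRact.flip g)
    (g := C.SB.barRact.flip g ∘ₗ C.barHomotopy A B) (fun X L c => ?_) x
  simp only [LinearMap.comp_apply, LinearMap.flip_apply]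
  rw [barRact_inj, barHomotopy_inj, barHomotopy_inj, map_sum, LinearMap.sum_apply]
  refine Finset.sum_congr rfl fun u hu => ?_
  rw [map_smul, LinearMap.smul_apply, barRact_ofChain, insertion_rmul]

/-- `barHomotopy` as a morphism of bimodules of degree `-ι`. -/
def barHomotopyHom : DGBimodule.Hom C.SB.Bar C.SB.Bar (-S.ι) where
  app := C.barHomotopy
  app_mem hm := C.barHomotopy_mem hm
  app_lact {A' A B i f} m hf := by
    refine (C.barHomotopy_lact f m).trans ?_
    rw [DGModule.signOp_of_mem _ _ hf, map_neg, AddMonoidHom.neg_apply, CharTwo.neg_eq, map_smul,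
      LinearMap.smul_apply]
    rfl
  app_ract m g := C.barHomotopy_ract m g

/-! ### Calculus of the elements `g ⊗ x ⊗ g'`. -/

variable {C}

/-- The element `g ⊗ x ⊗ g'` of `SB(C) ⊗_C Bar(C) ⊗_C SB(C)`. -/
def tripleTmul {A B : C.SB.Obj} {Y Y' : C.Obj} (g : C.SB.hom A (C.η.obj Y)) (x : C.Bar.val Y Y')
    (g' : C.SB.hom (C.η.obj Y') B) : C.SBBarSB.val A B :=
  sandwich g x g'

theorem tripleTmul_mem {A B : C.SB.Obj} {Y Y' : C.Obj} {a b c n : Γ} {g : C.SB.hom A (C.η.obj Y)}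
    {x : C.Bar.val Y Y'} {g' : C.SB.hom (C.η.obj Y') B} (hg : g ∈ (C.SB.hom A (C.η.obj Y)).deg a)
    (hx : x ∈ (C.Bar.val Y Y').deg b) (hg' : g' ∈ (C.SB.hom (C.η.obj Y') B).deg c)
    (h : a + b + c = n) : tripleTmul g x g' ∈ (C.SBBarSB.val A B).deg n :=
  DGBimodule.tmul_mem _ _ (DGBimodule.tmul_mem ((DGFunctor.id C.SB).bimodule C.η) C.Bar hg hx rfl)
    hg' h

theorem tripleTmul_lact {A' A B : C.SB.Obj} {Y Y' : C.Obj} (f : C.SB.hom A' A)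
    (g : C.SB.hom A (C.η.obj Y)) (x : C.Bar.val Y Y') (g' : C.SB.hom (C.η.obj Y') B) :
    C.SBBarSB.lact f (tripleTmul g x g') = tripleTmul (C.SB.comp f g) x g' := by
  refine (DGBimodule.tensorLact_tmul _ _ f _ _).trans ?_
  exact congrArg (fun t => DGBimodule.tmul _ (C.η.bimodule (DGFunctor.id C.SB)) t g')
    (DGBimodule.tensorLact_tmul ((DGFunctor.id C.SB).bimodule C.η) C.Bar f g x)

theorem tripleTmul_ract {A B B' : C.SB.Obj} {Y Y' : C.Obj}
    (g : C.SB.hom A (C.η.obj Y)) (x : C.Bar.val Y Y') (g' : C.SB.hom (C.η.obj Y') B)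
    (f : C.SB.hom B B') :
    C.SBBarSB.ract (tripleTmul g x g') f = tripleTmul g x (C.SB.comp g' f) :=
  DGBimodule.tensorRact_tmul _ (C.η.bimodule (DGFunctor.id C.SB)) _ g' f

theorem tripleTmul_balanced_left {A B : C.SB.Obj} {X Y Y' : C.Obj} (g : C.SB.hom A (C.η.obj X))
    (f : C.hom X Y) (x : C.Bar.val Y Y') (g' : C.SB.hom (C.η.obj Y') B) :
    tripleTmul (C.SB.comp g (C.η.map f)) x g' = tripleTmul g (C.Bar.lact f x) g' :=
  congrArg (fun t => DGBimodule.tmul _ (C.η.bimodule (DGFunctor.id C.SB)) t g')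
    (DGBimodule.tmul_balanced ((DGFunctor.id C.SB).bimodule C.η) C.Bar g f x)

theorem tripleTmul_balanced_right {A B : C.SB.Obj} {Y Y' Z : C.Obj} (g : C.SB.hom A (C.η.obj Y))
    (x : C.Bar.val Y Y') (f : C.hom Y' Z) (g' : C.SB.hom (C.η.obj Z) B) :
    tripleTmul g (C.Bar.ract x f) g' = tripleTmul g x (C.SB.comp (C.η.map f) g') := by
  refine Eq.trans ?_ (DGBimodule.tmul_balanced _ (C.η.bimodule (DGFunctor.id C.SB)) _ f g')
  exact congrArg (fun t => DGBimodule.tmul _ (C.η.bimodule (DGFunctor.id C.SB)) t g')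
    (DGBimodule.tensorRact_tmul ((DGFunctor.id C.SB).bimodule C.η) C.Bar g x f).symm

/-- `t ↦ t ⊗ g'` as a linear map. -/
def tmulRight {A B : C.SB.Obj} {Y' : C.Obj} (g' : C.SB.hom (C.η.obj Y') B) :
    (((DGFunctor.id C.SB).bimodule C.η).tensor C.Bar).val A Y' →ₗ[k] C.SBBarSB.val A B :=
  (DGBimodule.tmul (((DGFunctor.id C.SB).bimodule C.η).tensor C.Bar)
    (C.η.bimodule (DGFunctor.id C.SB)) (Y := Y')).flip g'

/-- `x ↦ g · x · g'` as a linear map. -/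
def tripleTmulMap {A B : C.SB.Obj} {Y Y' : C.Obj} (g : C.SB.hom A (C.η.obj Y))
    (g' : C.SB.hom (C.η.obj Y') B) : C.Bar.val Y Y' →ₗ[k] C.SBBarSB.val A B :=
  tmulRight g' ∘ₗ DGBimodule.tmul ((DGFunctor.id C.SB).bimodule C.η) C.Bar (Y := Y) g

theorem tripleTmul_zero_left {A B : C.SB.Obj} {Y Y' : C.Obj} (x : C.Bar.val Y Y')
    (g' : C.SB.hom (C.η.obj Y') B) :
    tripleTmul (0 : C.SB.hom A (C.η.obj Y)) x g' = 0 := by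
  let F : C.SB.hom A (C.η.obj Y) →ₗ[k] C.Bar.val Y Y' →ₗ[k]
    (((DGFunctor.id C.SB).bimodule C.η).tensor C.Bar).val A Y' :=
      DGBimodule.tmul ((DGFunctor.id C.SB).bimodule C.η) C.Bar
  change tmulRight g' (F 0 x) = 0
  rw [map_zero, LinearMap.zero_apply, map_zero]

theorem tripleTmul_zero_right {A B : C.SB.Obj} {Y Y' : C.Obj} (g : C.SB.hom A (C.η.obj Y))
    (x : C.Bar.val Y Y') : tripleTmul g x (0 : C.SB.hom (C.η.obj Y') B) = 0 := by
  let F : (((DGFunctor.id C.SB).bimodule C.η).tensor C.Bar).val A Y' →ₗ[k]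
    C.SB.hom (C.η.obj Y') B →ₗ[k] C.SBBarSB.val A B :=
      DGBimodule.tmul _ (C.η.bimodule (DGFunctor.id C.SB))
  let t : (((DGFunctor.id C.SB).bimodule C.η).tensor C.Bar).val A Y' :=
    DGBimodule.tmul ((DGFunctor.id C.SB).bimodule C.η) C.Bar g x
  change F t 0 = 0
  rw [map_zero]

theorem d_tripleTmul_of_mem {A B : C.SB.Obj} {Y Y' : C.Obj} {a b : Γ} {g : C.SB.hom A (C.η.obj Y)}
    (hg : g ∈ (C.SB.hom A (C.η.obj Y)).deg a) {x : C.Bar.val Y Y'} (hx : x ∈ (C.Bar.val Y Y').deg b)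
    (g' : C.SB.hom (C.η.obj Y') B) :
    (C.SBBarSB.val A B).d (tripleTmul g x g') = tripleTmul ((C.SB.hom A (C.η.obj Y)).d g) x g' +
      sgn k (S.pair S.ι a) • tripleTmul g ((C.Bar.val Y Y').d x) g' +
      sgn k (S.pair S.ι (a + b)) • tripleTmul g x ((C.SB.hom (C.η.obj Y') B).d g') := by
  refine (DGBimodule.tmul_d _ (C.η.bimodule (DGFunctor.id C.SB)) g'
    (DGBimodule.tmul_mem ((DGFunctor.id C.SB).bimodule C.η) C.Bar hg hx rfl)).trans ?_
  refine congrArg (· + _) ?_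
  refine (congrArg (tmulRight g')
    (DGBimodule.tmul_d ((DGFunctor.id C.SB).bimodule C.η) C.Bar x hg)).trans ?_
  refine (map_add (tmulRight g') _ _).trans ?_
  exact congrArg (_ + ·) (map_smul (tmulRight g') _ _)

/-- With closed outer factors only the middle term of the Leibniz rule survives. The reduction to
homogeneous `x` is needed since the sign of the last term, before it vanishes, depends on `|x|`. -/
theorem d_tripleTmul {A B : C.SB.Obj} {Y Y' : C.Obj} {a : Γ} {g : C.SB.hom A (C.η.obj Y)}
    (hg : g ∈ (C.SB.hom A (C.η.obj Y)).deg a) (hd : (C.SB.hom A (C.η.obj Y)).d g = 0)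
    {g' : C.SB.hom (C.η.obj Y') B} (hd' : (C.SB.hom (C.η.obj Y') B).d g' = 0) (x : C.Bar.val Y Y') :
    (C.SBBarSB.val A B).d (tripleTmul g x g') =
      sgn k (S.pair S.ι a) • tripleTmul g ((C.Bar.val Y Y').d x) g' := by
  refine (C.Bar.val Y Y').hom_ext (f := (C.SBBarSB.val A B).d ∘ₗ tripleTmulMap g g')
    (g := sgn k (S.pair S.ι a) • tripleTmulMap g g' ∘ₗ (C.Bar.val Y Y').d) (fun b x hx => ?_) x
  refine (d_tripleTmul_of_mem hg hx g').trans ?_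
  rw [hd, hd', tripleTmul_zero_left, tripleTmul_zero_right, zero_add, smul_zero, add_zero]
  rfl

theorem SBBarSB_ext {A B : C.SB.Obj} {P : Type*} [AddCommGroup P] [Module k P]
    {F G : C.SBBarSB.val A B →ₗ[k] P}
    (h : ∀ (Y Y' : C.Obj) (a b c : Γ), ∀ g ∈ (C.SB.hom A (C.η.obj Y)).deg a,
      ∀ x ∈ (C.Bar.val Y Y').deg b, ∀ g' ∈ (C.SB.hom (C.η.obj Y') B).deg c,
      F (tripleTmul g x g') = G (tripleTmul g x g')) (t : C.SBBarSB.val A B) : F t = G t := by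
  refine DGBimodule.tmul_ext _ (C.η.bimodule (DGFunctor.id C.SB)) (f := F) (g := G)
    (fun Y' _ c t _ g' hg' => ?_) t
  exact DGBimodule.tmul_ext ((DGFunctor.id C.SB).bimodule C.η) C.Bar
    (f := F ∘ₗ tmulRight g')
    (g := G ∘ₗ tmulRight g')
    (fun Y a b g hg x hx => h Y Y' a b c g hg x hx g' hg') t

theorem SBBarSB_map_mem {A B : C.SB.Obj} {P : Type*} [AddCommGroup P] [Module k P]
    (Q : Submodule k P) (F : C.SBBarSB.val A B →ₗ[k] P) (n : Γ)
    (h : ∀ (Y Y' : C.Obj) (a b c : Γ), ∀ g ∈ (C.SB.hom A (C.η.obj Y)).deg a,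
      ∀ x ∈ (C.Bar.val Y Y').deg b, ∀ g' ∈ (C.SB.hom (C.η.obj Y') B).deg c, a + b + c = n →
      F (tripleTmul g x g') ∈ Q) {t : C.SBBarSB.val A B} (ht : t ∈ (C.SBBarSB.val A B).deg n) :
    F t ∈ Q := by
  refine DGBimodule.tensorVal_le _ (C.η.bimodule (DGFunctor.id C.SB)) Q F n
    (fun Y' a' c t ht g' hg' hn => ?_) ht
  exact DGBimodule.tensorVal_le ((DGFunctor.id C.SB).bimodule C.η) C.Bar Q
    (F ∘ₗ tmulRight g') a'
    (fun Y a b g hg x hx hab => h Y Y' a b c g hg x hx g' hg' (hab ▸ hn)) ht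

/-! ### The comparison morphism: closedness and uniqueness. -/

variable (C)

/-- The comparison morphism `Ξ_SB`. -/
def xiSB : DGBimodule.Hom C.SB.Bar C.SBBarSB 0 where
  app A B := tripleTmulMap (C.φ A.obj A.shift) (C.φinv B.obj B.shift) ∘ₗ C.bareSusp.barMap A B
  app_mem {A B i x} hx := by
    refine tripleTmul_mem (C.φ_mem _ _) (C.bareSusp.barMap_mem hx) (C.φinv_mem _ _) ?_
    -- The degrees of `φ` and `φ⁻¹` undo the degree change of `barMap`.
    change A.shift + (i + B.shift - A.shift) + -B.shift = i + 0
    abel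
  app_lact {A' A B i f} x hf := by
    have h := C.bareSusp.barMap_lact f x
    rw [map_zero, AddMonoidHom.zero_apply, sgn_zero, one_smul]
    refine (congrArg (tripleTmulMap (C.φ A'.obj A'.shift) (C.φinv B.obj B.shift)) h).trans ?_
    -- The underlying morphism of `f` crosses the tensor sign to meet `φ`, and naturality turns it
    -- into `f` itself on the outside.
    refine (tripleTmul_balanced_left _ (C.bareSusp.map f) _ _).symm.trans ?_
    refine Eq.trans ?_ (tripleTmul_lact f _ _ _).symm
    exact congrArg (fun g => tripleTmul g _ _) (C.toShift_comp f)
  app_ract {A B B'} x g := by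
    have h := C.bareSusp.barMap_ract x g
    refine (congrArg (tripleTmulMap (C.φ A.obj A.shift) (C.φinv B'.obj B'.shift)) h).trans ?_
    -- The mirror image, with naturality of `φ⁻¹`.
    refine (tripleTmul_balanced_right _ _ (C.bareSusp.map g) _).trans ?_
    refine Eq.trans ?_ (tripleTmul_ract _ _ _ g).symm
    exact congrArg (fun g' => tripleTmul _ _ g') (C.comp_ofShift g)

theorem xiSB_app (A B : C.SB.Obj) (x : C.SB.Bar.val A B) :
    C.xiSB.app A B x = tripleTmul (C.φ A.obj A.shift) (C.bareSusp.barMap A B x)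
      (C.φinv B.obj B.shift) := rfl

/-- The sign `(-1)^⟨ι,j⟩` arises twice, from moving `d` past `φ` of degree `j` and from `d_barMap`,
and squares to one. -/
theorem xiSB_isClosed : C.xiSB.IsClosed := by
  intro A B
  refine LinearMap.ext fun x => ?_
  rw [DGBimodule.Hom.diff, map_zero, sgn_zero, one_smul, LinearMap.sub_apply, LinearMap.zero_apply,
    sub_eq_zero, LinearMap.comp_apply, LinearMap.comp_apply]
  let F := tripleTmulMap (C.φ A.obj A.shift) (C.φinv B.obj B.shift)
  refine (d_tripleTmul (C.φ_mem A.obj A.shift) (C.d_φ _ _) (C.d_φinv B.obj B.shift)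
    (C.bareSusp.barMap A B x)).trans ?_
  refine (congrArg (fun t => sgn k (S.pair S.ι A.shift) • F t) (C.bareSusp.d_barMap x)).trans ?_
  refine (congrArg (fun t => sgn k (S.pair S.ι A.shift) • t) (map_smul F _ _)).trans ?_
  refine (smul_smul _ _ _).trans ?_
  refine (congrArg (fun t : k => t • _) (sgn_mul_self (S.pair S.ι A.shift))).trans ?_
  exact one_smul _ _

theorem pair_barShift (r : ℕ) (a : Γ) : S.pair (barShift S r) a = (r : ZMod 2) * S.pair S.ι a := by
  rw [barShift, map_neg, AddMonoidHom.neg_apply, CharTwo.neg_eq, map_nsmul, AddMonoidHom.smul_apply,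
    nsmul_eq_mul]

theorem xiSB_isXiSB : C.IsXiSB C.xiSB.app := by
  intro A B X L s
  rw [xiSB_app]
  refine (congrArg (tripleTmulMap (C.φ A.obj A.shift) (C.φinv B.obj B.shift))
    (C.bareSusp.barMap_inj X L s.pure)).trans ?_
  refine (map_smul (tripleTmulMap (C.φ A.obj A.shift) (C.φinv B.obj B.shift)) _ _).trans ?_
  rw [pair_barShift]
  refine congrArg₂ _ rfl (congrArg _ (congrArg _ ?_))
  exact C.bareSusp_chainMap_pure s

/-- The formula fixes the values on brackets, which span each summand of the bar complex. -/
theorem IsXiSB.unique {ξ ξ' : ∀ A B : C.SB.Obj, C.SB.Bar.val A B →ₗ[k] C.SBBarSB.val A B}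
    (h : C.IsXiSB ξ) (h' : C.IsXiSB ξ') : ξ = ξ' := by
  funext A B
  refine LinearMap.ext fun x => ?_
  refine C.SB.bar_ext (f := ξ A B) (g := ξ' A B) (fun X L c => ?_) x
  exact C.SB.seq_pure_ext (F := ξ A B ∘ₗ C.SB.barInj X L) (G := ξ' A B ∘ₗ C.SB.barInj X L)
    (fun s => (h A B X L s).trans (h' A B X L s).symm) c

end DGCategory
end BarSuspendedEnvelope

/-! ### The homotopy inverse and the two composites. -/

section HomotopyInverse
universe u v w o
variable {k : Type u} [CommRing k] {Γ : Type v} [AddCommGroup Γ] {S : GradingDatum Γ}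

namespace DGCategory
variable (C : DGCategory.{u, v, w, o} k S)

/-- The map `Bar(C) → Bar(SB(C))` induced by `η`. -/
def ηBar (Y Y' : C.Obj) : C.Bar.val Y Y' →ₗ[k] C.SB.Bar.val (C.η.obj Y) (C.η.obj Y') :=
  C.ηSusp.barMap Y Y'

theorem ηBar_lact {X Y Y' : C.Obj} (f : C.hom X Y) (x : C.Bar.val Y Y') :
    C.ηBar X Y' (C.Bar.lact f x) = C.SB.Bar.lact (C.η.map f) (C.ηBar Y Y' x) :=
  C.ηSusp.barMap_lact f x

theorem ηBar_ract {Y Y' Z : C.Obj} (x : C.Bar.val Y Y') (f : C.hom Y' Z) :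
    C.ηBar Y Z (C.Bar.ract x f) = C.SB.Bar.ract (C.ηBar Y Y' x) (C.η.map f) :=
  C.ηSusp.barMap_ract x f

theorem ηBar_mem {Y Y' : C.Obj} {i : Γ} {x : C.Bar.val Y Y'} (hx : x ∈ (C.Bar.val Y Y').deg i) :
    C.ηBar Y Y' x ∈ (C.SB.Bar.val (C.η.obj Y) (C.η.obj Y')).deg i := by
  have h := C.ηSusp.barMap_mem hx
  rwa [show i + C.ηSusp.shift Y' - C.ηSusp.shift Y = i by
    change i + 0 - 0 = i; rw [add_zero, sub_zero]] at h

theorem d_ηBar {Y Y' : C.Obj} (x : C.Bar.val Y Y') :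
    (C.SB.Bar.val (C.η.obj Y) (C.η.obj Y')).d (C.ηBar Y Y' x) =
      C.ηBar Y Y' ((C.Bar.val Y Y').d x) := by
  refine (C.ηSusp.d_barMap x).trans ?_
  have h0 : C.ηSusp.shift Y = 0 := rfl
  rw [h0, map_zero, sgn_zero]
  exact one_smul _ _

/-- The bilinear map `(g, x) ↦ g · η(x)`. -/
def lactηBar (A : C.SB.Obj) (Y' Y : C.Obj) :
    ((DGFunctor.id C.SB).bimodule C.η).val A Y →ₗ[k] C.Bar.val Y Y' →ₗ[k]
      C.SB.Bar.val A (C.η.obj Y') :=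
  (C.SB.Bar.lact (X' := A) (X := C.η.obj Y)).compl₂ (C.ηBar Y Y')

theorem lactηBar_balanced (A : C.SB.Obj) (Y' Y Z : C.Obj)
    (g : ((DGFunctor.id C.SB).bimodule C.η).val A Y) (f : C.hom Y Z) (x : C.Bar.val Z Y') :
    C.lactηBar A Y' Z (((DGFunctor.id C.SB).bimodule C.η).ract g f) x =
      C.lactηBar A Y' Y g (C.Bar.lact f x) := by
  refine (C.SB.Bar.comp_lact g (C.η.map f) (C.ηBar Z Y' x)).trans ?_
  exact congrArg (C.SB.Bar.lact g) (C.ηBar_lact f x).symm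

/-- The map `g ⊗ x ↦ g · η(x)`. -/
def thetaLeft (A : C.SB.Obj) (Y' : C.Obj) :
    (((DGFunctor.id C.SB).bimodule C.η).tensor C.Bar).val A Y' →ₗ[k]
      C.SB.Bar.val A (C.η.obj Y') :=
  DGBimodule.tensorLift ((DGFunctor.id C.SB).bimodule C.η) C.Bar
    (C.lactηBar A Y') (C.lactηBar_balanced A Y')

theorem thetaLeft_tmul {A : C.SB.Obj} {Y Y' : C.Obj} (g : C.SB.hom A (C.η.obj Y))
    (x : C.Bar.val Y Y') :
    C.thetaLeft A Y' (DGBimodule.tmul ((DGFunctor.id C.SB).bimodule C.η) C.Bar g x) =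
      C.SB.Bar.lact g (C.ηBar Y Y' x) :=
  DGBimodule.tensorLift_tmul ((DGFunctor.id C.SB).bimodule C.η) C.Bar (C.lactηBar A Y')
    (C.lactηBar_balanced A Y') Y g x

theorem thetaLeft_ract {A : C.SB.Obj} {Y' Z : C.Obj}
    (t : (((DGFunctor.id C.SB).bimodule C.η).tensor C.Bar).val A Y') (f : C.hom Y' Z) :
    C.thetaLeft A Z ((((DGFunctor.id C.SB).bimodule C.η).tensor C.Bar).ract t f) =
      C.SB.Bar.ract (C.thetaLeft A Y' t) (C.η.map f) := by
  refine DGBimodule.tmul_ext ((DGFunctor.id C.SB).bimodule C.η) C.Bar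
    (f := C.thetaLeft A Z ∘ₗ (((DGFunctor.id C.SB).bimodule C.η).tensor C.Bar).ract.flip f)
    (g := C.SB.Bar.ract.flip (C.η.map f) ∘ₗ C.thetaLeft A Y') (fun Y a b g _ x _ => ?_) t
  refine (congrArg (C.thetaLeft A Z) (DGBimodule.tensorRact_tmul
    ((DGFunctor.id C.SB).bimodule C.η) C.Bar g x f)).trans ?_
  refine (C.thetaLeft_tmul g _).trans ?_
  refine (congrArg (C.SB.Bar.lact g) (C.ηBar_ract x f)).trans ?_
  refine (C.SB.Bar.lact_ract g _ _).symm.trans ?_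
  exact congrArg (fun y => C.SB.Bar.ract y (C.η.map f)) (C.thetaLeft_tmul g x).symm

/-- The map `g ⊗ x ⊗ g' ↦ g · η(x) · g'`. -/
def theta (A B : C.SB.Obj) : C.SBBarSB.val A B →ₗ[k] C.SB.Bar.val A B :=
  DGBimodule.tensorLift (((DGFunctor.id C.SB).bimodule C.η).tensor C.Bar)
    (C.η.bimodule (DGFunctor.id C.SB))
    (fun Y' => (C.SB.Bar.ract (Y := C.η.obj Y') (Y' := B)) ∘ₗ C.thetaLeft A Y')
    (fun Y' Z t f g' => by
      refine (congrArg (fun y => C.SB.Bar.ract y g') (C.thetaLeft_ract t f)).trans ?_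
      exact (C.SB.Bar.ract_comp _ (C.η.map f) g').symm)

theorem theta_tripleTmul {A B : C.SB.Obj} {Y Y' : C.Obj} (g : C.SB.hom A (C.η.obj Y))
    (x : C.Bar.val Y Y') (g' : C.SB.hom (C.η.obj Y') B) :
    C.theta A B (tripleTmul g x g') = C.SB.Bar.ract (C.SB.Bar.lact g (C.ηBar Y Y' x)) g' := by
  refine (DGBimodule.tensorLift_tmul _ (C.η.bimodule (DGFunctor.id C.SB)) _ _ Y' _ g').trans ?_
  exact congrArg (fun y => C.SB.Bar.ract y g') (C.thetaLeft_tmul g x)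

/-- The homotopy inverse of `Ξ_SB`. -/
def thetaSB : DGBimodule.Hom C.SBBarSB C.SB.Bar 0 where
  app := C.theta
  app_mem {A B i t} ht := by
    refine SBBarSB_map_mem _ (C.theta A B) i (fun Y Y' a b c g hg x hx g' hg' hn => ?_) ht
    rw [theta_tripleTmul, add_zero, ← hn]
    exact C.SB.Bar.ract_mem (C.SB.Bar.lact_mem hg (C.ηBar_mem hx)) hg'
  app_lact {A' A B i f} t hf := by
    rw [map_zero, AddMonoidHom.zero_apply, sgn_zero, one_smul]
    refine SBBarSB_ext (F := C.theta A' B ∘ₗ C.SBBarSB.lact f)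
      (G := C.SB.Bar.lact f ∘ₗ C.theta A B) (fun Y Y' a b c g hg x hx g' hg' => ?_) t
    rw [LinearMap.comp_apply, LinearMap.comp_apply, tripleTmul_lact, theta_tripleTmul,
      theta_tripleTmul,
      C.SB.Bar.comp_lact, C.SB.Bar.lact_ract]
  app_ract {A B B'} t f := by
    refine SBBarSB_ext (F := C.theta A B' ∘ₗ C.SBBarSB.ract.flip f)
      (G := C.SB.Bar.ract.flip f ∘ₗ C.theta A B) (fun Y Y' a b c g hg x hx g' hg' => ?_) t
    rw [LinearMap.comp_apply, LinearMap.comp_apply, LinearMap.flip_apply, LinearMap.flip_apply,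
      tripleTmul_ract, theta_tripleTmul, theta_tripleTmul, C.SB.Bar.ract_comp]

/-- The Leibniz rules of the two actions on `Bar(SB(C))` reproduce the three terms of `d (g ⊗ x ⊗
g')`, because `ηBar` preserves degrees and commutes with `d`. -/
theorem thetaSB_isClosed : C.thetaSB.IsClosed := by
  intro A B
  rw [DGBimodule.Hom.diff, map_zero, sgn_zero, one_smul, sub_eq_zero]
  refine LinearMap.ext (SBBarSB_ext fun Y Y' a b c g hg x hx g' hg' => ?_)
  rw [LinearMap.comp_apply, LinearMap.comp_apply, d_tripleTmul_of_mem hg hx, map_add, map_add,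
    map_smul, map_smul]
  change (C.SB.Bar.val A B).d (C.theta A B _) = C.theta A B _ + _ • C.theta A B _ +
    _ • C.theta A B _
  rw [theta_tripleTmul, theta_tripleTmul, theta_tripleTmul, theta_tripleTmul,
    C.SB.Bar.d_ract g' (C.SB.Bar.lact_mem hg (C.ηBar_mem hx)), C.SB.Bar.d_lact _ hg, d_ηBar,
    map_add C.SB.Bar.ract, map_smul C.SB.Bar.ract, LinearMap.add_apply, LinearMap.smul_apply]

/-- By bilinearity only `Ξ(η x)` matters. There the shifts are zero, so `φ` and `φ⁻¹` are
identities, and forgetting shifts undoes `η`. -/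
theorem xiSB_thetaSB (A B : C.SB.Obj) :
    C.xiSB.app A B ∘ₗ C.thetaSB.app A B = LinearMap.id := by
  refine LinearMap.ext (SBBarSB_ext fun Y Y' a b c g hg x hx g' hg' => ?_)
  refine (congrArg (C.xiSB.app A B) (C.theta_tripleTmul g x g')).trans ?_
  rw [C.xiSB.app_ract, C.xiSB.app_lact _ hg, map_zero, AddMonoidHom.zero_apply, sgn_zero, one_smul,
    xiSB_app]
  refine (congrArg (fun t => C.SBBarSB.ract t g') (tripleTmul_lact g _ _ _)).trans ?_
  refine (tripleTmul_ract _ _ _ g').trans ?_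
  have h1 : C.SB.comp g (C.φ Y 0) = g := C.SB.comp_one g
  have h2 : C.SB.comp (C.φinv Y' 0) g' = g' := C.SB.one_comp g'
  have h3 : C.bareSusp.barMap _ _ (C.ηBar Y Y' x) = x := C.bareSusp_barMap_ηSusp x
  refine (congrArg (fun t => tripleTmul t _ _) h1).trans ?_
  refine (congrArg (fun t => tripleTmul g _ t) h2).trans ?_
  exact congrArg (fun t => tripleTmul g t g') h3

/-- The sign in `Ξ` cancels the one created when `φ`, of degree `A.shift`, acts from the left on the
`r`-th term. The composite is therefore the endpoint `φ·σ` of the prism homotopy, with no sign. -/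
theorem thetaSB_xiSB_inj {A B : C.SB.Obj} (X : C.SB.Obj) (L : List C.SB.Obj)
    (c : C.SB.chain A (X :: L) B) : C.thetaSB.app A B (C.xiSB.app A B (C.SB.barInj X L c)) =
      C.SB.allDesc C.SB.ofChain
        (C.SB.allLmul (C.toShift A) (C.allStrip (C.SB.allInj (X :: L) c))) := by
  have h1 : C.bareSusp.barMap A B (C.SB.barInj X L c) =
      sgn k (S.pair (barShift S L.length) A.shift) • C.barInj X.obj (L.map SBObj.obj) (C.bareSusp.chainMap (X :: L) A c) :=
    C.bareSusp.barMap_inj X L c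
  have h2 := C.ηSusp.barMap_ofChain_of_shift_eq_zero _ (C.bareSusp.chainMap (X :: L) A c) rfl
  rw [SuspFunctor.allMap_inj, allDesc_ofChain_inj] at h2
  have hφ : (C.SB.hom A (C.unshift A)).signOp (barShift S L.length) (C.toShift A) =
      sgn k (S.pair (barShift S L.length) A.shift) • C.toShift A :=
    DGModule.signOp_of_mem _ _ (C.φ_mem A.obj A.shift)
  rw [allStrip_inj, allLmul_inj, allDesc_ofChain_inj]
  refine (C.theta_tripleTmul _ _ _).trans ?_
  refine (congrArg (fun y => C.SB.barRact (C.SB.barLact (C.toShift A) (C.ηSusp.barMap _ _ y))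
    (C.ofShift B)) h1).trans ?_
  rw [map_smul, map_smul, map_smul, LinearMap.smul_apply]
  refine (congrArg (fun y => sgn k (S.pair (barShift S L.length) A.shift) •
    C.SB.barRact (C.SB.barLact (C.toShift A) y) (C.ofShift B)) h2).trans ?_
  refine (congrArg (fun y => sgn k (S.pair (barShift S L.length) A.shift) •
    C.SB.barRact y (C.ofShift B)) (C.SB.barLact_inj _ _ _ _)).trans ?_
  rw [barRact_inj, List.length_map, List.length_map, hφ, map_smul (lmul _), LinearMap.smul_apply,
    map_smul (rmul _ _), LinearMap.smul_apply, map_smul (C.SB.barInj _ _), smul_smul, sgn_mul_self,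
    one_smul, lmul_rmul]
  rfl

theorem barHomotopy_d_add_barδ {A B : C.SB.Obj} (x : C.SB.barSum A B) :
    ((C.SB.barSum A B).d + C.SB.barδ A B) (C.barHomotopy A B x) +
        C.barHomotopy A B (((C.SB.barSum A B).d + C.SB.barδ A B) x) =
      C.SB.barδ A B (C.barHomotopy A B x) + C.barHomotopy A B (C.SB.barδ A B x) := by
  rw [LinearMap.add_apply, LinearMap.add_apply, map_add, add_add_add_comm, barHomotopy_d, zero_add]

/-- After the internal differential has dropped out, this is the truncation of `allδ_allHomotopy`.
-/
theorem thetaSB_xiSB (A B : C.SB.Obj) :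
    C.thetaSB.app A B ∘ₗ C.xiSB.app A B - LinearMap.id = C.barHomotopyHom.diff A B := by
  refine LinearMap.ext fun x => ?_
  -- The homotopy has odd degree, so its differential is the anticommutator `d ∘ H + H ∘ d`.
  have hs : sgn k (S.pair S.ι (-S.ι)) = -1 := by
    rw [map_neg, CharTwo.neg_eq, S.pair_ι, sgn_one]
  rw [DGBimodule.Hom.diff, hs, neg_one_smul, sub_neg_eq_add]
  refine Eq.trans (b := C.SB.barδ A B (C.barHomotopy A B x) + C.barHomotopy A B (C.SB.barδ A B x))
    ?_ ?_
  · refine C.SB.bar_ext (f := (C.thetaSB.app A B ∘ₗ C.xiSB.app A B - LinearMap.id))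
      (g := C.SB.barδ A B ∘ₗ C.barHomotopy A B + C.barHomotopy A B ∘ₗ C.SB.barδ A B)
      (fun X L c => ?_) x
    refine (congrArg (· - C.SB.barInj X L c) (C.thetaSB_xiSB_inj X L c)).trans ?_
    have h : C.SB.barInj X L c = C.SB.allDesc C.SB.ofChain (C.SB.allInj (X :: L) c) :=
      (C.SB.allDesc_ofChain_inj (X :: L) c).symm
    rw [LinearMap.add_apply, LinearMap.comp_apply, LinearMap.comp_apply, h, barHomotopy_allDesc,
      barδ_allDesc, barδ_allDesc, barHomotopy_allDesc, ← map_add, allδ_allHomotopy, map_sub]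
  · exact (C.barHomotopy_d_add_barδ x).symm

theorem xiSB_isHomotopyEquiv : C.xiSB.IsHomotopyEquiv := by
  -- The second homotopy is zero, since `Ξ ∘ Θ` equals the identity.
  refine ⟨C.xiSB_isClosed, C.thetaSB, C.barHomotopyHom, ⟨fun _ _ => 0,
    fun _ => Submodule.zero_mem _,
    fun _ _ => ?_, fun _ _ => ?_⟩, C.thetaSB_isClosed, C.thetaSB_xiSB, fun A B => ?_⟩
  · rw [LinearMap.zero_apply, LinearMap.zero_apply, map_zero, smul_zero]
  · rw [LinearMap.zero_apply, LinearMap.zero_apply, map_zero, LinearMap.zero_apply]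
  · rw [xiSB_thetaSB, sub_self, DGBimodule.Hom.diff, LinearMap.comp_zero, LinearMap.zero_comp,
      smul_zero, sub_zero]

end DGCategory
end HomotopyInverse
end DGEnv
end

theorem mainTheorem5 {k : Type*} [CommRing k] {Γ : Type*} [AddCommGroup Γ]
    {S : DGEnv.GradingDatum Γ} (C : DGEnv.DGCategory k S) :
    ∃ Ξ : DGEnv.DGBimodule.Hom C.SB.Bar C.SBBarSB 0,
      C.IsXiSB Ξ.app ∧
      (∀ ξ : ∀ A B : C.SB.Obj, C.SB.Bar.val A B →ₗ[k] C.SBBarSB.val A B,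
        C.IsXiSB ξ → ξ = Ξ.app) ∧
      Ξ.IsClosed ∧ Ξ.IsHomotopyEquiv :=
  ⟨C.xiSB, C.xiSB_isXiSB, fun _ h => h.unique C C.xiSB_isXiSB, C.xiSB_isClosed,
    C.xiSB_isHomotopyEquiv⟩
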